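/- Let $K$ be a field of characteristic $0$ (for instance $\mathbb C$ or $\mathbb C(q)$), let $q\in K$ be nonzero and not a root of unity, let $N\ge 1$, $M\ge 0$ be integers and put $n=N+M$. Let $\mathrm Y$ be one of the twisted $q$-Yangians $\mathrm Y_q^{\mathrm{tw}}(\mathfrak o_{n})$ or, if $n$ is even, $\mathrm Y_q^{\mathrm{tw}}(\mathfrak{sp}_{n})$. *The algebras.* Let $$R(x,y)=(x-y)\sum_{i\ne j}E_{ii}\otimes E_{jj}+(q^{-1}x-qy)\sum_iE_{ii}\otimes E_{ii}+(q^{-1}-q)x\sum_{i>j}E_{ij}\otimes E_{ji}+(q^{-1}-q)y\sum_{i<j}E_{ij}\otimes E_{ji},$$ and let $R^t$ be its transpose in the first tensor factor. $\mathrm Y_q^{\mathrm{tw}}(\mathfrak o_n)$ is the unital associative algebra with generators $s_{ij}^{(r)}$ ($1\le i,j\le n$, $r\ge 0$) and relations $s^{(0)}_{ij}=0$ for $i<j$, $s^{(0)}_{ii}=1$, and, for $S(u)=(s_{ij}(u))$ with $s_{ij}(u)=\sum_{r\ge0}s_{ij}^{(r)}u^{-r}$, $$R(u,v)S_1(u)R^t(u^{-1},v)S_2(v)=S_2(v)R^t(u^{-1},v)S_1(u)R(u,v).$$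 $\mathrm Y_q^{\mathrm{tw}}(\mathfrak{sp}_n)$ is generated by the $s_{ij}^{(r)}$ and elements $(s_{ii'}^{(0)})^{-1}$, $i=1,3,\dots,n-1$, $i'=i+1$, with the same last relation and $s^{(0)}_{ij}=0$ for $i<j$ with $(i,j)$ not one of the pairs $(1,2),(3,4),\dots$; $s^{(0)}_{i'i'}s^{(0)}_{ii}-q^2s^{(0)}_{i'i}s^{(0)}_{ii'}=q^3$ and $s^{(0)}_{ii'}(s^{(0)}_{ii'})^{-1}=(s^{(0)}_{ii'})^{-1}s^{(0)}_{ii'}=1$ for $i=1,3,\dots,n-1$. *Minors.* Let $\overline R(x)=R(x,1)/(x-1)$. On $(K^n)^{\otimes m}$ let $A^q_m=\frac1{m!}\sum_{\sigma\in\mathfrak S_m}\mathrm{sgn}(\sigma)P^q_\sigma$, where $\sigma\mapsto P^q_\sigma$ is the action of $\mathfrak S_m$ in which $(k,k+1)$ acts by $P^q=\sum_iE_{ii}\otimes E_{ii}+q\sum_{i>j}E_{ij}\otimes E_{ji}+q^{-1}\sum_{i<j}E_{ij}\otimes E_{ji}$ in the factors $k,k+1$. Put $u_k=q^{2-2k}u$,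 $S_k=S(u_k)$ acting in the $k$-th factor, $\overline R^t_{kl}=\overline R^t_{kl}(u_k^{-1}u_l^{-1})$ (series in $u^{-1}$), and $$\langle S_1,\dots,S_m\rangle=S_1(\overline R^t_{12}\cdots\overline R^t_{1m})S_2(\overline R^t_{23}\cdots\overline R^t_{2m})\cdots S_m.$$ The Sklyanin minor $s^{i_1\cdots i_m}_{j_1\cdots j_m}(u)$ is the coefficient of $E_{i_1j_1}\otimes\cdots\otimes E_{i_mj_m}$ in $m!\,A_m^q\langle S_1,\dots,S_m\rangle$, and $\mathrm{sdet}_qS(u)=s^{1\cdots n}_{1\cdots n}(u)$. The auxiliary minor $\check s^{i_1\cdots i_m}_{j_1\cdots j_{m-1},c}(u)$ is the coefficient of $E_{i_1j_1}\otimes\cdots\otimes E_{i_{m-1}j_{m-1}}\otimes E_{i_mc}$ in $m!\,A^q_m\langle S_1,\dots,S_{m-1}\rangle\overline R^t_{1m}\cdots\overline R^t_{m-1,m}$. **Theorem.** The matrix $S(u)$ is invertible over $\mathrm Y[[u^{-1}]]$. Let $C=\mathrm{diag}\big((-q)^{\frac{n-1}2},(-q)^{\frac{n-3}2},\dots,(-q)^{-\frac{n-1}2}\big)$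 (only conjugation by $C$ is used, $(C^{-1}TC)_{ij}=(-q)^{i-j}T_{ij}$, which involves only integral powers of $-q$) and $$X(u)=C^{-1}S(q^{-N-M}u)^{-1}C,$$ and let $\check X^{1,\dots,N}_{1,\dots,\hat a,\dots,N,b}$ denote the auxiliary minor of order $N$ formed from the matrix $X(u)$ with $q$ replaced by $q^{-1}$ everywhere in the definition of auxiliary minors. Then for all $1\le a,b\le N$, in $\mathrm Y[[u^{-1}]]$, $$s^{a,N+1,\dots,N+M}_{b,N+1,\dots,N+M}(u)=(-q)^{b-N}\,\mathrm{sdet}_qS(u)\;\check X^{1,\dots,N}_{1,\dots,\hat a,\dots,N,b}(q^{2-N-M}u).$$ -/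

import Mathlib

open scoped PowerSeries Kronecker

noncomputable section

namespace TwistedQ

/-! ### Operators on tensor powers

`End(Kⁿ)^{⊗ m} ⊗ B` is realised as the matrices over `B` whose rows and columns are indexed by
words `Fin m → Fin n`; the entry at `(I, J)` is the coefficient of
`E_{I₁J₁} ⊗ ⋯ ⊗ E_{IₘJₘ}`. Likewise the entry at `((i, k), (j, l))` of a matrix indexed by pairs
is the coefficient of `E_{ij} ⊗ E_{kl}`. All indices start at `0`. -/

section Operators

variable {n m : ℕ} {B : Type*}

/-- A matrix acting in the `k`-th tensor factor. -/
def onOne [Zero B] (k : Fin m) (T : Matrix (Fin n) (Fin n) B) :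
    Matrix (Fin m → Fin n) (Fin m → Fin n) B :=
  Matrix.of fun I J => if ∀ p, p ≠ k → I p = J p then T (I k) (J k) else 0

/-- A two-tensor acting in the tensor factors `k` and `l`. -/
def onTwo [Zero B] (k l : Fin m) (T : Matrix (Fin n × Fin n) (Fin n × Fin n) B) :
    Matrix (Fin m → Fin n) (Fin m → Fin n) B :=
  Matrix.of fun I J =>
    if ∀ p, p ≠ k → p ≠ l → I p = J p then T (I k, I l) (J k, J l) else 0

/-- Transposition of the first tensor factor. -/
def transposeFirst (T : Matrix (Fin n × Fin n) (Fin n × Fin n) B) :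
    Matrix (Fin n × Fin n) (Fin n × Fin n) B :=
  Matrix.of fun r c => T (c.1, r.2) (r.1, c.2)

/-- The trigonometric `R`-matrix
`R(x, y) = (x - y) ∑_{i ≠ j} E_ii ⊗ E_jj + (q⁻¹ x - q y) ∑_i E_ii ⊗ E_ii
  + (q⁻¹ - q) x ∑_{i > j} E_ij ⊗ E_ji + (q⁻¹ - q) y ∑_{i < j} E_ij ⊗ E_ji`. -/
def rMatrix {K : Type*} [Field K] [Ring B] [Algebra K B] (n : ℕ) (q : K) (x y : B) :
    Matrix (Fin n × Fin n) (Fin n × Fin n) B :=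
  Matrix.of fun r c =>
    if r = c then (if r.1 = r.2 then q⁻¹ • x - q • y else x - y)
    else if r = c.swap then (if c.1 < r.1 then (q⁻¹ - q) • x else (q⁻¹ - q) • y)
    else 0

end Operators

/-! ### The `q`-antisymmetrizer -/

section Antisymmetrizer

variable {K : Type*} [Field K] {n m : ℕ}

/-- The number of inversions of a word. -/
def inversions (I : Fin m → Fin n) : ℕ :=
  (Finset.univ.filter fun p : Fin m × Fin m => p.1 < p.2 ∧ I p.2 < I p.1).card

/-- `P^q = ∑_i E_ii ⊗ E_ii + q ∑_{i > j} E_ij ⊗ E_ji + q⁻¹ ∑_{i < j} E_ij ⊗ E_ji`. -/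
def qFlip (n : ℕ) (q : K) : Matrix (Fin n × Fin n) (Fin n × Fin n) K :=
  Matrix.of fun r c =>
    if r = c.swap then (if r.1 = c.1 then 1 else if c.1 < r.1 then q else q⁻¹) else 0

/-- The action `σ ↦ P^q_σ` of the symmetric group on `(Kⁿ)^{⊗ m}`. It is multiplicative
(`qPerm_one`, `qPerm_mul`) and sends the simple transposition `(k, k+1)` to `P^q` acting in the
factors `k` and `k + 1` (`qPerm_simple`); hence
`P^q_σ = P^q_{s₁} ⋯ P^q_{s_l}` for each decomposition `σ = s₁ ⋯ s_l`. -/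
def qPerm (n : ℕ) (q : K) (σ : Equiv.Perm (Fin m)) :
    Matrix (Fin m → Fin n) (Fin m → Fin n) K :=
  Matrix.of fun I J =>
    if I = J ∘ σ.symm then q ^ ((inversions I : ℤ) - (inversions J : ℤ)) else 0

theorem qPerm_one (q : K) : qPerm n q (1 : Equiv.Perm (Fin m)) = 1 := by
  ext I J
  by_cases h : I = J
  · subst h
    simp [qPerm, Equiv.Perm.one_def]
  · have : ¬ I = J ∘ (1 : Equiv.Perm (Fin m)).symm := by
      simpa [Equiv.Perm.one_def] using h
    simp [qPerm, h, Equiv.Perm.one_def]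

theorem qPerm_mul {q : K} (hq : q ≠ 0) (σ τ : Equiv.Perm (Fin m)) :
    qPerm n q (σ * τ) = qPerm n q σ * qPerm n q τ := by
  ext I J
  rw [Matrix.mul_apply, Finset.sum_eq_single (J ∘ τ.symm)]
  · have e : J ∘ (σ * τ).symm = (J ∘ τ.symm) ∘ σ.symm := by
      ext p; rfl
    simp only [qPerm, Matrix.of_apply, e, if_true]
    split_ifs with h
    · rw [← zpow_add₀ hq]; congr 1; ring
    · simp
  · intro L _ hL
    simp [qPerm, hL]
  · simp

theorem swap_lt_swap (k l : Fin m) (hkl : (l : ℕ) = k + 1) {x y : Fin m} (h : x < y)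
    (hne : ¬ (x = k ∧ y = l)) : Equiv.swap k l x < Equiv.swap k l y := by
  simp only [Equiv.swap_apply_def]
  rw [Fin.lt_def] at h ⊢
  simp only [Fin.ext_iff] at hne ⊢
  split_ifs <;> omega

theorem inversions_swap (k l : Fin m) (hkl : (l : ℕ) = k + 1) (J : Fin m → Fin n) :
    inversions (J ∘ Equiv.swap k l) + (if J l < J k then 1 else 0) =
      inversions J + (if J k < J l then 1 else 0) := by
  classical
  have hlt : k < l := by simp [Fin.lt_def, hkl]
  have split : ∀ I : Fin m → Fin n, inversions I =
      ((Finset.univ.filter fun p : Fin m × Fin m =>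
        p.1 < p.2 ∧ I p.2 < I p.1).erase (k, l)).card + (if I l < I k then 1 else 0) := by
    intro I
    by_cases h : I l < I k
    · rw [if_pos h, inversions]
      exact (Finset.card_erase_add_one (by simp [hlt, h])).symm
    · rw [if_neg h, inversions, Finset.erase_eq_of_notMem (by simp [h])]
      rfl
  have bij : ((Finset.univ.filter fun p : Fin m × Fin m =>
        p.1 < p.2 ∧ (J ∘ Equiv.swap k l) p.2 < (J ∘ Equiv.swap k l) p.1).erase (k, l)).card =
      ((Finset.univ.filter fun p : Fin m × Fin m =>
        p.1 < p.2 ∧ J p.2 < J p.1).erase (k, l)).card := by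
    refine Finset.card_equiv ((Equiv.swap k l).prodCongr (Equiv.swap k l)) ?_
    rintro ⟨x, y⟩
    have key : ∀ x y : Fin m, x < y ∧ ¬ (x = k ∧ y = l) →
        Equiv.swap k l x < Equiv.swap k l y ∧
          ¬ (Equiv.swap k l x = k ∧ Equiv.swap k l y = l) := by
      rintro x y ⟨h, hne⟩
      refine ⟨swap_lt_swap k l hkl h hne, ?_⟩
      rintro ⟨h1, h2⟩
      rw [Equiv.swap_apply_eq_iff, Equiv.swap_apply_left] at h1
      rw [Equiv.swap_apply_eq_iff, Equiv.swap_apply_right] at h2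
      subst h1 h2
      exact absurd h (not_lt.mpr hlt.le)
    have key' : (x < y ∧ ¬ (x = k ∧ y = l)) ↔
        (Equiv.swap k l x < Equiv.swap k l y ∧
          ¬ (Equiv.swap k l x = k ∧ Equiv.swap k l y = l)) := by
      refine ⟨key x y, fun h => ?_⟩
      have := key _ _ h
      simpa only [Equiv.swap_apply_self] using this
    simp only [Finset.mem_erase, Finset.mem_filter, Finset.mem_univ, true_and, ne_eq,
      Prod.mk.injEq, Function.comp_apply, Equiv.prodCongr_apply, Prod.map_apply]
    tauto
  rw [split (J ∘ Equiv.swap k l), split J, bij]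
  simp only [Function.comp_apply, Equiv.swap_apply_left, Equiv.swap_apply_right]
  ring

theorem qPerm_simple {q : K} (k l : Fin m) (hkl : (l : ℕ) = k + 1) :
    qPerm n q (Equiv.swap k l) = onTwo k l (qFlip n q) := by
  have hne : k ≠ l := by
    intro h
    rw [h] at hkl
    omega
  ext I J
  have iff1 : I = J ∘ (Equiv.swap k l).symm ↔
      (∀ p, p ≠ k → p ≠ l → I p = J p) ∧ I k = J l ∧ I l = J k := by
    rw [Equiv.symm_swap]
    constructor
    · rintro rfl
      refine ⟨fun p h1 h2 => ?_, ?_, ?_⟩ <;> simp [Equiv.swap_apply_of_ne_of_ne, *]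
    · rintro ⟨h, h1, h2⟩
      funext p
      by_cases hk : p = k
      · subst hk; simpa using h1
      · by_cases hl : p = l
        · subst hl; simpa using h2
        · simp [Equiv.swap_apply_of_ne_of_ne hk hl, h p hk hl]
  simp only [qPerm, onTwo, qFlip, Matrix.of_apply, iff1, Prod.swap_prod_mk, Prod.mk.injEq]
  by_cases h0 : ∀ p, p ≠ k → p ≠ l → I p = J p
  · by_cases h1 : I k = J l ∧ I l = J k
    · have hI : I = J ∘ Equiv.swap k l := by
        have := iff1.mpr ⟨h0, h1⟩
        rwa [Equiv.symm_swap] at this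
      have hinv := inversions_swap k l hkl J
      rw [← hI] at hinv
      rw [if_pos ⟨h0, h1⟩, if_pos h0, if_pos h1, h1.1]
      rcases lt_trichotomy (J l) (J k) with h | h | h
      · rw [if_neg h.ne, if_neg h.not_gt]
        rw [if_pos h, if_neg h.not_gt] at hinv
        rw [show (inversions I : ℤ) - inversions J = -1 by omega, zpow_neg_one]
      · rw [if_pos h]
        rw [h, if_neg (lt_irrefl _)] at hinv
        rw [show (inversions I : ℤ) - inversions J = 0 by omega, zpow_zero]
      · rw [if_neg h.ne', if_pos h]
        rw [if_pos h, if_neg h.not_gt] at hinv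
        rw [show (inversions I : ℤ) - inversions J = 1 by omega, zpow_one]
    · rw [if_neg (fun h => h1 h.2), if_pos h0, if_neg h1]
  · rw [if_neg (fun h => h0 h.1), if_neg h0]

/-- The `q`-antisymmetrizer `A^q_m = (1 / m!) ∑_σ sgn(σ) P^q_σ`. -/
def qAntisymmetrizer (n m : ℕ) (q : K) : Matrix (Fin m → Fin n) (Fin m → Fin n) K :=
  (m.factorial : K)⁻¹ • ∑ σ : Equiv.Perm (Fin m), (Equiv.Perm.sign σ : ℤ) • qPerm n q σ

end Antisymmetrizer

/-! ### Sklyanin minors and auxiliary minors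

A series in `u⁻¹` with coefficients in `A` is an element of `A⟦X⟧`, where `X` stands for `u⁻¹`. -/

section Minors

variable {K : Type*} [Field K] {A : Type*} [Ring A] [Algebra K A] {n m : ℕ}

/-- The series `f(c u)`, for `f(u)` a series in `u⁻¹`. -/
def scaleArg (c : K) (f : A⟦X⟧) : A⟦X⟧ :=
  PowerSeries.mk fun r => (c⁻¹ ^ r) • PowerSeries.coeff r f

/-- Scalar series as series with coefficients in `A`. -/
def toSeries (A : Type*) [Ring A] [Algebra K A] : K⟦X⟧ →+* A⟦X⟧ :=
  PowerSeries.map (algebraMap K A)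

/-- The scalar `c` as a constant series. -/
def constSeries (A : Type*) [Ring A] [Algebra K A] : K →+* A⟦X⟧ :=
  (PowerSeries.C : A →+* A⟦X⟧).comp (algebraMap K A)

/-- The normalised matrix `R̄(x) = R(x, 1) / (x - 1)`, expanded in powers of `u⁻¹`. -/
def rBar (n : ℕ) (q : K) (x : K⟦X⟧) : Matrix (Fin n × Fin n) (Fin n × Fin n) K⟦X⟧ :=
  (x - 1)⁻¹ • rMatrix n q x 1

/-- `R̄ᵗ_{kl}(u_k⁻¹ u_l⁻¹)` for the points `u_k = q^{-2k} u` (with `k = 0, …, m - 1`), acting in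
the factors `k` and `l`; here `u_k⁻¹ u_l⁻¹ = q^{2k + 2l} u⁻²`. -/
def rBarT (A : Type*) [Ring A] [Algebra K A] (n : ℕ) (q : K) (k l : Fin m) :
    Matrix (Fin m → Fin n) (Fin m → Fin n) A⟦X⟧ :=
  onTwo k l ((transposeFirst (rBar n q
    (PowerSeries.C (q ^ (2 * (k : ℕ) + 2 * (l : ℕ))) * PowerSeries.X ^ 2))).map (toSeries A))

/-- `S_k(u_k)` with `u_k = q^{-2k} u`. -/
def sAt (q : K) (S : Matrix (Fin n) (Fin n) A⟦X⟧) (k : Fin m) :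
    Matrix (Fin m → Fin n) (Fin m → Fin n) A⟦X⟧ :=
  onOne k (S.map (scaleArg (q ^ (-2 * (k : ℤ)))))

/-- `⟨S_{k₁}, …, S_{k_r}⟩ = S_{k₁} (R̄ᵗ_{k₁k₂} ⋯ R̄ᵗ_{k₁k_r}) S_{k₂} (R̄ᵗ_{k₂k₃} ⋯ R̄ᵗ_{k₂k_r}) ⋯ S_{k_r}`
as an operator on `m` tensor factors. -/
def bracket (q : K) (S : Matrix (Fin n) (Fin n) A⟦X⟧) :
    List (Fin m) → Matrix (Fin m → Fin n) (Fin m → Fin n) A⟦X⟧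
  | [] => 1
  | k :: L => sAt q S k * (L.map fun l => rBarT A n q k l).prod * bracket q S L

/-- The Sklyanin minor `s^{I}_{J}(u)`, the coefficient of `E_{I₁J₁} ⊗ ⋯ ⊗ E_{IₘJₘ}` in
`m! A^q_m ⟨S₁, …, Sₘ⟩`. -/
def sklyaninMinor (q : K) (S : Matrix (Fin n) (Fin n) A⟦X⟧) (I J : Fin m → Fin n) : A⟦X⟧ :=
  (((m.factorial : K) • qAntisymmetrizer n m q).map (constSeries A) *
    bracket q S (List.finRange m)) I J

/-- The Sklyanin determinant `sdet_q S(u) = s^{1 ⋯ n}_{1 ⋯ n}(u)`. -/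
def sklyaninDet (q : K) (S : Matrix (Fin n) (Fin n) A⟦X⟧) : A⟦X⟧ :=
  sklyaninMinor q S (id : Fin n → Fin n) id

/-- The auxiliary minor `š^{I}_{J,c}(u)` of order `m + 1`: the coefficient of
`E_{I₁J₁} ⊗ ⋯ ⊗ E_{IₘJₘ} ⊗ E_{I_{m+1}c}` in
`(m+1)! A^q_{m+1} ⟨S₁, …, Sₘ⟩ R̄ᵗ_{1,m+1} ⋯ R̄ᵗ_{m,m+1}`. -/
def auxiliaryMinor (q : K) (S : Matrix (Fin n) (Fin n) A⟦X⟧)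
    (I : Fin (m + 1) → Fin n) (J : Fin m → Fin n) (c : Fin n) : A⟦X⟧ :=
  ((((m + 1).factorial : K) • qAntisymmetrizer n (m + 1) q).map (constSeries A) *
    bracket q S ((List.finRange m).map Fin.castSucc) *
    ((List.finRange m).map fun k => rBarT A n q k.castSucc (Fin.last m)).prod)
    I (Fin.snoc (α := fun _ => Fin n) J c)

/-- The diagonal matrix `diag((-q)^{(n-1)/2}, (-q)^{(n-3)/2}, …, (-q)^{-(n-1)/2})`, divided by its
first entry. It is used only to conjugate, and the common scalar factor has no effect there. -/
def cMatrix (n : ℕ) (q : K) : Matrix (Fin n) (Fin n) K :=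
  Matrix.diagonal fun i => (-q) ^ (-(i : ℤ))

/-- `X(u) = C⁻¹ S(q⁻ⁿ u)⁻¹ C`, where `n` is the size of `S`. -/
def xMatrix (q : K) (S : Matrix (Fin n) (Fin n) A⟦X⟧) : Matrix (Fin n) (Fin n) A⟦X⟧ :=
  (cMatrix n q)⁻¹.map (constSeries A) * Ring.inverse (S.map (scaleArg (q ^ (-(n : ℤ))))) *
    (cMatrix n q).map (constSeries A)

end Minors

/-! ### Twisted `q`-Yangians -/

/-- The orthogonal and the symplectic case. -/
inductive SymmetryType
  | orthogonal
  | symplectic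

/-- `(i, i')` is one of the pairs `(1, 2), (3, 4), …` (counted from `1`). -/
def IsPair {n : ℕ} (i i' : Fin n) : Prop :=
  Even (i : ℕ) ∧ (i' : ℕ) = i + 1

/-- Generators: all `s_{ij}^{(r)}`, and in the symplectic case also `(s_{ii'}^{(0)})⁻¹` for
`i = 1, 3, 5, …`. -/
inductive Gen (n : ℕ) : SymmetryType → Type
  | s {g : SymmetryType} (i j : Fin n) (r : ℕ) : Gen n g
  | sInv (i i' : Fin n) (h : IsPair i i') : Gen n SymmetryType.symplectic

section Yangian

variable (K : Type*) [Field K] (q : K) (n : ℕ) (g : SymmetryType)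

/-- The free algebra on the generators. -/
abbrev Free : Type _ := FreeAlgebra K (Gen n g)

variable {n g} in
/-- The generator `s_{ij}^{(r)}`. -/
def gS (i j : Fin n) (r : ℕ) : Free K n g := FreeAlgebra.ι K (Gen.s i j r)

variable {n} in
/-- The generator `(s_{ii'}^{(0)})⁻¹`. -/
def gInv (i i' : Fin n) (h : IsPair i i') : Free K n SymmetryType.symplectic :=
  FreeAlgebra.ι K (Gen.sInv i i' h)

/-- The generator matrix as a series `∑_r s_{ij}^{(r)} t^r` in one of two commuting variables;
variable `0` stands for `u⁻¹` and variable `1` for `v⁻¹`. -/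
def gSeries (e : Fin 2) : Matrix (Fin n) (Fin n) (MvPowerSeries (Fin 2) (Free K n g)) :=
  Matrix.of fun i j => fun d => if d = Finsupp.single e (d e) then gS K i j (d e) else 0

/-- `R(u, v) S₁(u) Rᵗ(u⁻¹, v) S₂(v)`, multiplied by the scalar `u⁻¹ v⁻¹ · v⁻¹` in order to have a
series in `u⁻¹` and `v⁻¹`: `R` is homogeneous, so `u⁻¹ v⁻¹ R(u, v) = R(v⁻¹, u⁻¹)` and
`v⁻¹ Rᵗ(u⁻¹, v) = Rᵗ(u⁻¹ v⁻¹, 1)`. -/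
def reflectionLeft :
    Matrix (Fin n × Fin n) (Fin n × Fin n) (MvPowerSeries (Fin 2) (Free K n g)) :=
  rMatrix n q (MvPowerSeries.X 1) (MvPowerSeries.X 0) * (gSeries K n g 0 ⊗ₖ 1) *
    transposeFirst (rMatrix n q (MvPowerSeries.X 0 * MvPowerSeries.X 1) 1) *
    (1 ⊗ₖ gSeries K n g 1)

/-- `S₂(v) Rᵗ(u⁻¹, v) S₁(u) R(u, v)`, multiplied by the same scalar. -/
def reflectionRight :
    Matrix (Fin n × Fin n) (Fin n × Fin n) (MvPowerSeries (Fin 2) (Free K n g)) :=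
  (1 ⊗ₖ gSeries K n g 1) *
    transposeFirst (rMatrix n q (MvPowerSeries.X 0 * MvPowerSeries.X 1) 1) *
    (gSeries K n g 0 ⊗ₖ 1) * rMatrix n q (MvPowerSeries.X 1) (MvPowerSeries.X 0)

/-- The defining relations. -/
inductive Rel : (g : SymmetryType) → Free K n g → Free K n g → Prop
  | reflection (g : SymmetryType) (i j : Fin n × Fin n) (d : Fin 2 →₀ ℕ) :
      Rel g (MvPowerSeries.coeff d (reflectionLeft K q n g i j))
        (MvPowerSeries.coeff d (reflectionRight K q n g i j))
  | orth_upper (i j : Fin n) (h : i < j) : Rel SymmetryType.orthogonal (gS K i j 0) 0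
  | orth_diag (i : Fin n) : Rel SymmetryType.orthogonal (gS K i i 0) 1
  | symp_upper (i j : Fin n) (h : i < j) (h' : ¬ IsPair i j) :
      Rel SymmetryType.symplectic (gS K i j 0) 0
  | symp_block (i i' : Fin n) (h : IsPair i i') :
      Rel SymmetryType.symplectic
        (gS K i' i' 0 * gS K i i 0 - (q ^ 2) • (gS K i' i 0 * gS K i i' 0))
        (algebraMap K _ (q ^ 3))
  | symp_mul_inv (i i' : Fin n) (h : IsPair i i') :
      Rel SymmetryType.symplectic (gS K i i' 0 * gInv K i i' h) 1
  | symp_inv_mul (i i' : Fin n) (h : IsPair i i') :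
      Rel SymmetryType.symplectic (gInv K i i' h * gS K i i' 0) 1

/-- The twisted `q`-Yangian `Y_q^tw(o_n)` or `Y_q^tw(sp_n)`. -/
def TwistedYangian : Type _ := RingQuot (Rel K q n g)

instance : Ring (TwistedYangian K q n g) :=
  inferInstanceAs (Ring (RingQuot (Rel K q n g)))

instance : Algebra K (TwistedYangian K q n g) :=
  inferInstanceAs (Algebra K (RingQuot (Rel K q n g)))

/-- The generator matrix `S(u)`, with entries `s_{ij}(u) = ∑_r s_{ij}^{(r)} u^{-r}`. -/
def sMatrix : Matrix (Fin n) (Fin n) (TwistedYangian K q n g)⟦X⟧ :=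
  Matrix.of fun i j => PowerSeries.mk fun r => RingQuot.mkAlgHom K (Rel K q n g) (gS K i j r)

end Yangian

end TwistedQ

end

/-! Put d = N + M. At x = q²y the matrix R(x, y) degenerates to a multiple of 1 − P^q
(`rMatrix_special`). Hence the reflection equation at neighbouring points u_k, u_{k+1}, together
with the Yang–Baxter equation transposed in one factor, carries 1 − P^q from the left of a bracket
⟨S_1, …, S_m⟩ to its right (`satisfiesReflection_sMatrix`, `movesPast_bracket_finRange`). So every
row of A^q_m ⟨S_1, …, S_m⟩ is q-skew-symmetric in the column word (`isSkewRow_minor`), and for m = d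
the row of the word 1 ⋯ d is sdet_q S(u) times the same row of d! A^q_d
(`alternator_mul_bracket_apply`).

The bracket of order d splits into ⟨S_1, …, S_{M+1}⟩, the cross factors R̄ᵗ_{ij} with i ≤ M + 1 < j,
and ⟨S_{M+2}, …, S_d⟩. The cross factors with i = M + 1 and the last bracket are inverted
explicitly. By crossing symmetry the inverse of R̄ᵗ(x) is, up to a diagonal conjugation, R̄ᵗ(q^{-2d}
x) with q replaced by q⁻¹ (`transposeFirst_rMatrix_mul`), and inversion reverses the order of a
product. Read on the tensor factors d, d − 1, …, M + 1, the inverse is exactly the operator behind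
the antisymmetrizer in the auxiliary minor of X, for q⁻¹ and at the point q^{2-d} u
(`tail_mul_dualHom`).

Multiply by this inverse and compare the entries in row 1 ⋯ d and in the column N + 1, …, N + M, b,
followed by 1, …, N without a in decreasing order (`columnWord`). On one side the remaining cross
factors see distinct letters and act as the identity (`mul_rBarT_apply`); with the tail letters
fixed, the row of A^q_d becomes a row of A^q_{M+1} (`alternator_append_tailWord`), and the Sklyanin
minor appears. On the other side sdet_q S(u) factors out; with the letters N + 1, …, N + M fixed,
the row becomes a row of the antisymmetrizer for q⁻¹, because reversing a word complements its
inversions (`alternator_append_rev`). Counting inversions leaves the factor (−q)^{b−N}.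

S(u) is invertible because its constant term is: that matrix is unitriangular in the orthogonal case
and block triangular with 2 × 2 blocks in the symplectic case. Inverting a block uses the relation
s_{ii'} s_{ii} = q² s_{ii} s_{ii'} between constant terms, which is an entry of the reflection
equation (`reflection_const_comm`). -/

noncomputable section

namespace TwistedQ

/-! ### Operators acting in selected tensor factors -/

section Legs

variable {n m r : ℕ} {B : Type*}

/-- A matrix acting in the tensor factors `e 0, …, e (r - 1)`. -/
def onLegs [Zero B] (e : Fin r → Fin m) (T : Matrix (Fin r → Fin n) (Fin r → Fin n) B) :
    Matrix (Fin m → Fin n) (Fin m → Fin n) B :=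
  Matrix.of fun I J => if ∀ p, p ∉ Set.range e → I p = J p then T (I ∘ e) (J ∘ e) else 0

/-- The operator `T` acts in the tensor factors belonging to `s` only. -/
def ActsOn [Zero B] (s : Set (Fin m)) (T : Matrix (Fin m → Fin n) (Fin m → Fin n) B) : Prop :=
  (∀ I J, (∃ p, p ∉ s ∧ I p ≠ J p) → T I J = 0) ∧
    ∀ I J I' J', (∀ p ∉ s, I p = J p) → (∀ p ∉ s, I' p = J' p) →
      (∀ p ∈ s, I p = I' p) → (∀ p ∈ s, J p = J' p) → T I J = T I' J'

theorem actsOn_onOne [Zero B] (k : Fin m) (T : Matrix (Fin n) (Fin n) B) :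
    ActsOn {k} (onOne k T) := by
  refine ⟨?_, ?_⟩
  · rintro I J ⟨p, hp, hne⟩
    exact if_neg fun h => hne (h p hp)
  · intro I J I' J' h h' hI hJ
    have e : ∀ p, p ≠ k → I p = J p := fun p hp => h p hp
    have e' : ∀ p, p ≠ k → I' p = J' p := fun p hp => h' p hp
    simp only [onOne, Matrix.of_apply]
    rw [if_pos e, if_pos e', hI k rfl, hJ k rfl]

theorem actsOn_onTwo [Zero B] (k l : Fin m) (T : Matrix (Fin n × Fin n) (Fin n × Fin n) B) :
    ActsOn {k, l} (onTwo k l T) := by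
  refine ⟨?_, ?_⟩
  · rintro I J ⟨p, hp, hne⟩
    simp only [Set.mem_insert_iff, Set.mem_singleton_iff, not_or] at hp
    exact if_neg fun h => hne (h p hp.1 hp.2)
  · intro I J I' J' h h' hI hJ
    simp only [onTwo, Matrix.of_apply]
    rw [if_pos (fun p hp hp' => h p (by simp [hp, hp'])),
      if_pos (fun p hp hp' => h' p (by simp [hp, hp'])), hI k (by simp), hJ k (by simp),
      hI l (by simp), hJ l (by simp)]

/-- In each of the two products a single intermediate word survives, because each factor changes
only its own sites. Disjoint supports alone do not suffice: `B` is noncommutative, so the entries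
must commute as well. -/
theorem ActsOn.commute [Ring B] {s t : Set (Fin m)}
    {T U : Matrix (Fin m → Fin n) (Fin m → Fin n) B} (hT : ActsOn s T) (hU : ActsOn t U)
    (hst : Disjoint s t) (hc : ∀ I J I' J', Commute (T I J) (U I' J')) : Commute T U := by
  classical
  have hs : ∀ p, p ∈ s → p ∉ t := fun p h h' => Set.disjoint_left.mp hst h h'
  ext I J
  by_cases h : ∃ p, p ∉ s ∧ p ∉ t ∧ I p ≠ J p
  · obtain ⟨p, h1, h2, h3⟩ := h
    rw [Matrix.mul_apply, Matrix.mul_apply, Finset.sum_eq_zero, Finset.sum_eq_zero]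
    · intro K _
      by_cases hk : I p = K p
      · rw [hT.1 K J ⟨p, h1, fun h => h3 (hk.trans h)⟩, mul_zero]
      · rw [hU.1 I K ⟨p, h2, hk⟩, zero_mul]
    · intro K _
      by_cases hk : I p = K p
      · rw [hU.1 K J ⟨p, h2, fun h => h3 (hk.trans h)⟩, mul_zero]
      · rw [hT.1 I K ⟨p, h1, hk⟩, zero_mul]
  · push Not at h
    -- In `T * U` the intermediate word must equal `J` on `s` and `I` elsewhere; in `U * T` the
    -- roles are exchanged.
    rw [Matrix.mul_apply, Matrix.mul_apply,
      Finset.sum_eq_single (fun p => if p ∈ s then J p else I p),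
      Finset.sum_eq_single (fun p => if p ∈ s then I p else J p)]
    · rw [hT.2 I (fun p => if p ∈ s then J p else I p) (fun p => if p ∈ s then I p else J p) J
        (fun p hp => by simp [hp]) (fun p hp => by simp [hp]) (fun p hp => by simp [hp])
        (fun p hp => by simp [hp]),
        hU.2 (fun p => if p ∈ s then J p else I p) J I (fun p => if p ∈ s then I p else J p)
        (fun p hp => ?_) (fun p hp => ?_) (fun p hp => ?_) (fun p hp => ?_)]
      · exact hc _ _ _ _
      · by_cases h' : p ∈ s
        · simp [h']
        · simpa [h'] using h p h' hp
      · by_cases h' : p ∈ s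
        · simp [h']
        · simpa [h'] using h p h' hp
      · have h' : p ∉ s := fun h' => hs p h' hp
        simp [h']
      · have h' : p ∉ s := fun h' => hs p h' hp
        simp [h']
    · intro K _ hK
      obtain ⟨p, hp⟩ := Function.ne_iff.mp hK
      by_cases h' : p ∈ s
      · rw [hU.1 I K ⟨p, hs p h', by simpa [h', eq_comm] using hp⟩, zero_mul]
      · rw [hT.1 K J ⟨p, h', by simpa [h'] using hp⟩, mul_zero]
    · simp
    · intro K _ hK
      obtain ⟨p, hp⟩ := Function.ne_iff.mp hK
      by_cases h' : p ∈ s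
      · rw [hU.1 K J ⟨p, hs p h', by simpa [h'] using hp⟩, mul_zero]
      · rw [hT.1 I K ⟨p, h', by simpa [h', eq_comm] using hp⟩, zero_mul]
    · simp

/-- The intermediate words agree with `J` away from the selected sites, so the sum runs over their
letters at these sites only. This is how entries on all tensor factors are later reduced to entries
of smaller order. -/
theorem mul_onLegs_apply [NonUnitalNonAssocSemiring B] {e : Fin r → Fin m}
    (he : Function.Injective e)
    (V : Matrix (Fin m → Fin n) (Fin m → Fin n) B)
    (T : Matrix (Fin r → Fin n) (Fin r → Fin n) B) (I J : Fin m → Fin n) :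
    (V * onLegs e T) I J = ∑ k, V I (Function.extend e k J) * T k (J ∘ e) := by
  classical
  rw [Matrix.mul_apply]
  symm
  refine Finset.sum_of_injOn (fun k => Function.extend e k J) ?_ ?_ ?_ ?_
  · intro k _ k' _ h
    have := congrArg (fun f => f ∘ e) h
    simpa [Function.extend_comp he] using this
  · intro k _
    simp
  · intro K _ hK
    simp only [onLegs, Matrix.of_apply]
    rw [if_neg, mul_zero]
    intro h
    apply hK
    refine ⟨K ∘ e, by simp, ?_⟩
    funext p
    by_cases hp : p ∈ Set.range e
    · obtain ⟨x, rfl⟩ := hp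
      simp [he.extend_apply]
    · simp only
      rw [Function.extend_apply' _ _ _ hp, h p hp]
  · intro k _
    simp only [onLegs, Matrix.of_apply]
    rw [if_pos, Function.extend_comp he]
    intro p hp
    rw [Function.extend_apply' _ _ _ hp]

theorem onLegs_mul [NonUnitalNonAssocSemiring B] {e : Fin r → Fin m} (he : Function.Injective e)
    (T U : Matrix (Fin r → Fin n) (Fin r → Fin n) B) :
    onLegs e (T * U) = onLegs e T * onLegs e U := by
  ext I J
  rw [mul_onLegs_apply he]
  simp only [onLegs, Matrix.of_apply, Function.extend_comp he]
  have h : ∀ k : Fin r → Fin n, (∀ p, p ∉ Set.range e → I p = Function.extend e k J p) ↔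
      ∀ p, p ∉ Set.range e → I p = J p := by
    intro k
    refine forall_congr' fun p => forall_congr' fun hp => ?_
    rw [Function.extend_apply' _ _ _ hp]
  simp only [h]
  split_ifs
  · rw [Matrix.mul_apply]
  · simp

theorem onLegs_one [Zero B] [One B] (e : Fin r → Fin m) :
    onLegs e (1 : Matrix (Fin r → Fin n) (Fin r → Fin n) B) = 1 := by
  ext I J
  simp only [onLegs, Matrix.of_apply, Matrix.one_apply]
  by_cases h : I = J
  · simp [h]
  · rw [if_neg h]
    split_ifs with h1 h2
    · exfalso
      apply h
      funext p
      by_cases hp : p ∈ Set.range e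
      · obtain ⟨x, rfl⟩ := hp
        exact congrFun h2 x
      · exact h1 p hp
    · rfl
    · rfl

/-- `onLegs` as a monoid homomorphism. -/
def onLegsHom [NonAssocSemiring B] (e : Fin r → Fin m) (he : Function.Injective e) :
    Matrix (Fin r → Fin n) (Fin r → Fin n) B →* Matrix (Fin m → Fin n) (Fin m → Fin n) B where
  toFun := onLegs e
  map_one' := onLegs_one e
  map_mul' := onLegs_mul he

theorem onLegs_onOne [Zero B] {e : Fin r → Fin m} (he : Function.Injective e) (k : Fin r)
    (T : Matrix (Fin n) (Fin n) B) : onLegs e (onOne k T) = onOne (e k) T := by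
  ext I J
  simp only [onLegs, onOne, Matrix.of_apply, Function.comp_apply, ← ite_and]
  congr 1
  refine propext ⟨fun h p hp => ?_, fun h => ⟨fun p hp => h p ?_, fun p hp => h _ ?_⟩⟩
  · by_cases hr : p ∈ Set.range e
    · obtain ⟨x, rfl⟩ := hr
      exact h.2 x fun hx => hp (by rw [hx])
    · exact h.1 p hr
  · rintro rfl
    exact hp ⟨k, rfl⟩
  · exact fun hx => hp (he hx)

theorem onLegs_onTwo [Zero B] {e : Fin r → Fin m} (he : Function.Injective e) (k l : Fin r)
    (T : Matrix (Fin n × Fin n) (Fin n × Fin n) B) :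
    onLegs e (onTwo k l T) = onTwo (e k) (e l) T := by
  ext I J
  simp only [onLegs, onTwo, Matrix.of_apply, Function.comp_apply, ← ite_and]
  congr 1
  refine propext ⟨fun h p hp hp' => ?_,
    fun h => ⟨fun p hp => h p ?_ ?_, fun p hp hp' => h _ ?_ ?_⟩⟩
  · by_cases hr : p ∈ Set.range e
    · obtain ⟨x, rfl⟩ := hr
      exact h.2 x (fun hx => hp (by rw [hx])) fun hx => hp' (by rw [hx])
    · exact h.1 p hr
  · rintro rfl
    exact hp ⟨k, rfl⟩
  · rintro rfl
    exact hp ⟨l, rfl⟩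
  · exact fun hx => hp (he hx)
  · exact fun hx => hp' (he hx)

theorem onOne_eq_onLegs [Zero B] (k : Fin m) (T : Matrix (Fin n) (Fin n) B) :
    onOne k T = onLegs (fun _ : Fin 1 => k) (T.submatrix (fun f : Fin 1 → Fin n => f 0) (fun f :
        Fin 1 → Fin n => f 0)) := by
  ext I J
  simp [onOne, onLegs, eq_comm]

theorem onOne_mul [NonUnitalNonAssocSemiring B] (k : Fin m) (T U : Matrix (Fin n) (Fin n) B) :
    onOne k (T * U) = onOne k T * onOne k U := by
  have h : (T * U).submatrix (fun f : Fin 1 → Fin n => f 0)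
      (fun f : Fin 1 → Fin n => f 0) =
      T.submatrix (fun f : Fin 1 → Fin n => f 0)
        (fun f : Fin 1 → Fin n => f 0) * U.submatrix (fun f : Fin 1 → Fin n => f 0)
        (fun f : Fin 1 → Fin n => f 0) :=
    (Matrix.submatrix_mul_equiv T U (fun f : Fin 1 → Fin n => f 0) (Equiv.funUnique (Fin 1) (Fin n))
      (fun f : Fin 1 → Fin n => f 0)).symm
  rw [onOne_eq_onLegs, h, onLegs_mul (fun _ _ _ => Subsingleton.elim _ _), ← onOne_eq_onLegs,
    ← onOne_eq_onLegs]

theorem onTwo_eq_onLegs [Zero B] (k l : Fin m) (T : Matrix (Fin n × Fin n) (Fin n × Fin n) B) :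
    onTwo k l T =
      onLegs ![k, l] (T.submatrix (fun f : Fin 2 → Fin n => (f 0, f 1))
        (fun f : Fin 2 → Fin n => (f 0, f 1))) := by
  ext I J
  simp only [onTwo, onLegs, Matrix.of_apply, Matrix.submatrix_apply, Function.comp_apply,
    Matrix.cons_val_zero, Matrix.cons_val_one]
  congr 1
  refine propext ⟨fun h p hp => h p ?_ ?_, fun h p hk hl => h p ?_⟩
  · rintro rfl
    exact hp ⟨0, rfl⟩
  · rintro rfl
    exact hp ⟨1, rfl⟩
  · rintro ⟨x, rfl⟩
    fin_cases x
    · exact hk rfl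
    · exact hl rfl

theorem injective_pair {k l : Fin m} (h : k ≠ l) : Function.Injective ![k, l] := by
  intro x y
  fin_cases x <;> fin_cases y <;> simp [h, h.symm]

theorem onTwo_mul [NonUnitalNonAssocSemiring B] {k l : Fin m} (hkl : k ≠ l)
    (T U : Matrix (Fin n × Fin n) (Fin n × Fin n) B) :
    onTwo k l (T * U) = onTwo k l T * onTwo k l U := by
  have h : (T * U).submatrix (fun f : Fin 2 → Fin n => (f 0, f 1)) (fun f : Fin 2 → Fin n => (f 0,
      f 1)) =
      T.submatrix (fun f : Fin 2 → Fin n => (f 0, f 1))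
        (fun f : Fin 2 → Fin n => (f 0, f 1)) *
        U.submatrix (fun f : Fin 2 → Fin n => (f 0, f 1))
        (fun f : Fin 2 → Fin n => (f 0, f 1)) :=
    (Matrix.submatrix_mul_equiv T U (fun f : Fin 2 → Fin n => (f 0, f 1))
      (finTwoArrowEquiv (Fin n)) (fun f : Fin 2 → Fin n => (f 0, f 1))).symm
  rw [onTwo_eq_onLegs, h, onLegs_mul (injective_pair hkl), ← onTwo_eq_onLegs, ← onTwo_eq_onLegs]

theorem onOne_one [Zero B] [One B] (k : Fin m) : onOne k (1 : Matrix (Fin n) (Fin n) B) = 1 := by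
  ext I J
  simp only [onOne, Matrix.of_apply, Matrix.one_apply, ← ite_and]
  congr 1
  refine propext ⟨fun h => funext fun p => ?_, fun h => by simp [h]⟩
  by_cases hp : p = k
  · rw [hp, h.2]
  · exact h.1 p hp

theorem onTwo_one [Zero B] [One B] (k l : Fin m) :
    onTwo k l (1 : Matrix (Fin n × Fin n) (Fin n × Fin n) B) = 1 := by
  ext I J
  simp only [onTwo, Matrix.of_apply, Matrix.one_apply, ← ite_and, Prod.mk.injEq]
  congr 1
  refine propext ⟨fun h => funext fun p => ?_, fun h => by simp [h]⟩
  by_cases hp : p = k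
  · rw [hp, h.2.1]
  · by_cases hl : p = l
    · rw [hl, h.2.2]
    · exact h.1 p hp hl

theorem onTwo_sub [AddGroup B] (k l : Fin m) (T U : Matrix (Fin n × Fin n) (Fin n × Fin n) B) :
    onTwo k l (T - U) = onTwo k l T - onTwo k l U := by
  ext I J
  simp only [onTwo, Matrix.of_apply, Matrix.sub_apply]
  split_ifs <;> simp

theorem onTwo_smul {C : Type*} [Zero B] [SMulZeroClass C B] (k l : Fin m) (c : C)
    (T : Matrix (Fin n × Fin n) (Fin n × Fin n) B) :
    onTwo k l (c • T) = c • onTwo k l T := by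
  ext I J
  simp only [onTwo, Matrix.of_apply, Matrix.smul_apply]
  split_ifs <;> simp

theorem onTwo_kronecker_one [NonAssocSemiring B] {k l : Fin m} (hkl : k ≠ l)
    (T : Matrix (Fin n) (Fin n) B) : onTwo k l (T ⊗ₖ 1) = onOne k T := by
  ext I J
  simp only [onTwo, onOne, Matrix.of_apply, Matrix.kroneckerMap_apply, Matrix.one_apply,
    mul_ite, mul_one, mul_zero, ← ite_and]
  congr 1
  refine propext ⟨fun h p hp => ?_, fun h => ⟨fun p hp _ => h p hp, h l hkl.symm⟩⟩
  by_cases hl : p = l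
  · rw [hl, h.2]
  · exact h.1 p hp hl

theorem onTwo_one_kronecker [NonAssocSemiring B] {k l : Fin m} (hkl : k ≠ l)
    (T : Matrix (Fin n) (Fin n) B) : onTwo k l (1 ⊗ₖ T) = onOne l T := by
  ext I J
  simp only [onTwo, onOne, Matrix.of_apply, Matrix.kroneckerMap_apply, Matrix.one_apply,
    ite_mul, one_mul, zero_mul, ← ite_and]
  congr 1
  refine propext ⟨fun h p hp => ?_, fun h => ⟨fun p _ hp => h p hp, h k hkl⟩⟩
  by_cases hl : p = k
  · rw [hl, h.2]
  · exact h.1 p hl hp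

theorem onOne_map {C : Type*} [Zero B] [Zero C] (f : B → C) (hf : f 0 = 0) (k : Fin m)
    (T : Matrix (Fin n) (Fin n) B) : (onOne k T).map f = onOne k (T.map f) := by
  ext I J
  simp only [onOne, Matrix.of_apply, Matrix.map_apply]
  split_ifs <;> simp [hf]

theorem onTwo_map {C : Type*} [Zero B] [Zero C] (f : B → C) (hf : f 0 = 0) (k l : Fin m)
    (T : Matrix (Fin n × Fin n) (Fin n × Fin n) B) :
    (onTwo k l T).map f = onTwo k l (T.map f) := by
  ext I J
  simp only [onTwo, Matrix.of_apply, Matrix.map_apply]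
  split_ifs <;> simp [hf]

theorem onTwo_swap [Zero B] (k l : Fin m) (T : Matrix (Fin n × Fin n) (Fin n × Fin n) B) :
    onTwo k l (T.submatrix Prod.swap Prod.swap) = onTwo l k T := by
  ext I J
  simp only [onTwo, Matrix.of_apply, Matrix.submatrix_apply, Prod.swap_prod_mk]
  congr 1
  exact propext ⟨fun h p h1 h2 => h p h2 h1, fun h p h1 h2 => h p h2 h1⟩

theorem mul_onTwo_apply [NonUnitalNonAssocSemiring B] {k l : Fin m} (hkl : k ≠ l)
    (V : Matrix (Fin m → Fin n) (Fin m → Fin n) B)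
    (T : Matrix (Fin n × Fin n) (Fin n × Fin n) B) (I J : Fin m → Fin n) :
    (V * onTwo k l T) I J = ∑ x, ∑ y,
      V I (Function.update (Function.update J k x) l y) * T (x, y) (J k, J l) := by
  rw [onTwo_eq_onLegs, mul_onLegs_apply (injective_pair hkl),
    ← (finTwoArrowEquiv (Fin n)).symm.sum_comp, Fintype.sum_prod_type]
  refine Finset.sum_congr rfl fun x _ => Finset.sum_congr rfl fun y _ => ?_
  have h : Function.extend ![k, l] ((finTwoArrowEquiv (Fin n)).symm (x, y)) J =
      Function.update (Function.update J k x) l y := by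
    funext p
    by_cases hl : p = l
    · subst hl
      simpa using (injective_pair hkl).extend_apply ![x, y] J 1
    · by_cases hk : p = k
      · subst hk
        simpa [hl] using (injective_pair hkl).extend_apply ![x, y] J 0
      · rw [Function.extend_apply']
        · simp [hl, hk]
        · rintro ⟨a, ha⟩
          fin_cases a
          · exact hk (by simpa using ha.symm)
          · exact hl (by simpa using ha.symm)
  rw [h]
  simp

end Legs

/-! ### The Yang–Baxter equation -/

section YangBaxter

variable {K : Type*} [Field K] {n m : ℕ} {B : Type*} [CommRing B] [Algebra K B]

/-- The coefficient of the identity in a row of the `R`-matrix. -/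
def rDiag (q : K) (x y : B) (i j : Fin n) : B :=
  if i = j then q⁻¹ • x - q • y else x - y

/-- The coefficient of the flip in a row of the `R`-matrix. -/
def rOff (q : K) (x y : B) (i j : Fin n) : B :=
  if i = j then 0 else if j < i then (q⁻¹ - q) • x else (q⁻¹ - q) • y

/-- A row of R has at most two nonzero entries, at the word itself and at the word with two letters
exchanged. If the two letters coincide these are the same entry, so `rOff` vanishes there to avoid
counting it twice. -/
theorem onTwo_rMatrix_mul_apply (q : K) (x y : B) (k l : Fin m)
    (V : Matrix (Fin m → Fin n) (Fin m → Fin n) B) (I J : Fin m → Fin n) :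
    (onTwo k l (rMatrix n q x y) * V) I J =
      rDiag q x y (I k) (I l) * V I J +
        rOff q x y (I k) (I l) * V (I ∘ Equiv.swap k l) J := by
  have key : ∀ L, onTwo k l (rMatrix n q x y) I L =
      (if L = I then rDiag q x y (I k) (I l) else 0) +
        (if L = I ∘ Equiv.swap k l then rOff q x y (I k) (I l) else 0) := by
    intro L
    have e1 : L = I ↔ (∀ p, p ≠ k → p ≠ l → I p = L p) ∧ I k = L k ∧ I l = L l := by
      refine ⟨fun h => by simp [h], fun h => funext fun p => ?_⟩
      by_cases hk : p = k
      · rw [hk, h.2.1]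
      · by_cases hl : p = l
        · rw [hl, h.2.2]
        · exact (h.1 p hk hl).symm
    have e2 : L = I ∘ Equiv.swap k l ↔
        (∀ p, p ≠ k → p ≠ l → I p = L p) ∧ I k = L l ∧ I l = L k := by
      refine ⟨?_, fun h => funext fun p => ?_⟩
      · rintro rfl
        refine ⟨fun p h1 h2 => ?_, by simp, by simp⟩
        simp [Equiv.swap_apply_of_ne_of_ne h1 h2]
      · by_cases hk : p = k
        · simp [hk, h.2.2]
        · by_cases hl : p = l
          · simp [hl, h.2.1]
          · simp [Equiv.swap_apply_of_ne_of_ne hk hl, h.1 p hk hl]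
    by_cases h : ∀ p, p ≠ k → p ≠ l → I p = L p
    · have e1' : L = I ↔ I k = L k ∧ I l = L l := by rw [e1, and_iff_right h]
      have e2' : L = I ∘ Equiv.swap k l ↔ I k = L l ∧ I l = L k := by rw [e2, and_iff_right h]
      simp only [onTwo, rMatrix, rDiag, rOff, Matrix.of_apply, Prod.mk.injEq, Prod.swap_prod_mk,
        if_pos h, e1', e2']
      clear e1 e2 e1' e2' h
      generalize I k = a at *
      generalize I l = b at *
      generalize L k = c at *
      generalize L l = d at *
      by_cases h1 : a = c ∧ b = d
      · obtain ⟨rfl, rfl⟩ := h1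
        by_cases h2 : a = b
        · simp [h2]
        · simp [h2]
      · by_cases h2 : a = d ∧ b = c
        · obtain ⟨rfl, rfl⟩ := h2
          have : a ≠ b := fun h => h1 ⟨h, h.symm⟩
          simp [this, this.symm]
        · simp [h1, h2]
    · simp [e1, e2, onTwo, h]
  rw [Matrix.mul_apply]
  simp [key, add_mul, Finset.sum_add_distrib]

/-- Only the relative order of the three letters of the row matters. Each order leaves a polynomial
identity in x, y, z, q, q⁻¹ modulo q q⁻¹ = 1. -/
theorem yangBaxter_three {q : K} (hq : q ≠ 0) (x y z : B) :
    (onTwo 1 2 (rMatrix n q x y) * onTwo 0 2 (rMatrix n q z y) * onTwo 0 1 (rMatrix n q z x) :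
      Matrix (Fin 3 → Fin n) (Fin 3 → Fin n) B) =
    onTwo 0 1 (rMatrix n q z x) * onTwo 0 2 (rMatrix n q z y) * onTwo 1 2 (rMatrix n q x y) := by
  ext I J
  obtain ⟨a, b, c, rfl⟩ : ∃ a b c, I = ![a, b, c] :=
    ⟨I 0, I 1, I 2, funext fun p => by fin_cases p <;> rfl⟩
  have s01 : ∀ a b c : Fin n, ![a, b, c] ∘ Equiv.swap (0 : Fin 3) 1 = ![b, a, c] :=
    fun a b c => funext fun p => by fin_cases p <;> rfl
  have s02 : ∀ a b c : Fin n, ![a, b, c] ∘ Equiv.swap (0 : Fin 3) 2 = ![c, b, a] :=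
    fun a b c => funext fun p => by fin_cases p <;> rfl
  have s12 : ∀ a b c : Fin n, ![a, b, c] ∘ Equiv.swap (1 : Fin 3) 2 = ![a, c, b] :=
    fun a b c => funext fun p => by fin_cases p <;> rfl
  -- The extra factor 1 makes every R a left multiplication, so that the row formula applies; it is
  -- then replaced by an arbitrary matrix `V`.
  rw [← mul_one (onTwo 0 1 (rMatrix n q z x)), ← mul_one (onTwo 1 2 (rMatrix n q x y))]
  simp only [mul_assoc, onTwo_rMatrix_mul_apply,
   
    s01, s02, s12,
    one_mul, Matrix.cons_val_zero, Matrix.cons_val_one, Matrix.cons_val]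
  generalize (1 : Matrix (Fin 3 → Fin n) (Fin 3 → Fin n) B) = V
  simp only [rDiag, rOff, Algebra.smul_def, map_sub]
  have hs : algebraMap K B q * algebraMap K B q⁻¹ = 1 := by
    rw [← map_mul, mul_inv_cancel₀ hq, map_one]
  generalize algebraMap K B q = s at *
  generalize algebraMap K B q⁻¹ = t at *
  have ord : ∀ i j : Fin n, i = j ∨ (i < j ∧ i ≠ j ∧ j ≠ i ∧ ¬ j < i) ∨
      (j < i ∧ i ≠ j ∧ j ≠ i ∧ ¬ i < j) := by
    intro i j
    omega
  rcases ord a b with h1 | h1 | h1 <;> rcases ord b c with h2 | h2 | h2 <;>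
    rcases ord a c with h3 | h3 | h3 <;> first
    | (exfalso; omega)
    | (try subst h1
       try subst h2
       try subst h3
       simp only [*, if_true, if_false, lt_irrefl]
       grind)

end YangBaxter

/-! ### Partial transposition and the symmetrizer -/

section Transposed

variable {K : Type*} [Field K] {n m : ℕ} {B : Type*} [CommRing B] [Algebra K B]

theorem onTwo_zero_one_apply (T : Matrix (Fin n × Fin n) (Fin n × Fin n) B)
    (I J : Fin 3 → Fin n) :
    onTwo 0 1 T I J = if I 2 = J 2 then T (I 0, I 1) (J 0, J 1) else 0 := by
  simp [onTwo, Fin.forall_fin_succ]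

theorem onTwo_zero_two_apply (T : Matrix (Fin n × Fin n) (Fin n × Fin n) B)
    (I J : Fin 3 → Fin n) :
    onTwo 0 2 T I J = if I 1 = J 1 then T (I 0, I 2) (J 0, J 2) else 0 := by
  simp [onTwo, Fin.forall_fin_succ]

theorem onTwo_one_two_apply (T : Matrix (Fin n × Fin n) (Fin n × Fin n) B)
    (I J : Fin 3 → Fin n) :
    onTwo 1 2 T I J = if I 0 = J 0 then T (I 1, I 2) (J 1, J 2) else 0 := by
  simp [onTwo, Fin.forall_fin_succ]

/-- Transposing the factor 0 reverses the order of the two operators that act on it and exchanges `I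
0` with `J 0`. `Q` does not touch this factor and stays in place. -/
theorem transposeFirst_left (Q T U : Matrix (Fin n × Fin n) (Fin n × Fin n) B)
    (I J : Fin 3 → Fin n) :
    (onTwo 1 2 Q * onTwo 0 1 (transposeFirst T) * onTwo 0 2 (transposeFirst U) :
        Matrix (Fin 3 → Fin n) (Fin 3 → Fin n) B) I J =
      (onTwo 1 2 Q * onTwo 0 2 U * onTwo 0 1 T : Matrix (Fin 3 → Fin n) (Fin 3 → Fin n) B) ![J 0, I
          1, I 2] ![I 0, J 1, J 2] := by
  have h02 : (0 : Fin 3) ≠ 2 := by decide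
  have h01 : (0 : Fin 3) ≠ 1 := by decide
  simp only [mul_onTwo_apply h02, mul_onTwo_apply h01, onTwo_one_two_apply]
  simp [h01, h02, h01.symm, h02.symm, transposeFirst, Finset.sum_ite_irrel]
  refine Finset.sum_congr rfl fun x _ => ?_
  simp only [Finset.sum_mul]
  rw [Finset.sum_comm]
  exact Finset.sum_congr rfl fun y _ => Finset.sum_congr rfl fun z _ => by ring

theorem transposeFirst_right (Q T U : Matrix (Fin n × Fin n) (Fin n × Fin n) B)
    (I J : Fin 3 → Fin n) :
    (onTwo 0 2 (transposeFirst U) * onTwo 0 1 (transposeFirst T) * onTwo 1 2 Q :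
        Matrix (Fin 3 → Fin n) (Fin 3 → Fin n) B) I J =
      (onTwo 0 1 T * onTwo 0 2 U * onTwo 1 2 Q : Matrix (Fin 3 → Fin n) (Fin 3 → Fin n) B)
        ![J 0, I 1, I 2] ![I 0, J 1, J 2] := by
  have h12 : (1 : Fin 3) ≠ 2 := by decide
  have h01 : (0 : Fin 3) ≠ 1 := by decide
  have h02 : (0 : Fin 3) ≠ 2 := by decide
  simp only [mul_onTwo_apply h12, mul_onTwo_apply h01, mul_onTwo_apply h02,
    onTwo_zero_one_apply, onTwo_zero_two_apply]
  simp [h01, h12, h02, h02.symm, h01.symm, h12.symm, transposeFirst]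
  exact Finset.sum_congr rfl fun x _ => Finset.sum_congr rfl fun y _ => by
    congr 1
    exact Finset.sum_congr rfl fun z _ => by ring

theorem rMatrix_symm_transpose (q : K) (x y : B) :
    (transposeFirst (rMatrix n q x y)).submatrix Prod.swap Prod.swap =
      transposeFirst (rMatrix n q x y) := by
  ext ⟨a, b⟩ ⟨c, d⟩
  simp only [transposeFirst, rMatrix, Matrix.submatrix_apply, Matrix.of_apply, Prod.mk.injEq,
    Prod.swap_prod_mk]
  grind

/-- The Yang–Baxter equation transposed in the factor `a`. It is proved on three factors and then
embedded along `![a, b, c]`. -/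
theorem yangBaxter_transpose {q : K} (hq : q ≠ 0) (x y z : B) {a b c : Fin m} (hab : a ≠ b)
    (hac : a ≠ c) (hbc : b ≠ c) :
    (onTwo b c (rMatrix n q x y) * onTwo a b (transposeFirst (rMatrix n q z x)) *
        onTwo a c (transposeFirst (rMatrix n q z y)) :
      Matrix (Fin m → Fin n) (Fin m → Fin n) B) =
    onTwo a c (transposeFirst (rMatrix n q z y)) * onTwo a b (transposeFirst (rMatrix n q z x)) *
      onTwo b c (rMatrix n q x y) := by
  have he : Function.Injective ![a, b, c] := by
    intro x y
    fin_cases x <;> fin_cases y <;> simp [hab, hac, hbc, hab.symm, hac.symm, hbc.symm]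
  have h3 : (onTwo 1 2 (rMatrix n q x y) * onTwo 0 1 (transposeFirst (rMatrix n q z x)) *
        onTwo 0 2 (transposeFirst (rMatrix n q z y)) :
      Matrix (Fin 3 → Fin n) (Fin 3 → Fin n) B) =
    onTwo 0 2 (transposeFirst (rMatrix n q z y)) * onTwo 0 1 (transposeFirst (rMatrix n q z x)) *
      onTwo 1 2 (rMatrix n q x y) := by
    ext I J
    rw [transposeFirst_left, transposeFirst_right, yangBaxter_three hq]
  have h := congrArg (onLegs ![a, b, c]) h3
  simpa only [onLegs_mul he, onLegs_onTwo he, Matrix.cons_val_zero, Matrix.cons_val_one,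
    Matrix.cons_val] using h

theorem rMatrix_smul (q : K) (c : K) (x y : B) :
    rMatrix n q (c • x) (c • y) = c • rMatrix n q x y := by
  ext r s
  simp only [rMatrix, Matrix.of_apply, Matrix.smul_apply]
  split_ifs <;> simp [smul_sub, smul_comm c]

/-- The source of antisymmetry: at this point the diagonal coefficient q⁻¹x − qy vanishes and all
others become proportional to those of 1 − P^q. -/
theorem rMatrix_special {q : K} (hq : q ≠ 0) (y : B) :
    rMatrix n q (q ^ 2 • y) y =
      ((q ^ 2 - 1) • y) • (1 - (qFlip n q).map (algebraMap K B)) := by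
  have hs : algebraMap K B q * algebraMap K B q⁻¹ = 1 := by
    rw [← map_mul, mul_inv_cancel₀ hq, map_one]
  ext ⟨a, b⟩ ⟨c, d⟩
  simp only [rMatrix, qFlip, Matrix.of_apply, Matrix.smul_apply, Matrix.sub_apply,
    Matrix.one_apply, Matrix.map_apply, Prod.mk.injEq, Prod.swap_prod_mk, Algebra.smul_def,
    Algebra.algebraMap_self, RingHom.id_apply, map_sub, map_pow, map_one]
  generalize hs' : algebraMap K B q = s at *
  generalize ht' : algebraMap K B q⁻¹ = t at *
  have h : ∀ p : Prop, ∀ [Decidable p], ∀ u v : K,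
      algebraMap K B (if p then u else v) = if p then algebraMap K B u else algebraMap K B v := by
    intro p _ u v
    split_ifs <;> rfl
  simp only [h, map_one, map_zero, hs', ht']
  rcases lt_trichotomy a b with h1 | h1 | h1 <;> by_cases h2 : a = c <;> by_cases h3 : b = d <;>
    by_cases h4 : a = d <;> by_cases h5 : b = c <;> grind

/-- The `q`-symmetrizing factor moves past a pair of transposed `R`-matrices. -/
theorem one_sub_qFlip_mul_transpose {q : K} (hq : q ≠ 0) (hq2 : q ^ 2 ≠ 1) (ξ : B) {a b c : Fin m}
    (hab : a ≠ b) (hac : a ≠ c) (hbc : b ≠ c) :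
    ((1 - onTwo b c ((qFlip n q).map (algebraMap K B))) *
        onTwo a b (transposeFirst (rMatrix n q ξ 1)) *
        onTwo a c (transposeFirst (rMatrix n q (q ^ 2 • ξ) 1)) :
      Matrix (Fin m → Fin n) (Fin m → Fin n) B) =
    onTwo a c (transposeFirst (rMatrix n q (q ^ 2 • ξ) 1)) *
      onTwo a b (transposeFirst (rMatrix n q ξ 1)) *
      (1 - onTwo b c ((qFlip n q).map (algebraMap K B))) := by
  -- By homogeneity R(q²ξ, q²) = q² R(ξ, 1), while R(q², 1) is (q² − 1)(1 − P^q). The scalars q² and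
  -- q² − 1 are nonzero and cancel.
  have h := yangBaxter_transpose (n := n) hq (q ^ 2 • (1 : B)) 1 (q ^ 2 • ξ) hab hac hbc
  have ht : ∀ (c : K) (T : Matrix (Fin n × Fin n) (Fin n × Fin n) B),
      transposeFirst (c • T) = c • transposeFirst T := fun c T => rfl
  rw [rMatrix_special hq, rMatrix_smul, ht, onTwo_smul, onTwo_smul, onTwo_sub, onTwo_one] at h
  simp only [smul_mul_assoc, mul_smul_comm, one_smul, smul_assoc] at h
  rw [smul_comm (q ^ 2 - 1)] at h
  exact smul_right_injective _ (sub_ne_zero.mpr hq2) (smul_right_injective _ (pow_ne_zero 2 hq) h)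

end Transposed

/-! ### Crossing symmetry -/

section Crossing

/-- The sum telescopes. Once `m` has passed both `a` and `c`, the partial sum is (s² − 1)(−x' + x
t^{2m}) plus the diagonal term, and the choice x' = t^{2n} x makes the first part vanish at m = n.
-/
theorem crossing_sum {R : Type*} [CommRing R] {s t : R} (hst : s * t = 1) (x x' : R) (n a c : ℕ)
    (ha : a < n) (hc : c < n) (hx : (t ^ 2) ^ n * x = x') :
    ∑ e ∈ Finset.range n,
      (if a = e then t * x - s else if a < e then (t - s) * x else t - s) *
        (if e = c then s * x' - t else if e < c then (s - t) * x' else s - t) * (t ^ 2) ^ e =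
      if a = c then (x - 1) * (x' - 1) * (t ^ 2) ^ a else 0 := by
  have key := Finset.sum_range_induction
    (fun e => (if a = e then t * x - s else if a < e then (t - s) * x else t - s) *
        (if e = c then s * x' - t else if e < c then (s - t) * x' else s - t) * (t ^ 2) ^ e)
    -- The closed form of the partial sum up to `m`; the branches record whether `m` has passed `a`
    -- and whether it has passed `c`.
    (fun m => if m ≤ a then
        (if m ≤ c then -(s ^ 2 - 1) * x' * (1 - (t ^ 2) ^ m)
          else (s ^ 2 - 1) * (-x' + (t ^ 2) ^ m))
      else if m ≤ c then (s ^ 2 - 1) * (-x' + x * x' * (t ^ 2) ^ m)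
      else (s ^ 2 - 1) * (-x' + x * (t ^ 2) ^ m) +
        if a = c then (x - 1) * (x' - 1) * (t ^ 2) ^ a else 0)
    (by simp) n (fun m _ => ?_)
  · rw [key]
    have h1 : ¬ n ≤ a := by omega
    have h2 : ¬ n ≤ c := by omega
    simp only [h1, h2, if_false]
    rw [← hx]
    ring
  · have hp : (t ^ 2) ^ (m + 1) = t ^ 2 * (t ^ 2) ^ m := by ring
    rcases lt_trichotomy m a with h1 | h1 | h1 <;> rcases lt_trichotomy m c with h2 | h2 | h2
    · have e1 : m + 1 ≤ a := h1
      have e2 : m + 1 ≤ c := h2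
      simp only [h1.le, h2.le, e1, e2, h1.ne', h2.ne, h1.not_gt, h2, hp, if_true, if_false]
      generalize (t ^ 2) ^ m = w
      grind
    · subst h2
      have e1 : m + 1 ≤ a := h1
      simp only [h1.le, e1, h1.ne', h1.not_gt, hp, if_true, if_false, le_refl,
        Nat.not_succ_le_self]
      generalize (t ^ 2) ^ m = w
      grind
    · have e1 : m + 1 ≤ a := h1
      have e2 : ¬ m + 1 ≤ c := by omega
      simp only [h1.le, h2.not_ge, e1, e2, h1.ne', h2.ne', h1.not_gt, h2.not_gt, hp, if_true,
        if_false]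
      generalize (t ^ 2) ^ m = w
      grind
    · subst h1
      have e2 : m + 1 ≤ c := h2
      simp only [h2.le, e2, h2.ne, h2, hp, if_true, if_false, le_refl, Nat.not_succ_le_self]
      generalize (t ^ 2) ^ m = w
      grind
    · subst h1 h2
      simp only [hp, if_true, if_false, le_refl, Nat.not_succ_le_self]
      generalize (t ^ 2) ^ m = w
      grind
    · subst h1
      have e2 : ¬ m + 1 ≤ c := by omega
      simp only [h2.not_ge, e2, h2.ne', h2.not_gt, hp, if_true, if_false, le_refl,
        Nat.not_succ_le_self]
      generalize (t ^ 2) ^ m = w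
      grind
    · have e1 : ¬ m + 1 ≤ a := by omega
      have e2 : m + 1 ≤ c := h2
      simp only [h1.not_ge, h2.le, e1, e2, h1.ne, h2.ne, h1, h2, hp, if_true, if_false]
      generalize (t ^ 2) ^ m = w
      grind
    · subst h2
      have e1 : ¬ m + 1 ≤ a := by omega
      simp only [h1.not_ge, e1, h1.ne, h1, hp, if_true, if_false, le_refl,
        Nat.not_succ_le_self]
      generalize (t ^ 2) ^ m = w
      grind
    · have e1 : ¬ m + 1 ≤ a := by omega
      have e2 : ¬ m + 1 ≤ c := by omega
      simp only [h1.not_ge, h2.not_ge, e1, e2, h1.ne, h2.ne', h1, h2.not_gt, hp, if_true,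
        if_false]
      generalize (t ^ 2) ^ m = w
      grind

variable {K : Type*} [Field K] {n : ℕ}

/-- The transposed matrix is block diagonal: it is the scalar x − 1 on the vectors e_a ⊗ e_b with a
≠ b, and an n × n matrix on the span of the e_a ⊗ e_a. Both crossing symmetry and the trivial action
on distinct letters rest on this. -/
theorem transposeFirst_rMatrix_apply {B : Type*} [Ring B] [Algebra K B] (q : K) (x : B) (a b c d :
    Fin n) :
    transposeFirst (rMatrix n q x 1) (a, b) (c, d) =
      if a = b then
        (if c = d then
          (if a = c then algebraMap K B q⁻¹ * x - algebraMap K B q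
            else if a < c then (algebraMap K B q⁻¹ - algebraMap K B q) * x
            else algebraMap K B q⁻¹ - algebraMap K B q) else 0)
      else if a = c ∧ b = d then x - 1 else 0 := by
  simp only [transposeFirst, rMatrix, Matrix.of_apply, Prod.mk.injEq, Prod.swap_prod_mk,
    Algebra.smul_def, map_sub, mul_one]
  by_cases h1 : a = b <;> by_cases h2 : c = d <;> by_cases h3 : a = c <;> by_cases h4 : b = d <;>
    simp_all [eq_comm]

/-- Crossing symmetry of the transposed `R`-matrix. -/
theorem transposeFirst_rMatrix_mul {B : Type*} [CommRing B] [Algebra K B] {q : K} (hq : q ≠ 0) (x :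
    B) :
    transposeFirst (rMatrix n q x 1) *
      (Matrix.of fun r c => ((-q) ^ ((c.1 : ℤ) + (c.2 : ℤ) - (r.1 : ℤ) - (r.2 : ℤ)) : K) •
        transposeFirst (rMatrix n q⁻¹ ((q ^ 2)⁻¹ ^ n • x) (1 : B)) r c) =
      ((x - 1) * ((q ^ 2)⁻¹ ^ n • x - 1)) • 1 := by
  have hs : algebraMap K B q * algebraMap K B q⁻¹ = 1 := by
    rw [← map_mul, mul_inv_cancel₀ hq, map_one]
  ext ⟨a, b⟩ ⟨c, d⟩
  rw [Matrix.mul_apply, Fintype.sum_prod_type]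
  simp only [transposeFirst_rMatrix_apply, Matrix.of_apply, Matrix.smul_apply, Matrix.one_apply,
    Prod.mk.injEq, inv_inv, smul_eq_mul]
  by_cases hab : a = b
  · subst hab
    by_cases hcd : c = d
    · subst hcd
      -- Inside the block of the vectors e_a ⊗ e_a the product is the telescoping sum, since
      -- (−q)^{2c−2e} = q^{2c} (q⁻²)^e.
      have h := crossing_sum hs x ((q ^ 2)⁻¹ ^ n • x) n a c a.2 c.2 (by
        simp [Algebra.smul_def, ← map_pow])
      rw [Finset.sum_range] at h
      have h' := congrArg (fun z => (q ^ (2 * (c : ℤ)) : K) • z) h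
      simp only [Finset.smul_sum] at h'
      simp only [if_true, ite_mul, zero_mul, Finset.sum_ite_eq, Finset.mem_univ]
      refine Eq.trans (Finset.sum_congr rfl fun e _ => ?_) (h'.trans ?_)
      · have hpow : ((-q) ^ ((c : ℤ) + (c : ℤ) - (e : ℤ) - (e : ℤ)) : K) =
            q ^ (2 * (c : ℤ)) * (q⁻¹ ^ 2) ^ (e : ℕ) := by
          rw [show (c : ℤ) + (c : ℤ) - (e : ℤ) - (e : ℤ) = 2 * ((c : ℤ) - e) by ring,
            (even_two_mul _).neg_zpow, mul_sub, zpow_sub₀ hq, div_eq_mul_inv]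
          congr 1
          rw [← pow_mul, inv_pow, inv_inj]
          exact_mod_cast rfl
        simp only [hpow, Fin.ext_iff, Fin.lt_def, Algebra.smul_def, map_mul, map_pow]
        split_ifs <;> ring
      · by_cases hac : a = c
        · subst hac
          simp only [and_self, if_true, mul_one]
          rw [mul_comm _ ((algebraMap K B q⁻¹ ^ 2) ^ (a : ℕ)), ← map_pow, ← map_pow,
            ← Algebra.smul_def, smul_smul]
          have : (q ^ (2 * (a : ℤ)) * (q⁻¹ ^ 2) ^ (a : ℕ) : K) = 1 := by
            rw [← pow_mul, inv_pow]
            exact_mod_cast mul_inv_cancel₀ (pow_ne_zero _ hq)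
          rw [this, one_smul]
        · have : ¬ (a : ℕ) = c := fun h => hac (Fin.ext h)
          simp [hac, this]
    · have h1 : ∀ e f : Fin n, (if a = a then (if e = f then
          (if a = e then algebraMap K B q⁻¹ * x - algebraMap K B q
            else if a < e then (algebraMap K B q⁻¹ - algebraMap K B q) * x
            else algebraMap K B q⁻¹ - algebraMap K B q) else 0)
        else if a = e ∧ a = f then x - 1 else 0) *
        (((-q) ^ ((c : ℤ) + (d : ℤ) - (e : ℤ) - (f : ℤ)) : K) • if e = f then (if c = d then
          (if e = c then algebraMap K B q * (q ^ 2)⁻¹ ^ n • x - algebraMap K B q⁻¹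
            else if e < c then (algebraMap K B q - algebraMap K B q⁻¹) * (q ^ 2)⁻¹ ^ n • x
            else algebraMap K B q - algebraMap K B q⁻¹) else 0)
        else if e = c ∧ f = d then (q ^ 2)⁻¹ ^ n • x - 1 else 0) = 0 := by
        intro e f
        by_cases hef : e = f
        · simp [hef, hcd]
        · simp only [if_true, if_neg hef, zero_mul]
      rw [Finset.sum_eq_zero fun e _ => Finset.sum_eq_zero fun f _ => h1 e f, if_neg, mul_zero]
      rintro ⟨rfl, rfl⟩
      exact hcd rfl
  · simp only [if_neg hab, ite_mul, zero_mul]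
    rw [Finset.sum_eq_single a, Finset.sum_eq_single b]
    · by_cases h : a = c ∧ b = d
      · obtain ⟨rfl, rfl⟩ := h
        rw [show (a : ℤ) + (b : ℤ) - (a : ℤ) - (b : ℤ) = 0 by ring]
        simp [hab]
      · simp [h, hab]
    · intro e _ he
      simp [he.symm]
    · simp
    · intro e _ he
      simp [he.symm]
    · simp

end Crossing

/-! ### Series and specialisation -/

section Series

variable {K : Type*} [Field K] {A : Type*} [Ring A] [Algebra K A] {n m : ℕ}

/-- Scalar series are central although `A⟦X⟧` is noncommutative. All commutation between R-matrices
and generators comes from this. -/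
theorem toSeries_commute (f : K⟦X⟧) (g : A⟦X⟧) : Commute (toSeries A f) g := by
  ext r
  rw [PowerSeries.coeff_mul, PowerSeries.coeff_mul, ← Finset.Nat.sum_antidiagonal_swap]
  refine Finset.sum_congr rfl fun p _ => ?_
  simp only [toSeries, PowerSeries.coeff_map, Prod.fst_swap, Prod.snd_swap]
  exact Algebra.commutes _ _

theorem coeff_smul_series (c : K) (f : A⟦X⟧) (r : ℕ) :
    PowerSeries.coeff r (c • f) = c • PowerSeries.coeff r f := rfl

theorem toSeries_smul (c : K) (f : K⟦X⟧) : toSeries A (c • f) = c • toSeries A f := by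
  ext r
  rw [coeff_smul_series, toSeries, PowerSeries.coeff_map, PowerSeries.coeff_map,
    coeff_smul_series, smul_eq_mul, map_mul, Algebra.smul_def]

theorem toSeries_C (c : K) : toSeries A (PowerSeries.C c) = constSeries A c := by
  simp only [toSeries, constSeries, RingHom.comp_apply]
  exact PowerSeries.map_C _ _

theorem toSeries_X : toSeries A (PowerSeries.X : K⟦X⟧) = PowerSeries.X := by
  simp [toSeries]

theorem constSeries_mul (c : K) (f : A⟦X⟧) : constSeries A c * f = c • f := by
  ext r
  rw [coeff_smul_series, constSeries, RingHom.comp_apply, PowerSeries.coeff_C_mul,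
    Algebra.smul_def]

theorem coeff_scaleArg (c : K) (f : A⟦X⟧) (r : ℕ) :
    PowerSeries.coeff r (scaleArg c f) = (c⁻¹ ^ r) • PowerSeries.coeff r f := by
  simp [scaleArg]

/-- The substitution `u ↦ c u` as a ring homomorphism. -/
def scaleHom (A : Type*) [Ring A] [Algebra K A] (c : K) : A⟦X⟧ →+* A⟦X⟧ where
  toFun := scaleArg c
  map_one' := by
    ext r
    rw [coeff_scaleArg, PowerSeries.coeff_one]
    split_ifs with h <;> simp [h]
  map_zero' := by
    ext r
    simp [coeff_scaleArg]
  map_add' f g := by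
    ext r
    simp [coeff_scaleArg]
  map_mul' f g := by
    ext r
    simp only [coeff_scaleArg, PowerSeries.coeff_mul, Finset.smul_sum]
    refine Finset.sum_congr rfl fun p hp => ?_
    rw [← Finset.HasAntidiagonal.mem_antidiagonal.mp hp, pow_add, smul_mul_smul_comm]

theorem scaleHom_apply (c : K) (f : A⟦X⟧) : scaleHom A c f = scaleArg c f := rfl

theorem scaleArg_scaleArg (c d : K) (f : A⟦X⟧) :
    scaleArg c (scaleArg d f) = scaleArg (c * d) f := by
  ext r
  simp only [coeff_scaleArg, smul_smul, mul_inv, mul_pow]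

theorem scaleArg_smul (c d : K) (f : A⟦X⟧) : scaleArg c (d • f) = d • scaleArg c f := by
  ext r
  simp only [coeff_scaleArg, coeff_smul_series, smul_comm d]

theorem scaleArg_constSeries (c d : K) : scaleArg c (constSeries A d) = constSeries A d := by
  ext r
  rw [coeff_scaleArg]
  simp only [constSeries, RingHom.comp_apply, PowerSeries.coeff_C]
  split_ifs with h <;> simp [h]

theorem scaleArg_toSeries (c : K) (f : K⟦X⟧) :
    scaleArg c (toSeries A f) = toSeries A (scaleArg c f) := by
  ext r
  simp only [coeff_scaleArg, toSeries, PowerSeries.coeff_map, smul_eq_mul, map_mul,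
    Algebra.smul_def]

theorem central_smul_mul {R : Type*} [Ring R] {ι κ μ : Type*} [Fintype κ] (c : R)
    (M : Matrix ι κ R) (N : Matrix κ μ R) : (c • M) * N = c • (M * N) := by
  simp

theorem mul_central_smul {R : Type*} [Ring R] {ι κ μ : Type*} [Fintype κ] {c : R}
    (hc : ∀ a, Commute c a) (M : Matrix ι κ R) (N : Matrix κ μ R) :
    M * (c • N) = c • (M * N) := by
  ext i j
  simp only [Matrix.mul_apply, Matrix.smul_apply, smul_eq_mul, Finset.mul_sum]
  refine Finset.sum_congr rfl fun k _ => ?_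
  rw [← mul_assoc, ← (hc _).eq, mul_assoc]

/-- The specialisation `u⁻¹ ↦ c₀ u⁻¹`, `v⁻¹ ↦ c₁ u⁻¹` of series in two variables, combined with
a homomorphism of the coefficients. -/
def specialize {F : Type*} [Ring F] [Algebra K F] (π : F →ₐ[K] A) (c : Fin 2 → K) :
    MvPowerSeries (Fin 2) F →ₐ[K] A⟦X⟧ :=
  AlgHom.ofLinearMap
    { toFun := fun f => PowerSeries.mk fun r => ∑ d ∈ Finset.finsuppAntidiag Finset.univ r,
        (c 0 ^ d 0 * c 1 ^ d 1) • π (MvPowerSeries.coeff d f)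
      map_add' := fun f g => by
        ext r
        simp [Finset.sum_add_distrib]
      map_smul' := fun a f => by
        ext r
        simp only [PowerSeries.coeff_mk, coeff_smul_series, RingHom.id_apply, Finset.smul_sum]
        refine Finset.sum_congr rfl fun d _ => ?_
        have h : MvPowerSeries.coeff d (a • f) = a • MvPowerSeries.coeff d f := rfl
        rw [h, map_smul, smul_comm] }
    (by
      ext r
      simp only [LinearMap.coe_mk, AddHom.coe_mk, PowerSeries.coeff_mk, PowerSeries.coeff_one,
        MvPowerSeries.coeff_one]
      split_ifs with h
      · subst h
        rw [Finset.finsuppAntidiag_zero]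
        simp
      · refine Finset.sum_eq_zero fun d hd => ?_
        have hd0 : d ≠ 0 := by
          rintro rfl
          simp [Finset.mem_finsuppAntidiag, eq_comm, h] at hd
        rw [if_neg hd0]
        simp)
    (by
      intro f g
      ext r
      simp only [LinearMap.coe_mk, AddHom.coe_mk, PowerSeries.coeff_mk, PowerSeries.coeff_mul,
        MvPowerSeries.coeff_mul, map_sum, map_mul, Finset.smul_sum, Finset.sum_mul_sum]
      rw [Finset.sum_sigma']
      simp only [← Finset.sum_product']
      rw [Finset.sum_sigma']
      -- Choosing an exponent d of degree r and splitting it as e + f is the same as choosing e and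
      -- f with total degree r.
      refine Finset.sum_nbij' (fun x => ⟨(∑ i, x.2.1 i, ∑ i, x.2.2 i), x.2⟩)
        (fun x => ⟨x.2.1 + x.2.2, x.2⟩) ?_ ?_ ?_ ?_ ?_
      · rintro ⟨d, e, f⟩ h
        simp only [Finset.mem_sigma, Finset.mem_finsuppAntidiag,
          Finset.HasAntidiagonal.mem_antidiagonal,
          Finset.mem_product, Finset.subset_univ, and_true] at h ⊢
        rw [← h.1, ← h.2, ← Finset.sum_add_distrib]
        simp
      · rintro ⟨⟨i, j⟩, e, f⟩ h
        simp only [Finset.mem_sigma, Finset.mem_finsuppAntidiag,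
          Finset.HasAntidiagonal.mem_antidiagonal,
          Finset.mem_product, Finset.subset_univ, and_true] at h ⊢
        rw [← h.1, ← h.2.1, ← h.2.2, ← Finset.sum_add_distrib]
        simp
      · rintro ⟨d, e, f⟩ h
        simp only [Finset.mem_sigma, Finset.HasAntidiagonal.mem_antidiagonal] at h
        simp [h.2]
      · rintro ⟨⟨i, j⟩, e, f⟩ h
        simp only [Finset.mem_sigma, Finset.mem_finsuppAntidiag, Finset.mem_product,
          Finset.subset_univ, and_true] at h
        simp [← h.2.1, ← h.2.2]
      · rintro ⟨d, e, f⟩ h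
        simp only [Finset.mem_sigma, Finset.HasAntidiagonal.mem_antidiagonal] at h
        rw [smul_mul_smul_comm, ← h.2]
        congr 1
        simp only [Finsupp.add_apply]
        ring)

theorem coeff_specialize {F : Type*} [Ring F] [Algebra K F] (π : F →ₐ[K] A) (c : Fin 2 → K)
    (f : MvPowerSeries (Fin 2) F) (r : ℕ) :
    PowerSeries.coeff r (specialize π c f) = ∑ d ∈ Finset.finsuppAntidiag Finset.univ r,
      (c 0 ^ d 0 * c 1 ^ d 1) • π (MvPowerSeries.coeff d f) := by
  simp only [specialize, AlgHom.ofLinearMap_apply, LinearMap.coe_mk, AddHom.coe_mk,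
    PowerSeries.coeff_mk]

theorem coeff_specialize_single {F : Type*} [Ring F] [Algebra K F] (π : F →ₐ[K] A)
    (c : Fin 2 → K) (e : Fin 2) (f : MvPowerSeries (Fin 2) F)
    (hf : ∀ d : Fin 2 →₀ ℕ, d ≠ Finsupp.single e (d e) → MvPowerSeries.coeff d f = 0) (r : ℕ) :
    PowerSeries.coeff r (specialize π c f) =
      c e ^ r • π (MvPowerSeries.coeff (Finsupp.single e r) f) := by
  rw [coeff_specialize, Finset.sum_eq_single (Finsupp.single e r)]
  · congr 1
    fin_cases e <;> simp
  · intro d hd hne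
    rw [hf d, map_zero π, smul_zero]
    intro h
    apply hne
    rw [Finset.mem_finsuppAntidiag] at hd
    have : d e = r := by
      rw [← hd.1, h]
      simp
    rw [← this]
    exact h
  · intro h
    exfalso
    apply h
    simp [Finset.mem_finsuppAntidiag]

theorem specialize_X {F : Type*} [Ring F] [Algebra K F] (π : F →ₐ[K] A) (c : Fin 2 → K)
    (e : Fin 2) : specialize π c (MvPowerSeries.X e) = c e • PowerSeries.X := by
  ext r
  rw [coeff_specialize_single π c e, coeff_smul_series, MvPowerSeries.coeff_X,
    PowerSeries.coeff_X]
  · by_cases h : r = 1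
    · simp [h]
    · have : Finsupp.single e r ≠ Finsupp.single e 1 := fun h' =>
        h (Finsupp.single_injective e h')
      simp [h, this]
  · intro d hd
    rw [MvPowerSeries.coeff_X, if_neg]
    rintro rfl
    simp at hd

end Series

/-! ### The reflection equation -/

section Reflection

theorem rMatrix_map {K : Type*} [Field K] {B C : Type*} [Ring B] [Algebra K B] [Ring C]
    [Algebra K C] {n : ℕ} (φ : B →ₐ[K] C) (q : K) (x y : B) :
    (rMatrix n q x y).map φ = rMatrix n q (φ x) (φ y) := by
  ext r c
  simp only [rMatrix, Matrix.map_apply, Matrix.of_apply]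
  split_ifs <;> simp

/-- `toSeries` as an algebra homomorphism. -/
def toSeriesAlg {K : Type*} [Field K] (A : Type*) [Ring A] [Algebra K A] : K⟦X⟧ →ₐ[K] A⟦X⟧ where
  __ := toSeries A
  commutes' c := by
    have h : ∀ (B : Type _) [Ring B] [Algebra K B], algebraMap K B⟦X⟧ c = constSeries B c := by
      intro B _ _
      rw [Algebra.algebraMap_eq_smul_one, ← constSeries_mul, mul_one]
    show toSeries A (algebraMap K K⟦X⟧ c) = _
    rw [h A, Algebra.algebraMap_eq_smul_one, toSeries_smul, map_one, ← constSeries_mul, mul_one]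

theorem toSeriesAlg_apply {K : Type*} [Field K] (A : Type*) [Ring A] [Algebra K A] (f : K⟦X⟧) :
    toSeriesAlg A f = toSeries A f := rfl

variable {K : Type*} [Field K] {q : K} {n : ℕ} {g : SymmetryType}

variable (K q n g) in
/-- The projection from the free algebra. -/
def toYangian : Free K n g →ₐ[K] TwistedYangian K q n g :=
  RingQuot.mkAlgHom K (Rel K q n g)

theorem toYangian_rel {x y : Free K n g} (h : Rel K q n g x y) :
    toYangian K q n g x = toYangian K q n g y :=
  RingQuot.mkAlgHom_rel K h

theorem coeff_sMatrix (i j : Fin n) (r : ℕ) :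
    PowerSeries.coeff r (sMatrix K q n g i j) = toYangian K q n g (gS K i j r) :=
  PowerSeries.coeff_mk r fun r => toYangian K q n g (gS K i j r)

theorem specialize_gSeries (c : Fin 2 → K) (e : Fin 2) (i j : Fin n) :
    specialize (toYangian K q n g) c (gSeries K n g e i j) =
      (scaleArg (c e)⁻¹ (sMatrix K q n g i j) : (TwistedYangian K q n g)⟦X⟧) := by
  have hc : ∀ d : Fin 2 →₀ ℕ, MvPowerSeries.coeff d (gSeries K n g e i j) =
      if d = Finsupp.single e (d e) then gS K i j (d e) else 0 := fun d => rfl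
  ext r
  refine (coeff_specialize_single _ c e _ (fun d hd => ?_) r).trans ?_
  · rw [hc, if_neg hd]
  · refine Eq.trans ?_ (coeff_scaleArg _ _ _).symm
    rw [hc, inv_inv, coeff_sMatrix]
    simp

theorem specialize_reflection (c : Fin 2 → K) :
    (reflectionLeft K q n g).map (specialize (toYangian K q n g) c) =
      (reflectionRight K q n g).map (specialize (toYangian K q n g) c) := by
  ext i j r
  simp only [Matrix.map_apply, coeff_specialize]
  refine Finset.sum_congr rfl fun d _ => ?_
  rw [toYangian_rel (Rel.reflection g i j d)]

theorem map_kronecker_one {B C : Type*} [Ring B] [Ring C] (φ : B →+* C)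
    (T : Matrix (Fin n) (Fin n) B) :
    (T ⊗ₖ (1 : Matrix (Fin n) (Fin n) B)).map φ = T.map φ ⊗ₖ 1 := by
  ext r s
  simp only [Matrix.map_apply, Matrix.kroneckerMap_apply, Matrix.one_apply]
  split_ifs <;> simp

theorem map_one_kronecker {B C : Type*} [Ring B] [Ring C] (φ : B →+* C)
    (T : Matrix (Fin n) (Fin n) B) :
    ((1 : Matrix (Fin n) (Fin n) B) ⊗ₖ T).map φ = 1 ⊗ₖ T.map φ := by
  ext r s
  simp only [Matrix.map_apply, Matrix.kroneckerMap_apply, Matrix.one_apply]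
  split_ifs <;> simp

theorem transposeFirst_map {B C : Type*} (φ : B → C)
    (T : Matrix (Fin n × Fin n) (Fin n × Fin n) B) :
    (transposeFirst T).map φ = transposeFirst (T.map φ) := rfl

/-- The reflection equation at `u⁻¹ = c₀ X`, `v⁻¹ = c₁ X`. -/
theorem reflection_specialized (c : Fin 2 → K) :
    rMatrix n q (c 1 • PowerSeries.X) (c 0 • PowerSeries.X) *
        ((sMatrix K q n g).map (scaleArg (c 0)⁻¹) ⊗ₖ 1) *
        transposeFirst (rMatrix n q ((c 0 • PowerSeries.X) * (c 1 • PowerSeries.X)) 1) *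
        (1 ⊗ₖ (sMatrix K q n g).map (scaleArg (c 1)⁻¹)) =
      (1 ⊗ₖ (sMatrix K q n g).map (scaleArg (c 1)⁻¹)) *
        transposeFirst (rMatrix n q ((c 0 • PowerSeries.X) * (c 1 • PowerSeries.X)) 1) *
        ((sMatrix K q n g).map (scaleArg (c 0)⁻¹) ⊗ₖ 1) *
        rMatrix n q (c 1 • PowerSeries.X) (c 0 • PowerSeries.X) := by
  have h := specialize_reflection (q := q) (n := n) (g := g) c
  have hS : ∀ e, (gSeries K n g e).map (specialize (toYangian K q n g) c) =
      (sMatrix K q n g).map (scaleArg (c e)⁻¹) := by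
    intro e
    ext1 i j
    exact specialize_gSeries c e i j
  have k1 := map_kronecker_one
    (specialize (toYangian K q n g) c : _ →+* (TwistedYangian K q n g)⟦X⟧) (gSeries K n g 0)
  have k2 := map_one_kronecker
    (specialize (toYangian K q n g) c : _ →+* (TwistedYangian K q n g)⟦X⟧) (gSeries K n g 1)
  simp only [AlgHom.coe_toRingHom] at k1 k2
  simp only [reflectionLeft, reflectionRight, Matrix.map_mul, transposeFirst_map, rMatrix_map, k1,
    k2, hS, map_mul, map_one, specialize_X] at h
  exact h

end Reflection

/-! ### The normalised reflection equation -/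

section Normalised

variable {K : Type*} [Field K] {A : Type*} [Ring A] [Algebra K A] {n m : ℕ}

theorem rBarT_eq (q : K) (k l : Fin m) :
    rBarT A n q k l = onTwo k l ((transposeFirst (rBar n q
      (PowerSeries.C (q ^ (2 * (k : ℕ) + 2 * (l : ℕ))) * PowerSeries.X ^ 2))).map
        (toSeries A)) := rfl

theorem sub_one_ne_zero_of_constantCoeff {x : K⟦X⟧} (hx : PowerSeries.constantCoeff x = 0) :
    PowerSeries.constantCoeff (x - 1) ≠ 0 := by
  simp [hx]

theorem transposeFirst_rBar (q : K) (x : K⟦X⟧) :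
    transposeFirst (rBar n q x) = (x - 1)⁻¹ • transposeFirst (rMatrix n q x 1) := rfl

theorem smul_transposeFirst_rBar (q : K) {x : K⟦X⟧} (hx : PowerSeries.constantCoeff x = 0) :
    (x - 1) • transposeFirst (rBar n q x) = transposeFirst (rMatrix n q x 1) := by
  rw [transposeFirst_rBar, smul_smul,
    PowerSeries.mul_inv_cancel _ (sub_one_ne_zero_of_constantCoeff hx), one_smul]

theorem map_toSeries_smul {ι κ : Type*} (f : K⟦X⟧) (M : Matrix ι κ K⟦X⟧) :
    (f • M).map (toSeries A) = toSeries A f • M.map (toSeries A) := by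
  ext1 i j
  simp

theorem X_smul_injective {ι κ : Type*} {M M' : Matrix ι κ A⟦X⟧}
    (h : (PowerSeries.X : A⟦X⟧) • M = (PowerSeries.X : A⟦X⟧) • M') : M = M' := by
  ext i j r
  have := congrArg (PowerSeries.coeff (r + 1)) (congrFun (congrFun h i) j)
  simpa [PowerSeries.coeff_succ_X_mul] using this

theorem toSeries_smul_cancel {ι κ : Type*} {f : K⟦X⟧} (hf : PowerSeries.constantCoeff f ≠ 0)
    {M M' : Matrix ι κ A⟦X⟧} (h : toSeries A f • M = toSeries A f • M') : M = M' := by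
  have := congrArg (fun N => toSeries A f⁻¹ • N) h
  simpa only [smul_smul, ← map_mul, PowerSeries.inv_mul_cancel _ hf, map_one, one_smul] using this

/-- The reflection equation for neighbouring spectral parameters `q^{-2k} u`, `q^{-2k-2} u`. -/
def SatisfiesReflection (q : K) (S : Matrix (Fin n) (Fin n) A⟦X⟧) : Prop :=
  ∀ k : ℕ,
    (1 - (qFlip n q).map (constSeries A)) * (S.map (scaleArg (q ^ (-2 * (k : ℤ)))) ⊗ₖ 1) *
        (transposeFirst (rBar n q
          (PowerSeries.C (q ^ (2 * k + 2 * (k + 1))) * PowerSeries.X ^ 2))).map (toSeries A) *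
        (1 ⊗ₖ S.map (scaleArg (q ^ (-2 * ((k + 1 : ℕ) : ℤ))))) =
      (1 ⊗ₖ S.map (scaleArg (q ^ (-2 * ((k + 1 : ℕ) : ℤ))))) *
        (transposeFirst (rBar n q
          (PowerSeries.C (q ^ (2 * k + 2 * (k + 1))) * PowerSeries.X ^ 2))).map (toSeries A) *
        (S.map (scaleArg (q ^ (-2 * (k : ℤ)))) ⊗ₖ 1) * (1 - (qFlip n q).map (constSeries A))

/-- At u⁻¹ = q^{2k} X and v⁻¹ = q^{2k+2} X the two arguments of R differ by the factor q², so
`rMatrix_special` turns R into a multiple of 1 − P^q. What remains is to cancel the scalars X, (q² −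
1) q^{2k} and x − 1. -/
theorem satisfiesReflection_sMatrix {q : K} (hq : q ≠ 0) (hq2 : q ^ 2 ≠ 1) (g : SymmetryType) :
    SatisfiesReflection q (sMatrix K q n g) := by
  intro k
  have h := reflection_specialized (q := q) (n := n) (g := g) ![q ^ (2 * k), q ^ (2 * (k + 1))]
  have e0 : (q ^ (2 * k))⁻¹ = q ^ (-2 * (k : ℤ)) := by
    rw [neg_mul, zpow_neg]
    exact_mod_cast rfl
  have e1 : (q ^ (2 * (k + 1)))⁻¹ = q ^ (-2 * ((k + 1 : ℕ) : ℤ)) := by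
    rw [neg_mul, zpow_neg]
    exact_mod_cast rfl
  simp only [Matrix.cons_val_zero, Matrix.cons_val_one, e0, e1] at h
  set Y := TwistedYangian K q n g
  set x : K⟦X⟧ := PowerSeries.C (q ^ (2 * k + 2 * (k + 1))) * PowerSeries.X ^ 2 with hx
  have hx0 : PowerSeries.constantCoeff x = 0 := by simp [hx]
  have hX : ∀ c : K, c • (PowerSeries.X : Y⟦X⟧) = toSeriesAlg Y (c • (PowerSeries.X : K⟦X⟧)) := by
    intro c
    rw [toSeriesAlg_apply, toSeries_smul, toSeries_X]
  have hmap : ∀ M : Matrix (Fin n × Fin n) (Fin n × Fin n) K⟦X⟧,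
      M.map (toSeriesAlg Y) = M.map (toSeries Y) := fun _ => rfl
  have hR : rMatrix n q (q ^ (2 * (k + 1)) • PowerSeries.X) (q ^ (2 * k) • PowerSeries.X) =
      (PowerSeries.X : Y⟦X⟧) • (toSeries Y (PowerSeries.C ((q ^ 2 - 1) * q ^ (2 * k))) •
        (1 - (qFlip n q).map (constSeries Y))) := by
    have hz : toSeries Y (((q ^ 2 - 1) * q ^ (2 * k)) • (PowerSeries.X : K⟦X⟧)) =
        PowerSeries.X * toSeries Y (PowerSeries.C ((q ^ 2 - 1) * q ^ (2 * k))) := by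
      rw [PowerSeries.smul_eq_C_mul, map_mul, toSeries_X, (toSeries_commute _ _).eq]
    have hF : (qFlip n q).map (algebraMap K K⟦X⟧) =
        (qFlip n q).map (PowerSeries.C : K →+* K⟦X⟧) := rfl
    have hF' : ((qFlip n q).map (PowerSeries.C : K →+* K⟦X⟧)).map (toSeries Y) =
        (qFlip n q).map (constSeries Y) := by
      ext1 a b
      exact toSeries_C (A := Y) (qFlip n q a b)
    rw [hX, hX, ← rMatrix_map, hmap, show q ^ (2 * (k + 1)) = q ^ 2 * q ^ (2 * k) by ring,
      mul_smul, rMatrix_special hq, map_toSeries_smul, smul_smul,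
      Matrix.map_sub (toSeries Y) (map_sub _),
      Matrix.map_one _ (map_zero _) (map_one _), hF, hF', hz, mul_smul]
  have hT : transposeFirst (rMatrix n q ((q ^ (2 * k) • PowerSeries.X) *
      (q ^ (2 * (k + 1)) • PowerSeries.X)) (1 : Y⟦X⟧)) =
      toSeries Y (x - 1) • (transposeFirst (rBar n q x)).map (toSeries Y) := by
    rw [← map_toSeries_smul, smul_transposeFirst_rBar q hx0, hX, hX, ← map_mul,
      ← map_one (toSeriesAlg (K := K) Y), ← rMatrix_map, ← transposeFirst_map, hmap, hx]
    congr 3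
    rw [PowerSeries.smul_eq_C_mul, PowerSeries.smul_eq_C_mul, pow_add, map_mul]
    ring
  have hcX : ∀ a, Commute (PowerSeries.X : Y⟦X⟧) a := fun a => (PowerSeries.commute_X a).symm
  have hcT : ∀ (f : K⟦X⟧) (a : Y⟦X⟧), Commute (toSeries Y f) a := toSeries_commute
  rw [hR, hT] at h
  simp only [central_smul_mul, mul_central_smul hcX, mul_central_smul (hcT _)] at h
  have hc : PowerSeries.constantCoeff (PowerSeries.C ((q ^ 2 - 1) * q ^ (2 * k))) ≠ 0 := by
    simpa [sub_ne_zero, hq] using hq2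
  have hw := sub_one_ne_zero_of_constantCoeff hx0
  -- The cancellation lemmas strip the outermost scalar, so the unit x − 1 is brought to the front
  -- first.
  have hsw : ∀ M : Matrix (Fin n × Fin n) (Fin n × Fin n) Y⟦X⟧,
      (PowerSeries.X : Y⟦X⟧) • toSeries Y (PowerSeries.C ((q ^ 2 - 1) * q ^ (2 * k))) •
        toSeries Y (x - 1) • M =
      toSeries Y (x - 1) • (PowerSeries.X : Y⟦X⟧) •
        toSeries Y (PowerSeries.C ((q ^ 2 - 1) * q ^ (2 * k))) • M := by
    intro M
    rw [smul_smul, smul_smul, smul_smul, smul_smul, (hcT (x - 1) PowerSeries.X).eq,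
      mul_assoc, mul_assoc, (hcT (x - 1) (toSeries Y _)).eq]
  rw [hsw] at h
  exact toSeries_smul_cancel hc (X_smul_injective (toSeries_smul_cancel hw h))

end Normalised

/-! ### Intertwining the bracket with the simple flips -/

section Bracket

variable {K : Type*} [Field K] {A : Type*} [Ring A] [Algebra K A] {n m : ℕ}

theorem map_toSeries_onTwo (k l : Fin m) (T : Matrix (Fin n × Fin n) (Fin n × Fin n) K⟦X⟧) :
    onTwo k l (T.map (toSeries A)) = (onTwo k l T).map (toSeries A) :=
  (onTwo_map _ (map_zero _) k l T).symm

theorem onTwo_toSeries_commute {s : Set (Fin m)} {k l : Fin m}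
    (T : Matrix (Fin n × Fin n) (Fin n × Fin n) K⟦X⟧)
    {U : Matrix (Fin m → Fin n) (Fin m → Fin n) A⟦X⟧} (hU : ActsOn s U) (hk : k ∉ s)
    (hl : l ∉ s) : Commute (onTwo k l (T.map (toSeries A))) U := by
  refine (actsOn_onTwo k l _).commute hU ?_ fun I J I' J' => ?_
  · simp [Set.disjoint_left, hk, hl]
  · rw [map_toSeries_onTwo]
    exact toSeries_commute _ _

theorem rBarT_commute_rBarT (q : K) {i j k l : Fin m} (h1 : i ≠ k) (h2 : i ≠ l) (h3 : j ≠ k)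
    (h4 : j ≠ l) : Commute (rBarT A n q i j) (rBarT A n q k l) := by
  rw [rBarT_eq]
  exact onTwo_toSeries_commute _ (actsOn_onTwo k l _) (by simp [h1, h2]) (by simp [h3, h4])

theorem rBarT_commute_sAt (q : K) (S : Matrix (Fin n) (Fin n) A⟦X⟧) {i j k : Fin m} (h1 : i ≠ k)
    (h2 : j ≠ k) : Commute (rBarT A n q i j) (sAt q S k) := by
  rw [rBarT_eq]
  exact onTwo_toSeries_commute _ (actsOn_onOne k _) (by simp [h1]) (by simp [h2])

theorem rBarT_symm (q : K) (k l : Fin m) : rBarT A n q k l = rBarT A n q l k := by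
  have h : ∀ x : K⟦X⟧, (transposeFirst (rBar n q x)).submatrix Prod.swap Prod.swap =
      transposeFirst (rBar n q x) := by
    intro x
    rw [transposeFirst_rBar]
    exact congrArg (fun M => (x - 1)⁻¹ • M) (rMatrix_symm_transpose q x 1)
  rw [rBarT_eq, rBarT_eq, map_toSeries_onTwo, map_toSeries_onTwo, add_comm (2 * (k : ℕ)),
    ← onTwo_swap k l, h]

/-- The `q`-flip acting in the tensor factors `k` and `l`. -/
def flipAt (A : Type*) [Ring A] [Algebra K A] (n : ℕ) (q : K) (k l : Fin m) :
    Matrix (Fin m → Fin n) (Fin m → Fin n) A⟦X⟧ :=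
  onTwo k l ((qFlip n q).map (constSeries A))

theorem flipAt_eq (q : K) (k l : Fin m) :
    flipAt A n q k l = onTwo k l (((qFlip n q).map PowerSeries.C).map (toSeries A)) := by
  rw [flipAt]
  congr 1
  ext1 i j
  exact (toSeries_C _).symm

theorem flipAt_commute (q : K) {s : Set (Fin m)} {k l : Fin m}
    {U : Matrix (Fin m → Fin n) (Fin m → Fin n) A⟦X⟧} (hU : ActsOn s U) (hk : k ∉ s)
    (hl : l ∉ s) : Commute (1 - flipAt A n q k l) U := by
  rw [flipAt_eq]
  exact (Commute.one_left _).sub_left (onTwo_toSeries_commute _ hU hk hl)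

/-- Since `c` is the successor of `b`, the parameter of the pair `(a, c)` is q² times that of `(a,
b)`, which is the case of `one_sub_qFlip_mul_transpose`. The normalising denominators are scalars.
-/
theorem flipAt_mul_rBarT {q : K} (hq : q ≠ 0) (hq2 : q ^ 2 ≠ 1) {a b c : Fin m} (hab : a ≠ b)
    (hac : a ≠ c) (hbc : (c : ℕ) = b + 1) :
    (1 - flipAt A n q b c) * rBarT A n q a b * rBarT A n q a c =
      rBarT A n q a c * rBarT A n q a b * (1 - flipAt A n q b c) := by
  have hbc' : b ≠ c := by
    rintro rfl
    omega
  set ξ : K⟦X⟧ := PowerSeries.C (q ^ (2 * (a : ℕ) + 2 * (b : ℕ))) * PowerSeries.X ^ 2 with hξ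
  have hξ' : PowerSeries.C (q ^ (2 * (a : ℕ) + 2 * (c : ℕ))) * PowerSeries.X ^ 2 =
      q ^ 2 • ξ := by
    rw [hξ, PowerSeries.smul_eq_C_mul, ← mul_assoc, ← map_mul, hbc]
    congr 2
    ring
  have h := one_sub_qFlip_mul_transpose (n := n) hq hq2 ξ hab hac hbc'
  have h' := congrArg (fun M => (toSeries A).mapMatrix (((ξ - 1)⁻¹ * (q ^ 2 • ξ - 1)⁻¹) • M)) h
  rw [rBarT_eq, rBarT_eq, flipAt_eq, hξ', ← hξ, map_toSeries_onTwo, map_toSeries_onTwo,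
    map_toSeries_onTwo, transposeFirst_rBar, transposeFirst_rBar, onTwo_smul, onTwo_smul]
  have hF : (qFlip n q).map (algebraMap K K⟦X⟧) =
    (qFlip n q).map (PowerSeries.C : K →+* K⟦X⟧) := rfl
  rw [hF] at h'
  have hm : ∀ M : Matrix (Fin m → Fin n) (Fin m → Fin n) K⟦X⟧,
    M.map (toSeries A) = (toSeries A).mapMatrix M := fun _ => rfl
  simp only [hm]
  rw [← map_one (toSeries (K := K) A).mapMatrix, ← map_sub, ← map_mul, ← map_mul, ← map_mul, ←
      map_mul]
  simp only [smul_mul_assoc, mul_smul_comm, smul_smul] at h' ⊢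
  rw [mul_comm (q ^ 2 • ξ - 1)⁻¹]
  exact h'

theorem flipAt_mul_sAt {q : K} {S : Matrix (Fin n) (Fin n) A⟦X⟧} (hS : SatisfiesReflection q S)
    {k l : Fin m} (hkl : (l : ℕ) = k + 1) :
    (1 - flipAt A n q k l) * sAt q S k * rBarT A n q k l * sAt q S l =
      sAt q S l * rBarT A n q k l * sAt q S k * (1 - flipAt A n q k l) := by
  have hkl' : k ≠ l := by
    rintro rfl
    omega
  have h := congrArg (onTwo k l) (hS k)
  simp only [onTwo_mul hkl', onTwo_sub, onTwo_one, onTwo_kronecker_one hkl',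
    onTwo_one_kronecker hkl'] at h
  rw [rBarT_eq, sAt, sAt, flipAt, hkl]
  exact h

/-- `Z` can be moved past `F`. -/
def MovesPast {R : Type*} [Mul R] (F Z : R) : Prop := ∃ Z', F * Z = Z' * F

/-- Only the existence of `Z'` matters: what is used later is that a factor 1 − P^q stands on the
right, where 1 + P^q annihilates it. -/
theorem MovesPast.mul {R : Type*} [Semigroup R] {F Z W : R} (hZ : MovesPast F Z)
    (hW : MovesPast F W) : MovesPast F (Z * W) := by
  obtain ⟨Z', hZ⟩ := hZ
  obtain ⟨W', hW⟩ := hW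
  exact ⟨Z' * W', by rw [← mul_assoc, hZ, mul_assoc, hW, mul_assoc]⟩

theorem _root_.Commute.movesPast {R : Type*} [Mul R] {F Z : R} (h : Commute F Z) :
    MovesPast F Z := ⟨Z, h⟩

theorem movesPast_list_prod {R : Type*} [Monoid R] {F : R} (L : List R)
    (h : ∀ Z ∈ L, Commute F Z) : MovesPast F L.prod :=
  (Commute.list_prod_right L F h).movesPast

theorem commute_bracket (q : K) (S : Matrix (Fin n) (Fin n) A⟦X⟧)
    (U : Matrix (Fin m → Fin n) (Fin m → Fin n) A⟦X⟧) (L : List (Fin m)) (hL : L.Nodup)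
    (h1 : ∀ i ∈ L, Commute U (sAt q S i))
    (h2 : ∀ i ∈ L, ∀ j ∈ L, i ≠ j → Commute U (rBarT A n q i j)) :
    Commute U (bracket q S L) := by
  induction L with
  | nil => exact Commute.one_right _
  | cons k L ih =>
    rw [List.nodup_cons] at hL
    refine ((h1 k (by simp)).mul_right (Commute.list_prod_right _ _ ?_)).mul_right
      (ih hL.2 (fun i hi => h1 i (by simp [hi]))
        fun i hi j hj => h2 i (by simp [hi]) j (by simp [hj]))
    intro Z hZ
    obtain ⟨l, hl, rfl⟩ := List.mem_map.mp hZ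
    exact h2 k (by simp) l (by simp [hl]) (by rintro rfl; exact hL.1 hl)

theorem list_prod_map_mul_comm {R ι : Type*} [Monoid R] (f g : ι → R) (L : List ι)
    (hL : L.Nodup) (h : ∀ i ∈ L, ∀ j ∈ L, i ≠ j → Commute (f i) (g j)) :
    (L.map f).prod * (L.map g).prod = (L.map fun i => f i * g i).prod := by
  induction L with
  | nil => simp
  | cons k L ih =>
    rw [List.nodup_cons] at hL
    rw [List.map_cons, List.map_cons, List.map_cons, List.prod_cons, List.prod_cons,
      List.prod_cons, ← ih hL.2 fun i hi j hj => h i (by simp [hi]) j (by simp [hj])]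
    have hc : Commute (L.map f).prod (g k) := by
      refine Commute.list_prod_left _ _ fun Z hZ => ?_
      obtain ⟨i, hi, rfl⟩ := List.mem_map.mp hZ
      exact h i (by simp [hi]) k (by simp) (by rintro rfl; exact hL.1 hi)
    rw [mul_assoc, mul_assoc, ← mul_assoc _ (g k), hc.eq]
    simp only [mul_assoc]

/-- Moving S_l to the left groups the bracket into S_k R̄ᵗ_{kl} S_l, the pairs R̄ᵗ_{kx} R̄ᵗ_{lx},
and a bracket away from `k` and `l`. These are passed by the reflection equation, by the Yang–Baxter
equation and by commutation. -/
theorem movesPast_bracket_pair {q : K} (hq : q ≠ 0) (hq2 : q ^ 2 ≠ 1)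
    {S : Matrix (Fin n) (Fin n) A⟦X⟧} (hS : SatisfiesReflection q S) {k l : Fin m}
    (hkl : (l : ℕ) = k + 1) (L : List (Fin m)) (hL : (k :: l :: L).Nodup) :
    MovesPast (1 - flipAt A n q k l) (bracket q S (k :: l :: L)) := by
  have hkl' : k ≠ l := by
    rintro rfl
    omega
  simp only [List.nodup_cons, List.mem_cons, not_or] at hL
  obtain ⟨⟨-, hk⟩, hl, hL⟩ := hL
  have hkn : ∀ i ∈ L, k ≠ i := by
    rintro i hi rfl
    exact hk hi
  have hln : ∀ i ∈ L, l ≠ i := by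
    rintro i hi rfl
    exact hl hi
  have hc : Commute (L.map fun x => rBarT A n q k x).prod (sAt q S l) := by
    refine Commute.list_prod_left _ _ fun Z hZ => ?_
    obtain ⟨i, hi, rfl⟩ := List.mem_map.mp hZ
    exact rBarT_commute_sAt q S hkl' (hln i hi).symm
  have e : bracket q S (k :: l :: L) = sAt q S k * rBarT A n q k l * sAt q S l *
      (L.map fun x => rBarT A n q k x * rBarT A n q l x).prod * bracket q S L := by
    rw [← list_prod_map_mul_comm _ _ L hL fun i hi j hj hij =>
      rBarT_commute_rBarT q hkl' (hkn j hj) (hln i hi).symm hij]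
    simp only [bracket, List.map_cons, List.prod_cons]
    have := hc.eq
    simp only [mul_assoc]
    rw [← mul_assoc _ (sAt q S l), this]
    simp only [mul_assoc]
  rw [e]
  refine (MovesPast.mul ⟨sAt q S l * rBarT A n q k l * sAt q S k, ?_⟩ ?_).mul
    (Commute.movesPast ?_)
  · simp only [← mul_assoc]
    exact flipAt_mul_sAt hS hkl
  · clear e hc
    induction L with
    | nil => exact (Commute.one_right _).movesPast
    | cons x L ih =>
      rw [List.nodup_cons] at hL
      rw [List.map_cons, List.prod_cons]
      refine MovesPast.mul ⟨rBarT A n q l x * rBarT A n q k x, ?_⟩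
        (ih (by simp_all) (by simp_all) hL.2 (by simp_all) (by simp_all))
      rw [rBarT_symm q k, rBarT_symm q l, ← mul_assoc]
      exact flipAt_mul_rBarT hq hq2 (hkn x (by simp)).symm (hln x (by simp)).symm hkl
  · refine commute_bracket q S _ L hL (fun i hi => ?_) fun i hi j hj _ => ?_
    · exact flipAt_commute q (actsOn_onOne i _) (by simp [hkn i hi]) (by simp [hln i hi])
    · exact flipAt_commute q (actsOn_onTwo i j _) (by simp [hkn i hi, hkn j hj])
        (by simp [hln i hi, hln j hj])

/-- A site `i` in front of `k` contributes the adjacent pair R̄ᵗ_{ik} R̄ᵗ_{il}, which the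
Yang–Baxter equation handles; its other factors commute with the flip. -/
theorem movesPast_bracket {q : K} (hq : q ≠ 0) (hq2 : q ^ 2 ≠ 1)
    {S : Matrix (Fin n) (Fin n) A⟦X⟧} (hS : SatisfiesReflection q S) {k l : Fin m}
    (hkl : (l : ℕ) = k + 1) (L' L : List (Fin m)) (hL : (L' ++ k :: l :: L).Nodup) :
    MovesPast (1 - flipAt A n q k l) (bracket q S (L' ++ k :: l :: L)) := by
  induction L' with
  | nil => exact movesPast_bracket_pair hq hq2 hS hkl L hL
  | cons i L' ih =>
    rw [List.cons_append, List.nodup_cons] at hL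
    have hik : i ≠ k := by
      rintro rfl
      exact hL.1 (by simp)
    have hil : i ≠ l := by
      rintro rfl
      exact hL.1 (by simp)
    have hc : ∀ L'' : List (Fin m), k ∉ L'' → l ∉ L'' →
        MovesPast (1 - flipAt A n q k l) (L''.map fun x => rBarT A n q i x).prod := by
      intro L'' hk hl
      refine movesPast_list_prod _ fun Z hZ => ?_
      obtain ⟨x, hx, rfl⟩ := List.mem_map.mp hZ
      have hkx : k ≠ x := by
        rintro rfl
        exact hk hx
      have hlx : l ≠ x := by
        rintro rfl
        exact hl hx
      exact flipAt_commute q (actsOn_onTwo i x _) (by simp [hik.symm, hkx])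
        (by simp [hil.symm, hlx])
    have hnd := hL.2
    rw [List.nodup_append] at hnd
    simp only [List.nodup_cons, List.mem_cons, not_or] at hnd
    simp only [List.cons_append, bracket, List.map_append, List.prod_append, List.map_cons,
      List.prod_cons]
    refine MovesPast.mul (MovesPast.mul ?_ (MovesPast.mul ?_ ?_)) (ih hL.2)
    · exact (flipAt_commute q (actsOn_onOne i _) (by simp [hik.symm])
        (by simp [hil.symm])).movesPast
    · exact hc L' (fun h => hnd.2.2 k h k (by simp) rfl) fun h => hnd.2.2 l h l (by simp) rfl
    · rw [← mul_assoc]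
      refine MovesPast.mul ⟨rBarT A n q i l * rBarT A n q i k, ?_⟩
        (hc L hnd.2.1.1.2 hnd.2.1.2.1)
      rw [← mul_assoc]
      exact flipAt_mul_rBarT hq hq2 hik hil hkl

theorem finRange_eq_append {k l : Fin m} (hkl : (l : ℕ) = k + 1) :
    ∃ L' L, List.finRange m = L' ++ k :: l :: L := by
  refine ⟨(List.finRange m).take k, (List.finRange m).drop (k + 2), ?_⟩
  have hk : (k : ℕ) < (List.finRange m).length := by simp
  have hl : (k : ℕ) + 1 < (List.finRange m).length := by simp [← hkl]
  conv_lhs => rw [← List.take_append_drop k (List.finRange m), List.drop_eq_getElem_cons hk,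
    List.drop_eq_getElem_cons hl]
  congr 2
  · simp
  · congr 1
    ext
    simp [hkl]

theorem movesPast_bracket_finRange {q : K} (hq : q ≠ 0) (hq2 : q ^ 2 ≠ 1)
    {S : Matrix (Fin n) (Fin n) A⟦X⟧} (hS : SatisfiesReflection q S) {k l : Fin m}
    (hkl : (l : ℕ) = k + 1) :
    MovesPast (1 - flipAt A n q k l) (bracket q S (List.finRange m)) := by
  obtain ⟨L', L, h⟩ := finRange_eq_append hkl
  rw [h]
  exact movesPast_bracket hq hq2 hS hkl L' L (h ▸ List.nodup_finRange m)

end Bracket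

/-! ### Skew-symmetry of the minors -/

section Skew

/-- The reflection equation controls only neighbouring sites, and the adjacent transpositions
generate the symmetric group. -/
theorem perm_adjacent_induction {m : ℕ} {P : Equiv.Perm (Fin m) → Prop} (one : P 1)
    (mul : ∀ σ τ, P σ → P τ → P (σ * τ))
    (swap : ∀ k l : Fin m, (l : ℕ) = k + 1 → P (Equiv.swap k l)) (σ : Equiv.Perm (Fin m)) :
    P σ := by
  cases m with
  | zero =>
    rw [Subsingleton.elim σ 1]
    exact one
  | succ m =>
    have h : σ ∈ Submonoid.closure
        (Set.range fun i : Fin m => Equiv.swap i.castSucc i.succ) := by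
      rw [Equiv.Perm.mclosure_swap_castSucc_succ]
      trivial
    induction h using Submonoid.closure_induction with
    | mem x hx =>
      obtain ⟨i, rfl⟩ := hx
      exact swap _ _ (by simp)
    | one => exact one
    | mul x y _ _ hx hy => exact mul x y hx hy

/-- The sign of a permutation is the parity of the change in inversions. It therefore merges with
the powers of q in `qPerm` into powers of −q. -/
theorem neg_one_pow_inversions {n m : ℕ} (σ : Equiv.Perm (Fin m)) :
    ∀ I : Fin m → Fin n, Function.Injective I →
      (-1 : ℤ) ^ inversions (I ∘ σ) = Equiv.Perm.sign σ * (-1) ^ inversions I := by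
  induction σ using perm_adjacent_induction with
  | one =>
    intro I _
    simp
  | mul σ τ hσ hτ =>
    intro I hI
    rw [Equiv.Perm.coe_mul, ← Function.comp_assoc, hτ (I ∘ σ) (hI.comp σ.injective), hσ I hI,
      Equiv.Perm.sign_mul]
    push_cast
    ring
  | swap k l hkl =>
    intro I hI
    have hne : k ≠ l := by
      rintro rfl
      omega
    have h := inversions_swap k l hkl I
    rw [Equiv.Perm.sign_swap hne]
    rcases lt_or_gt_of_ne (hI.ne hne) with h1 | h1
    · rw [if_neg h1.not_gt, if_pos h1, add_zero] at h
      rw [h, pow_succ]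
      simp
    · rw [if_pos h1, if_neg h1.not_gt, add_zero] at h
      rw [← h, pow_succ]
      simp

variable {K : Type*} [Field K] {A : Type*} [Ring A] [Algebra K A] {n m : ℕ}

/-- The antisymmetrizer `∑_σ sgn(σ) P^q_σ`, acting on series. -/
def alternator (A : Type*) [Ring A] [Algebra K A] (n m : ℕ) (q : K) :
    Matrix (Fin m → Fin n) (Fin m → Fin n) A⟦X⟧ :=
  (∑ σ : Equiv.Perm (Fin m), (Equiv.Perm.sign σ : ℤ) • qPerm n q σ).map (constSeries A)

theorem factorial_smul_qAntisymmetrizer [CharZero K] (q : K) :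
    (((m.factorial : K) • qAntisymmetrizer n m q).map (constSeries A)) =
      alternator A n m q := by
  rw [qAntisymmetrizer, smul_smul, mul_inv_cancel₀ (by exact_mod_cast m.factorial_ne_zero),
    one_smul, alternator]

/-- The operator `P^q_σ` acting on series. -/
def permAt (A : Type*) [Ring A] [Algebra K A] (n : ℕ) (q : K) (σ : Equiv.Perm (Fin m)) :
    Matrix (Fin m → Fin n) (Fin m → Fin n) A⟦X⟧ :=
  (qPerm n q σ).map (constSeries A)

theorem permAt_one (q : K) : permAt A n q (1 : Equiv.Perm (Fin m)) = 1 := by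
  rw [permAt, qPerm_one, Matrix.map_one _ (map_zero _) (map_one _)]

theorem permAt_mul {q : K} (hq : q ≠ 0) (σ τ : Equiv.Perm (Fin m)) :
    permAt A n q (σ * τ) = permAt A n q σ * permAt A n q τ := by
  rw [permAt, qPerm_mul hq, Matrix.map_mul]
  rfl

theorem permAt_swap (q : K) {k l : Fin m} (hkl : (l : ℕ) = k + 1) :
    permAt A n q (Equiv.swap k l) = flipAt A n q k l := by
  rw [permAt, qPerm_simple k l hkl, onTwo_map _ (map_zero _)]
  rfl

theorem alternator_mul_permAt {q : K} (hq : q ≠ 0) (σ : Equiv.Perm (Fin m)) :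
    alternator A n m q * permAt A n q σ = (Equiv.Perm.sign σ : ℤ) • alternator A n m q := by
  have h : (∑ τ : Equiv.Perm (Fin m), (Equiv.Perm.sign τ : ℤ) • qPerm n q τ) * qPerm n q σ =
      (Equiv.Perm.sign σ : ℤ) • ∑ τ : Equiv.Perm (Fin m), (Equiv.Perm.sign τ : ℤ) • qPerm n q τ :=
          by
    rw [Finset.sum_mul, Finset.smul_sum]
    refine Fintype.sum_equiv (Equiv.mulRight σ) _ _ fun τ => ?_
    rw [Equiv.coe_mulRight, smul_mul_assoc, ← qPerm_mul hq, smul_smul, Equiv.Perm.sign_mul,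
      mul_comm (Equiv.Perm.sign τ), ← Units.val_mul, ← mul_assoc, Int.units_mul_self, one_mul]
  rw [alternator, permAt, ← Matrix.map_mul, h]
  ext1 I J
  rcases Int.units_eq_one_or (Equiv.Perm.sign σ) with h | h <;> simp [h]

theorem eq_zero_of_add_self [CharZero K] {M : Matrix (Fin m → Fin n) (Fin m → Fin n) A⟦X⟧}
    (h : M + M = 0) : M = 0 := by
  have h2 : (2 : K) • M = 0 := by rw [two_smul, h]
  have := congrArg (fun N => (2 : K)⁻¹ • N) h2
  simpa [smul_smul] using this

/-- For an adjacent transposition with flip P and antisymmetrizer 𝒜, 𝒜P = −𝒜 gives 2𝒜B = 𝒜(1 − P)B =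
𝒜Z(1 − P). Multiplying by 1 + P yields 2𝒜B(1 + P) = 0, because P² = 1, and 2 is invertible. -/
theorem alternator_mul_mul_permAt [CharZero K] {q : K} (hq : q ≠ 0)
    {B : Matrix (Fin m → Fin n) (Fin m → Fin n) A⟦X⟧}
    (hB : ∀ k l : Fin m, (l : ℕ) = k + 1 → MovesPast (1 - flipAt A n q k l) B)
    (σ : Equiv.Perm (Fin m)) :
    alternator A n m q * B * permAt A n q σ =
      (Equiv.Perm.sign σ : ℤ) • (alternator A n m q * B) := by
  induction σ using perm_adjacent_induction with
  | one => simp [permAt_one]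
  | mul σ τ hσ hτ =>
    rw [permAt_mul hq, ← mul_assoc, hσ, smul_mul_assoc, hτ, smul_smul, Equiv.Perm.sign_mul,
      Units.val_mul]
  | swap k l hkl =>
    have hne : k ≠ l := by
      rintro rfl
      omega
    obtain ⟨Z, hZ⟩ := hB k l hkl
    have h1 := alternator_mul_permAt (A := A) (n := n) hq (Equiv.swap k l)
    have h2 : permAt A n q (Equiv.swap k l) * permAt A n q (Equiv.swap k l) = 1 := by
      rw [← permAt_mul hq, Equiv.swap_mul_self, permAt_one]
    rw [Equiv.Perm.sign_swap hne] at h1 ⊢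
    rw [← permAt_swap q hkl] at hZ
    simp only [Units.val_neg, Units.val_one, neg_smul, one_smul] at h1 ⊢
    have h3 : alternator A n m q * B + alternator A n m q * B =
        alternator A n m q * Z * (1 - permAt A n q (Equiv.swap k l)) := by
      rw [mul_assoc, ← hZ, ← mul_assoc, mul_sub, h1]
      simp [add_mul]
    have h4 : (alternator A n m q * B + alternator A n m q * B) *
        (1 + permAt A n q (Equiv.swap k l)) = 0 := by
      rw [h3, mul_assoc, sub_mul, mul_add, one_mul, mul_add, h2]
      simp [add_comm]
    rw [add_mul] at h4
    have h5 := eq_zero_of_add_self (K := K) h4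
    rw [mul_add, mul_one, add_comm] at h5
    exact eq_neg_of_add_eq_zero_left h5

theorem mul_permAt_apply {q : K} (V : Matrix (Fin m → Fin n) (Fin m → Fin n) A⟦X⟧)
    (σ : Equiv.Perm (Fin m)) (I J : Fin m → Fin n) :
    (V * permAt A n q σ) I J =
      q ^ ((inversions (J ∘ σ.symm) : ℤ) - inversions J) • V I (J ∘ σ.symm) := by
  rw [Matrix.mul_apply, Finset.sum_eq_single (J ∘ σ.symm)]
  · simp only [permAt, qPerm, Matrix.map_apply, Matrix.of_apply, if_true]
    have h : Commute (V I (J ∘ σ.symm)) (constSeries A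
        (q ^ ((inversions (J ∘ σ.symm) : ℤ) - inversions J))) := by
      rw [← toSeries_C]
      exact (toSeries_commute _ _).symm
    rw [h.eq, constSeries_mul]
  · intro L _ hL
    simp [permAt, qPerm, hL]
  · simp

/-- Rows that are skew-symmetric in the `q`-sense. -/
def IsSkewRow (q : K) (V : Matrix (Fin m → Fin n) (Fin m → Fin n) A⟦X⟧) : Prop :=
  ∀ σ : Equiv.Perm (Fin m), V * permAt A n q σ = (Equiv.Perm.sign σ : ℤ) • V

theorem IsSkewRow.apply_comp {q : K}
    {V : Matrix (Fin m → Fin n) (Fin m → Fin n) A⟦X⟧} (hV : IsSkewRow q V)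
    (I : Fin m → Fin n) {J : Fin m → Fin n} (hJ : Function.Injective J)
    (σ : Equiv.Perm (Fin m)) :
    V I (J ∘ σ) = (-q) ^ ((inversions J : ℤ) - inversions (J ∘ σ)) • V I J := by
  have h := congrFun (congrFun (hV σ) I) (J ∘ σ)
  rw [mul_permAt_apply] at h
  have e : (J ∘ σ) ∘ σ.symm = J := by
    ext p
    simp
  have hs := neg_one_pow_inversions σ J hJ
  have hs' : ((Equiv.Perm.sign σ : ℤ) : K) =
      (-1) ^ ((inversions J : ℤ) - inversions (J ∘ σ)) := by
    have h1 : ((-1 : K)) ^ inversions (J ∘ σ) =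
        ((Equiv.Perm.sign σ : ℤ) : K) * (-1) ^ inversions J := by
      have := congrArg (Int.cast : ℤ → K) hs
      push_cast at this
      exact this
    rw [zpow_sub₀ (by simp), zpow_natCast, zpow_natCast, h1]
    rcases Int.units_eq_one_or (Equiv.Perm.sign σ) with h | h <;> simp [h, div_eq_mul_inv]
  rw [e, Matrix.smul_apply, ← Int.cast_smul_eq_zsmul K, hs'] at h
  have h2 := congrArg (fun z => (-1 : K) ^ ((inversions J : ℤ) - inversions (J ∘ σ)) • z) h
  simp only [smul_smul] at h2
  rw [← mul_zpow, ← mul_zpow] at h2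
  simpa using h2.symm

/-- Exchanging two equal letters fixes the word, so no power of q appears and the entry equals its
own negative. -/
theorem IsSkewRow.apply_eq_zero [CharZero K] {q : K}
    {V : Matrix (Fin m → Fin n) (Fin m → Fin n) A⟦X⟧} (hV : IsSkewRow q V)
    (I : Fin m → Fin n) {J : Fin m → Fin n} (hJ : ¬ Function.Injective J) : V I J = 0 := by
  obtain ⟨x, y, hxy, hne⟩ : ∃ x y, J x = J y ∧ x ≠ y := by
    simpa [Function.Injective] using hJ
  have h := congrFun (congrFun (hV (Equiv.swap x y)) I) J
  have e : J ∘ (Equiv.swap x y).symm = J := by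
    funext p
    simp only [Equiv.symm_swap, Function.comp_apply, Equiv.swap_apply_def]
    split_ifs with h1 h2
    · rw [h1, hxy]
    · rw [h2, hxy]
    · rfl
  rw [mul_permAt_apply, e, sub_self, zpow_zero, one_smul, Matrix.smul_apply,
    Equiv.Perm.sign_swap hne] at h
  simp only [Units.val_neg, Units.val_one, neg_smul, one_smul] at h
  have h2 : (2 : K) • V I J = 0 := by
    rw [two_smul]
    nth_rewrite 1 [h]
    simp
  have := congrArg (fun N => (2 : K)⁻¹ • N) h2
  simpa [smul_smul] using this

theorem isSkewRow_alternator {q : K} (hq : q ≠ 0) : IsSkewRow q (alternator A n m q) :=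
  alternator_mul_permAt hq

theorem isSkewRow_minor [CharZero K] {q : K} (hq : q ≠ 0) (hq2 : q ^ 2 ≠ 1)
    {S : Matrix (Fin n) (Fin n) A⟦X⟧} (hS : SatisfiesReflection q S) :
    IsSkewRow q (alternator A n m q * bracket q S (List.finRange m)) :=
  alternator_mul_mul_permAt hq fun _ _ hkl => movesPast_bracket_finRange hq hq2 hS hkl

theorem alternator_apply_self (q : K) {I : Fin m → Fin n} (hI : Function.Injective I) :
    alternator A n m q I I = 1 := by
  rw [alternator, Matrix.map_apply, Matrix.sum_apply, Finset.sum_eq_single 1]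
  · simp [qPerm_one]
  · intro σ _ hσ
    rw [Matrix.smul_apply, qPerm, Matrix.of_apply, if_neg, smul_zero]
    intro h
    apply hσ
    ext p
    have := congrFun h (σ p)
    simp only [Function.comp_apply, Equiv.symm_apply_apply] at this
    simp [hI this]
  · simp

theorem alternator_apply_comp {q : K} (hq : q ≠ 0) {I : Fin m → Fin n}
    (hI : Function.Injective I) (σ : Equiv.Perm (Fin m)) :
    alternator A n m q I (I ∘ σ) =
      constSeries A ((-q) ^ ((inversions I : ℤ) - inversions (I ∘ σ))) := by
  rw [(isSkewRow_alternator hq).apply_comp I hI σ, alternator_apply_self q hI,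
    ← constSeries_mul, mul_one]

theorem alternator_apply_eq_zero (q : K) {I J : Fin m → Fin n}
    (h : ∀ σ : Equiv.Perm (Fin m), J ≠ I ∘ σ) : alternator A n m q I J = 0 := by
  rw [alternator, Matrix.map_apply, Matrix.sum_apply, Finset.sum_eq_zero, map_zero]
  intro σ _
  rw [Matrix.smul_apply, qPerm, Matrix.of_apply, if_neg, smul_zero]
  intro h'
  apply h σ
  rw [h']
  ext p
  simp

end Skew

/-! ### Invertibility of the generator matrix -/

section Invertible

/-- A matrix of series is a series with matrix coefficients, and such a series is a unit as soon as
its constant coefficient is. -/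
theorem isUnit_matrix_powerSeries {R ι : Type*} [Ring R] [Fintype ι] [DecidableEq ι]
    {M : Matrix ι ι R⟦X⟧} (h : IsUnit (M.map PowerSeries.constantCoeff)) : IsUnit M := by
  let f : (Matrix ι ι R)⟦X⟧ →* Matrix ι ι R⟦X⟧ :=
    { toFun := fun F => Matrix.of fun i j => PowerSeries.mk fun r => PowerSeries.coeff r F i j
      map_one' := by
        ext i j r
        simp only [Matrix.of_apply, PowerSeries.coeff_mk, PowerSeries.coeff_one,
          Matrix.one_apply]
        by_cases hr : r = 0 <;> by_cases hij : i = j <;>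
          simp [hr, hij, PowerSeries.coeff_one, Matrix.one_apply]
      map_mul' := fun F G => by
        ext i j r
        simp only [Matrix.of_apply, PowerSeries.coeff_mk, PowerSeries.coeff_mul,
          Matrix.mul_apply, map_sum, Matrix.sum_apply]
        rw [Finset.sum_comm] }
  have hM : f (PowerSeries.mk fun r => M.map (PowerSeries.coeff r)) = M := by
    ext i j r
    simp [f]
  obtain ⟨u, hu⟩ := h
  rw [← hM]
  have hc : PowerSeries.constantCoeff (PowerSeries.mk fun r => M.map (PowerSeries.coeff r)) =
      (u : Matrix ι ι R) := by
    rw [hu, ← PowerSeries.coeff_zero_eq_constantCoeff_apply, PowerSeries.coeff_mk]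
    ext i j
    exact PowerSeries.coeff_zero_eq_constantCoeff_apply _
  exact IsUnit.map f ⟨⟨_, PowerSeries.invOfUnit _ u, PowerSeries.mul_invOfUnit _ u hc,
    PowerSeries.invOfUnit_mul _ u hc⟩, rfl⟩

/-- Each factor `T` lowers the level `f` by at least one, so a power exceeding the highest level
vanishes. No commutativity is needed. -/
theorem isNilpotent_of_lower {R ι : Type*} [Ring R] [Fintype ι] [DecidableEq ι] (f : ι → ℕ)
    {T : Matrix ι ι R} (hT : ∀ i j, ¬ f j < f i → T i j = 0) : IsNilpotent T := by
  have h : ∀ k i j, ¬ f j + k ≤ f i → (T ^ k) i j = 0 := by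
    intro k
    induction k with
    | zero =>
      intro i j hij
      rw [pow_zero, Matrix.one_apply, if_neg]
      rintro rfl
      simp at hij
    | succ k ih =>
      intro i j hij
      rw [pow_succ, Matrix.mul_apply, Finset.sum_eq_zero]
      intro l _
      by_cases h1 : f l + k ≤ f i
      · rw [hT l j (by omega), mul_zero]
      · rw [ih i l h1, zero_mul]
  refine ⟨Finset.univ.sup f + 1, ?_⟩
  ext i j
  refine h _ _ _ ?_
  have := Finset.le_sup (f := f) (Finset.mem_univ i)
  omega

/-- `M = B (1 + B' (M - B))`, where `B` is the block diagonal part. `B'` preserves levels and `M -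
B` strictly lowers them, so the second factor is unipotent. -/
theorem isUnit_of_block_lower {R ι : Type*} [Ring R] [Fintype ι] [DecidableEq ι] (f : ι → ℕ)
    {M B B' : Matrix ι ι R} (h1 : B * B' = 1) (h2 : B' * B = 1)
    (hB' : ∀ i j, f i ≠ f j → B' i j = 0) (hM : ∀ i j, ¬ f j < f i → M i j = B i j) :
    IsUnit M := by
  have hu : IsUnit (1 + B' * (M - B)) := by
    refine IsNilpotent.isUnit_one_add (isNilpotent_of_lower f fun i j hij => ?_)
    rw [Matrix.mul_apply, Finset.sum_eq_zero]
    intro l _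
    by_cases hl : f i = f l
    · rw [Matrix.sub_apply, hM l j (by omega), sub_self, mul_zero]
    · rw [hB' i l hl, zero_mul]
  have hM' : M = B * (1 + B' * (M - B)) := by
    rw [mul_add, mul_one, ← mul_assoc, h1, one_mul]
    abel
  rw [hM']
  exact (show IsUnit B from ⟨⟨B, B', h1, h2⟩, rfl⟩).mul hu

variable {K : Type*} [Field K] {q : K} {n : ℕ} {g : SymmetryType}

variable (K q n g) in
/-- The constant terms of the generator matrix. -/
def sConst : Matrix (Fin n) (Fin n) (TwistedYangian K q n g) :=
  Matrix.of fun i j => toYangian K q n g (gS K i j 0)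

theorem sMatrix_map_constantCoeff :
    (sMatrix K q n g).map PowerSeries.constantCoeff = sConst K q n g := by
  ext i j
  rw [Matrix.map_apply, ← PowerSeries.coeff_zero_eq_constantCoeff_apply]
  exact coeff_sMatrix i j 0

/-- R(X, 0) = X R(1, 0), so the factor X must be cancelled before passing to constant terms;
otherwise the equation would read 0 = 0. -/
theorem map_constantCoeff_reflection {A : Type*} [Ring A] [Algebra K A]
    {S T : Matrix (Fin n) (Fin n) A⟦X⟧}
    (h : rMatrix n q (PowerSeries.X : A⟦X⟧) 0 * (S ⊗ₖ 1) *
        transposeFirst (rMatrix n q 0 1) * (1 ⊗ₖ T) =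
      (1 ⊗ₖ T) * transposeFirst (rMatrix n q 0 1) * (S ⊗ₖ 1) *
        rMatrix n q (PowerSeries.X : A⟦X⟧) 0) :
    rMatrix n q (1 : A) 0 * (S.map PowerSeries.constantCoeff ⊗ₖ 1) *
        transposeFirst (rMatrix n q 0 1) * (1 ⊗ₖ T.map PowerSeries.constantCoeff) =
      (1 ⊗ₖ T.map PowerSeries.constantCoeff) * transposeFirst (rMatrix n q 0 1) *
        (S.map PowerSeries.constantCoeff ⊗ₖ 1) * rMatrix n q (1 : A) 0 := by
  have hR : rMatrix n q (PowerSeries.X : A⟦X⟧) 0 =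
      (PowerSeries.X : A⟦X⟧) • rMatrix n q (1 : A⟦X⟧) 0 := by
    ext1 r s
    simp only [rMatrix, Matrix.of_apply, Matrix.smul_apply]
    split_ifs <;> simp
  have hcX : ∀ a, Commute (PowerSeries.X : A⟦X⟧) a := fun a => (PowerSeries.commute_X a).symm
  rw [hR] at h
  simp only [central_smul_mul, mul_central_smul hcX] at h
  have h' := X_smul_injective h
  let φ : A⟦X⟧ →ₐ[K] A := AlgHom.mk' PowerSeries.constantCoeff fun c x => by
    rw [← PowerSeries.coeff_zero_eq_constantCoeff_apply, coeff_smul_series,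
      PowerSeries.coeff_zero_eq_constantCoeff_apply]
  have k0 : ∀ T : Matrix (Fin n) (Fin n) A⟦X⟧, T.map PowerSeries.constantCoeff = T.map φ :=
    fun _ => rfl
  have k1 : ∀ T : Matrix (Fin n) (Fin n) A⟦X⟧, (T ⊗ₖ 1).map φ = T.map φ ⊗ₖ 1 :=
    map_kronecker_one (φ : A⟦X⟧ →+* A)
  have k2 : ∀ T : Matrix (Fin n) (Fin n) A⟦X⟧, (1 ⊗ₖ T).map φ = 1 ⊗ₖ T.map φ :=
    map_one_kronecker (φ : A⟦X⟧ →+* A)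
  have h'' := congrArg (fun M => M.map φ) h'
  simp only [Matrix.map_mul, transposeFirst_map, rMatrix_map, k1, k2, map_one, map_zero] at h''
  rw [k0, k0]
  exact h''

theorem map_scaleArg_constantCoeff {A : Type*} [Ring A] [Algebra K A]
    (S : Matrix (Fin n) (Fin n) A⟦X⟧) (c : K) :
    (S.map (scaleArg c)).map PowerSeries.constantCoeff = S.map PowerSeries.constantCoeff := by
  ext i j
  simp only [Matrix.map_apply, ← PowerSeries.coeff_zero_eq_constantCoeff_apply, coeff_scaleArg,
    pow_zero, one_smul]

theorem reflection_const :
    rMatrix n q (1 : TwistedYangian K q n g) 0 * (sConst K q n g ⊗ₖ 1) *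
        transposeFirst (rMatrix n q 0 1) * (1 ⊗ₖ sConst K q n g) =
      (1 ⊗ₖ sConst K q n g) * transposeFirst (rMatrix n q 0 1) * (sConst K q n g ⊗ₖ 1) *
        rMatrix n q (1 : TwistedYangian K q n g) 0 := by
  -- The point u⁻¹ = 0, v⁻¹ = X. As `0⁻¹ = 0` in `K`, the scaling `scaleArg 0⁻¹` keeps exactly the
  -- constant term.
  have h := reflection_specialized (q := q) (n := n) (g := g) ![0, 1]
  simp only [Matrix.cons_val_zero, Matrix.cons_val_one, zero_smul, one_smul, zero_mul] at h
  have := map_constantCoeff_reflection h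
  rwa [map_scaleArg_constantCoeff, map_scaleArg_constantCoeff, sMatrix_map_constantCoeff] at this

theorem kronecker_one_mul_apply {R : Type*} [Ring R] (T : Matrix (Fin n) (Fin n) R)
    (M : Matrix (Fin n × Fin n) (Fin n × Fin n) R) (a b : Fin n) (J : Fin n × Fin n) :
    ((T ⊗ₖ (1 : Matrix (Fin n) (Fin n) R)) * M) (a, b) J = ∑ a', T a a' * M (a', b) J := by
  simp [Matrix.mul_apply, Fintype.sum_prod_type, Matrix.one_apply]

theorem one_kronecker_mul_apply {R : Type*} [Ring R] (T : Matrix (Fin n) (Fin n) R)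
    (M : Matrix (Fin n × Fin n) (Fin n × Fin n) R) (a b : Fin n) (J : Fin n × Fin n) :
    (((1 : Matrix (Fin n) (Fin n) R) ⊗ₖ T) * M) (a, b) J = ∑ b', T b b' * M (a, b') J := by
  simp [Matrix.mul_apply, Fintype.sum_prod_type, Matrix.one_apply]

theorem mul_kronecker_one_apply {R : Type*} [Ring R] (T : Matrix (Fin n) (Fin n) R)
    (M : Matrix (Fin n × Fin n) (Fin n × Fin n) R) (a b : Fin n) (I : Fin n × Fin n) :
    (M * (T ⊗ₖ (1 : Matrix (Fin n) (Fin n) R))) I (a, b) = ∑ a', M I (a', b) * T a' a := by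
  simp [Matrix.mul_apply, Fintype.sum_prod_type, Matrix.one_apply]

theorem mul_one_kronecker_apply {R : Type*} [Ring R] (T : Matrix (Fin n) (Fin n) R)
    (M : Matrix (Fin n × Fin n) (Fin n × Fin n) R) (a b : Fin n) (I : Fin n × Fin n) :
    (M * ((1 : Matrix (Fin n) (Fin n) R) ⊗ₖ T)) I (a, b) = ∑ b', M I (a, b') * T b' b := by
  simp [Matrix.mul_apply, Fintype.sum_prod_type, Matrix.one_apply]

theorem transposeFirst_rMatrix_zero_apply {A : Type*} [Ring A] [Algebra K A] (a b c d : Fin n) :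
    transposeFirst (rMatrix n q (0 : A) 1) (a, b) (c, d) = algebraMap K A
      (if a = b then (if c = d then (if a = c then -q else if a < c then 0 else q⁻¹ - q) else 0)
        else if a = c ∧ b = d then -1 else 0) := by
  rw [transposeFirst_rMatrix_apply]
  split_ifs <;> simp

theorem rMatrix_one_zero_apply {A : Type*} [Ring A] [Algebra K A] (a b c d : Fin n) :
    rMatrix n q (1 : A) 0 (a, b) (c, d) = algebraMap K A
      (if a = c ∧ b = d then (if a = b then q⁻¹ else 1)
        else if a = d ∧ b = c ∧ c < a then q⁻¹ - q else 0) := by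
  simp only [rMatrix, Matrix.of_apply, Prod.mk.injEq, Prod.swap_prod_mk, smul_zero, sub_zero,
    ← ite_and]
  split_ifs <;> first | (simp [Algebra.algebraMap_eq_smul_one, sub_smul]; done) | (exfalso; tauto)

/-- This is the entry at row (i, i) and column (i, j): the left side is −s_ii s_ij and the right
side is (q² − 1) s_ii s_ij − s_ij s_ii. The symplectic blocks need it to have a two-sided inverse.
-/
theorem reflection_const_comm {A : Type*} [Ring A] [Algebra K A] {s : Matrix (Fin n) (Fin n) A}
    (h : rMatrix n q (1 : A) 0 * (s ⊗ₖ 1) * transposeFirst (rMatrix n q 0 1) * (1 ⊗ₖ s) =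
      (1 ⊗ₖ s) * transposeFirst (rMatrix n q 0 1) * (s ⊗ₖ 1) * rMatrix n q (1 : A) 0)
    (hq : q ≠ 0) {i j : Fin n} (hij : i < j) :
    s i j * s i i = q ^ 2 • (s i i * s i j) := by
  have h' := congrFun (congrFun h (i, i)) (i, j)
  have hL : (rMatrix n q (1 : A) 0 * (s ⊗ₖ 1) * transposeFirst (rMatrix n q 0 1) * (1 ⊗ₖ s) :
      Matrix (Fin n × Fin n) (Fin n × Fin n) A)
      (i, i) (i, j) = q⁻¹ • (s i i * (-q) • s i j) := by
    rw [Matrix.mul_assoc, Matrix.mul_assoc, Matrix.mul_apply, Finset.sum_eq_single (i, i),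
      kronecker_one_mul_apply, Finset.sum_eq_single i, mul_one_kronecker_apply,
      Finset.sum_eq_single i]
    · simp only [transposeFirst_rMatrix_zero_apply, rMatrix_one_zero_apply]
      simp [Algebra.smul_def]
    · intro b _ hb
      simp [transposeFirst_rMatrix_zero_apply, hb.symm]
    · simp
    · intro a _ ha
      rw [mul_one_kronecker_apply, Finset.sum_eq_zero, mul_zero]
      intro b _
      simp [transposeFirst_rMatrix_zero_apply, ha]
    · simp
    · rintro ⟨a, b⟩ _ hab
      rw [rMatrix_one_zero_apply, if_neg, if_neg, map_zero, zero_mul]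
      · rintro ⟨h1, h2, -⟩
        exact hab (Prod.ext h2.symm h1.symm)
      · rintro ⟨h1, h2⟩
        exact hab (Prod.ext h1.symm h2.symm)
    · simp
  have hR1 : (transposeFirst (rMatrix n q (0 : A) 1) * (s ⊗ₖ 1) * rMatrix n q (1 : A) 0 : Matrix
      (Fin n × Fin n) (Fin n × Fin n) A)
      (i, i) (i, j) = (q⁻¹ - q) • (-q) • s i j := by
    rw [Matrix.mul_apply, Finset.sum_eq_single (j, i), mul_kronecker_one_apply,
      Finset.sum_eq_single i]
    · simp only [transposeFirst_rMatrix_zero_apply, rMatrix_one_zero_apply]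
      simp only [if_true, hij.ne', hij, and_self, if_false, false_and]
      rw [← Algebra.commutes, Algebra.smul_def, Algebra.smul_def]
    · intro a _ ha
      simp [transposeFirst_rMatrix_zero_apply, ha]
    · simp
    · rintro ⟨a, b⟩ _ hab
      rw [rMatrix_one_zero_apply]
      split_ifs with h1 h2 h2
      · obtain ⟨rfl, rfl⟩ := h1
        exact absurd h2 hij.ne
      · obtain ⟨rfl, rfl⟩ := h1
        rw [mul_kronecker_one_apply, Finset.sum_eq_zero, zero_mul]
        intro c _
        rw [transposeFirst_rMatrix_zero_apply, if_pos rfl]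
        by_cases hc : c = b
        · simp [hc, hij, hij.ne]
        · simp [hc]
      · exact absurd (by rw [h2.1, h2.2.1]) hab
      · simp
    · simp
  have hR : ((1 ⊗ₖ s) * transposeFirst (rMatrix n q (0 : A) 1) * (s ⊗ₖ 1) *
      rMatrix n q (1 : A) 0 : Matrix (Fin n × Fin n) (Fin n × Fin n) A)
      (i, i) (i, j) =
      s i i * ((q⁻¹ - q) • (-q) • s i j) + s i j * (-s i i) := by
    rw [Matrix.mul_assoc, Matrix.mul_assoc, ← Matrix.mul_assoc (transposeFirst _),
      one_kronecker_mul_apply, ← Finset.add_sum_erase _ _ (Finset.mem_univ i), hR1,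
      Finset.sum_eq_single j]
    · congr 2
      rw [Matrix.mul_apply, Finset.sum_eq_single (i, j), mul_kronecker_one_apply,
        Finset.sum_eq_single i]
      · simp only [transposeFirst_rMatrix_zero_apply, rMatrix_one_zero_apply]
        simp [hij.ne]
      · intro a _ ha
        simp [transposeFirst_rMatrix_zero_apply, ha.symm, hij.ne]
      · simp
      · rintro ⟨a, b⟩ _ hab
        rw [rMatrix_one_zero_apply]
        split_ifs with h1 h2 h2
        · exact absurd (by rw [h1.1, h1.2]) hab
        · exact absurd (by rw [h1.1, h1.2]) hab
        · rw [mul_kronecker_one_apply, Finset.sum_eq_zero, zero_mul]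
          intro c _
          rw [transposeFirst_rMatrix_zero_apply, if_neg hij.ne, if_neg, map_zero, zero_mul]
          rintro ⟨-, h3⟩
          exact hij.ne' (h3.trans h2.2.1)
        · simp
      · simp
    · intro b hb hbj
      rw [Matrix.mul_apply, Finset.sum_eq_zero, mul_zero]
      rintro ⟨c, d⟩ _
      rw [rMatrix_one_zero_apply]
      have hbi : i ≠ b := (Finset.ne_of_mem_erase hb).symm
      split_ifs with h1 h2 h2
      · obtain ⟨rfl, rfl⟩ := h1
        exact absurd h2 hij.ne
      · obtain ⟨rfl, rfl⟩ := h1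
        rw [mul_kronecker_one_apply, Finset.sum_eq_zero, zero_mul]
        intro e _
        simp [transposeFirst_rMatrix_zero_apply, hbi, hbj]
      · rw [mul_kronecker_one_apply, Finset.sum_eq_zero, zero_mul]
        intro e _
        rw [transposeFirst_rMatrix_zero_apply, if_neg hbi, if_neg, map_zero, zero_mul]
        rintro ⟨-, h3⟩
        exact hbi (h3.trans h2.2.1).symm
      · simp
    · intro hj
      exact absurd (Finset.mem_erase.mpr ⟨hij.ne', Finset.mem_univ j⟩) hj
  rw [hL, hR] at h'
  simp only [mul_smul_comm, smul_smul, mul_neg] at h'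
  rw [inv_mul_cancel₀ hq, sub_mul, inv_mul_cancel₀ hq, neg_smul, one_smul, neg_smul, sub_smul,
    one_smul, ← sq] at h'
  have := congrArg (fun x => x + s i j * s i i + s i i * s i j) h'
  simpa [add_comm, add_left_comm] using this

theorem isUnit_symplectic_block {A : Type*} [Ring A] [Algebra K A] (hq : q ≠ 0) {a b c d β : A}
    (h1 : b * β = 1) (h2 : β * b = 1) (hdet : d * a - q ^ 2 • (c * b) = algebraMap K A (q ^ 3))
    (hcomm : b * a = q ^ 2 • (a * b)) :
    ∃ B : Matrix (Fin 2) (Fin 2) A, !![a, b; c, d] * B = 1 ∧ B * !![a, b; c, d] = 1 := by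
  -- The second column comes from the determinant relation and `hcomm`. The first column is then
  -- forced by requiring the second column of `B * !![a, b; c, d]` to be (0, 1), and is solved for
  -- with β = b⁻¹.
  refine ⟨!![q⁻¹ • (b * d * β), -(q⁻¹ • b); β - (q ^ 3)⁻¹ • (a * d * β), (q ^ 3)⁻¹ • a], ?_⟩
  have hda : d * a = q ^ 3 • (1 : A) + q ^ 2 • (c * b) := by
    rw [← Algebra.algebraMap_eq_smul_one, ← hdet, sub_add_cancel]
  have hβa : β * a = (q ^ 2)⁻¹ • (a * β) := by
    have : a * β = q ^ 2 • (β * a) := by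
      calc a * β = β * (b * a) * β := by rw [← mul_assoc β, h2, one_mul]
        _ = q ^ 2 • (β * a) := by
          rw [hcomm, mul_smul_comm, smul_mul_assoc, mul_assoc, mul_assoc, h1, mul_one]
    rw [this, smul_smul, inv_mul_cancel₀ (pow_ne_zero 2 hq), one_smul]
  have hdβa : d * β * a = q • β + c := by
    rw [mul_assoc, hβa, mul_smul_comm, ← mul_assoc, hda, add_mul, smul_mul_assoc, smul_mul_assoc,
      one_mul, mul_assoc, h1, mul_one, smul_add, smul_smul, smul_smul,
      inv_mul_cancel₀ (pow_ne_zero 2 hq), one_smul]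
    congr 2
    field_simp
  have e1 : (q ^ 3)⁻¹ * q ^ 2 = q⁻¹ := by field_simp
  have e2 : (q ^ 3)⁻¹ * q ^ 3 = 1 := inv_mul_cancel₀ (pow_ne_zero 3 hq)
  have e3 : (q ^ 3)⁻¹ * q = (q ^ 2)⁻¹ := by field_simp
  rw [Matrix.mul_fin_two, Matrix.mul_fin_two, Matrix.one_fin_two]
  constructor
  · congr! 3
    · rw [mul_sub, h1, mul_smul_comm, mul_smul_comm, ← mul_assoc b, ← mul_assoc b, hcomm,
        smul_mul_assoc, smul_mul_assoc, smul_smul, e1]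
      simp only [mul_assoc]
      abel
    · rw [mul_neg, mul_smul_comm, mul_smul_comm, hcomm, smul_smul, e1, neg_add_cancel]
    · congr 1
      · rw [mul_sub, mul_smul_comm, mul_smul_comm, ← mul_assoc d, ← mul_assoc d, hda, add_mul,
          add_mul, smul_add]
        simp only [smul_mul_assoc, one_mul, smul_smul, e1, e2, one_smul, mul_assoc]
        abel
      · congr 1
        rw [mul_neg, mul_smul_comm, mul_smul_comm, hda, smul_add, smul_smul, smul_smul, e1, e2,
          one_smul]
        abel
  · have f1 : b * d * β * a = q • 1 + b * c := by
      rw [mul_assoc b, mul_assoc b, hdβa, mul_add, mul_smul_comm, h1]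
    have f2 : a * d * β * a = q • (a * β) + a * c := by
      rw [mul_assoc a, mul_assoc a, hdβa, mul_add, mul_smul_comm]
    have f3 : ∀ x : A, x * β * b = x := fun x => by rw [mul_assoc, h2, mul_one]
    congr! 3
    · rw [smul_mul_assoc, neg_mul, smul_mul_assoc, f1, smul_add, smul_smul, inv_mul_cancel₀ hq,
        one_smul]
      abel
    · rw [smul_mul_assoc, neg_mul, smul_mul_assoc, f3, add_neg_cancel]
    · congr 1
      · rw [sub_mul, smul_mul_assoc, smul_mul_assoc, f2, hβa, smul_add, smul_smul, e3]
        abel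
      · congr 1
        rw [sub_mul, smul_mul_assoc, smul_mul_assoc, f3, h2]
        abel

theorem isUnit_sConst_orthogonal : IsUnit (sConst K q n .orthogonal) := by
  refine isUnit_of_block_lower (B := 1) (B' := 1) Fin.val (mul_one 1) (mul_one 1) ?_ ?_
  · intro i j hij
    exact Matrix.one_apply_ne fun h => hij (by rw [h])
  · intro i j hij
    rcases (not_lt.mp hij).eq_or_lt with h | h
    · obtain rfl := Fin.ext h
      rw [Matrix.one_apply_eq]
      exact (toYangian_rel (Rel.orth_diag i)).trans (map_one _)
    · rw [Matrix.one_apply_ne (Fin.ne_of_val_ne h.ne)]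
      exact (toYangian_rel (Rel.orth_upper i j h)).trans (map_zero _)

theorem isUnit_sConst_symplectic (hq : q ≠ 0) (k : ℕ) :
    IsUnit (sConst K q (k * 2) .symplectic) := by
  -- The pair number `y` is the level of a triangular structure, and `x` is the position inside the
  -- pair.
  let e : Fin 2 × Fin k ≃ Fin (k * 2) := (Equiv.prodComm _ _).trans finProdFinEquiv
  have he : ∀ x y, ((e (x, y) : Fin (k * 2)) : ℕ) = x + 2 * y := fun x y => rfl
  set s := sConst K q (k * 2) .symplectic with hs
  have hp : ∀ y : Fin k, IsPair (e (0, y)) (e (1, y)) := by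
    intro y
    constructor
    · rw [he]
      simp
    · rw [he, he, Fin.val_zero, Fin.val_one]
      omega
  let β : Fin k → TwistedYangian K q (k * 2) .symplectic := fun y =>
    toYangian K q (k * 2) .symplectic (gInv K _ _ (hp y))
  choose B' hB' using fun y : Fin k => isUnit_symplectic_block hq (β := β y) (a := s (e (0, y)) (e
      (0, y)))
    (b := s (e (0, y)) (e (1, y))) (c := s (e (1, y)) (e (0, y))) (d := s (e (1, y)) (e (1, y)))
    (by
      have := toYangian_rel (Rel.symp_mul_inv (K := K) (q := q) _ _ (hp y))
      rwa [map_mul, map_one] at this)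
    (by
      have := toYangian_rel (Rel.symp_inv_mul (K := K) (q := q) _ _ (hp y))
      rwa [map_mul, map_one] at this)
    (by
      have := toYangian_rel (Rel.symp_block (K := K) (q := q) _ _ (hp y))
      rwa [map_sub, map_smul, map_mul, map_mul, AlgHom.commutes] at this)
    (reflection_const_comm reflection_const hq (by
      rw [Fin.lt_def, he, he, Fin.val_zero, Fin.val_one]
      omega))
  suffices h : IsUnit (s.submatrix e e) by
    have := h.map (Matrix.reindexRingEquiv (TwistedYangian K q (k * 2) .symplectic) e)
    simpa using this
  refine isUnit_of_block_lower (fun x => (x.2 : ℕ))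
    (B := Matrix.blockDiagonal fun y => !![s (e (0, y)) (e (0, y)), s (e (0, y)) (e (1, y));
      s (e (1, y)) (e (0, y)), s (e (1, y)) (e (1, y))])
    (B' := Matrix.blockDiagonal B') ?_ ?_ ?_ ?_
  · rw [← Matrix.blockDiagonal_mul, funext fun y => (hB' y).1]
    exact Matrix.blockDiagonal_one
  · rw [← Matrix.blockDiagonal_mul, funext fun y => (hB' y).2]
    exact Matrix.blockDiagonal_one
  · rintro ⟨x, y⟩ ⟨x', y'⟩ h
    rw [Matrix.blockDiagonal_apply_ne]
    rintro rfl
    exact h rfl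
  · rintro ⟨x, y⟩ ⟨x', y'⟩ h
    rcases (not_lt.mp h).eq_or_lt with h' | h'
    · obtain rfl : y = y' := Fin.ext h'
      rw [Matrix.blockDiagonal_apply_eq]
      fin_cases x <;> fin_cases x' <;> rfl
    · rw [Matrix.blockDiagonal_apply_ne _ _ _ (Fin.ne_of_val_ne h'.ne)]
      have h'' : (y : ℕ) < y' := h'
      refine (toYangian_rel (Rel.symp_upper (e (x, y)) (e (x', y')) ?_ ?_)).trans (map_zero _)
      · rw [Fin.lt_def, he, he]
        omega
      · rintro ⟨h3, h4⟩
        rw [he] at h3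
        rw [he, he] at h4
        obtain ⟨r, hr⟩ := h3
        omega

/-- The generator matrix is invertible. -/
theorem isUnit_sMatrix (hq : q ≠ 0) (hg : g = .symplectic → Even n) :
    IsUnit (sMatrix K q n g) := by
  apply isUnit_matrix_powerSeries
  rw [sMatrix_map_constantCoeff]
  cases g with
  | orthogonal => exact isUnit_sConst_orthogonal
  | symplectic =>
    obtain ⟨k, rfl⟩ := (hg rfl).exists_two_nsmul
    rw [smul_eq_mul, mul_comm]
    exact isUnit_sConst_symplectic hq k

end Invertible

/-! ### Inverting the factors of the bracket -/

section Dual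

variable {K : Type*} [Field K] {A : Type*} [Ring A] [Algebra K A] {n m r : ℕ}

/-- Conjugation of a two-tensor by `diag((-q)^{-i}) ⊗ diag((-q)^{-i})`. -/
def conjTwo {B : Type*} [SMul K B] (q : K) (T : Matrix (Fin n × Fin n) (Fin n × Fin n) B) :
    Matrix (Fin n × Fin n) (Fin n × Fin n) B :=
  Matrix.of fun r c => ((-q) ^ ((c.1 : ℤ) + (c.2 : ℤ) - (r.1 : ℤ) - (r.2 : ℤ)) : K) • T r c

theorem transposeFirst_rBar_mul {q : K} (hq : q ≠ 0) {x : K⟦X⟧}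
    (hx : PowerSeries.constantCoeff x = 0) :
    transposeFirst (rBar n q x) *
      conjTwo q (transposeFirst (rBar n q⁻¹ ((q ^ 2)⁻¹ ^ n • x))) = 1 := by
  set y : K⟦X⟧ := (q ^ 2)⁻¹ ^ n • x with hy
  have hy0 : PowerSeries.constantCoeff y = 0 := by
    rw [hy, ← PowerSeries.coeff_zero_eq_constantCoeff_apply, PowerSeries.coeff_smul,
      PowerSeries.coeff_zero_eq_constantCoeff_apply, hx, smul_zero]
  have hc : conjTwo q (transposeFirst (rBar n q⁻¹ y)) =
      (y - 1)⁻¹ • conjTwo q (transposeFirst (rMatrix n q⁻¹ y (1 : K⟦X⟧))) := by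
    ext1 a b
    exact smul_comm (_ : K) (_ : K⟦X⟧) (_ : K⟦X⟧)
  rw [hc, transposeFirst_rBar, smul_mul_assoc, mul_smul_comm, smul_smul]
  refine (congrArg (_ • ·) (transposeFirst_rMatrix_mul hq x)).trans ?_
  rw [← hy, smul_smul, mul_mul_mul_comm,
    PowerSeries.inv_mul_cancel _ (sub_one_ne_zero_of_constantCoeff hx),
    PowerSeries.inv_mul_cancel _ (sub_one_ne_zero_of_constantCoeff hy0), one_mul, one_smul]

theorem scaleArg_rBar_apply (q c : K) {x : K⟦X⟧} (hx : PowerSeries.constantCoeff x = 0)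
    (a b : Fin n × Fin n) : scaleArg c (rBar n q x a b) = rBar n q (scaleArg c x) a b := by
  have hy : PowerSeries.constantCoeff (scaleArg c x) = 0 := by
    rw [← PowerSeries.coeff_zero_eq_constantCoeff_apply, coeff_scaleArg,
      PowerSeries.coeff_zero_eq_constantCoeff_apply, hx, smul_zero]
  have h1 : scaleArg c (1 : K⟦X⟧) = 1 := map_one (scaleHom K c)
  have hi : scaleArg c (x - 1)⁻¹ = (scaleArg c x - 1)⁻¹ := by
    rw [PowerSeries.eq_inv_iff_mul_eq_one (sub_one_ne_zero_of_constantCoeff hy)]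
    have := map_mul (scaleHom K c) (x - 1)⁻¹ (x - 1)
    rw [PowerSeries.inv_mul_cancel _ (sub_one_ne_zero_of_constantCoeff hx), map_one, map_sub,
      map_one] at this
    exact this.symm
  have hR : scaleArg c (rMatrix n q x 1 a b) = rMatrix n q (scaleArg c x) 1 a b := by
    have hs : ∀ f g : K⟦X⟧, scaleArg c (f - g) = scaleArg c f - scaleArg c g :=
      map_sub (scaleHom K c)
    simp only [rMatrix, Matrix.of_apply]
    split_ifs <;> first
      | exact map_zero (scaleHom K c)
      | simp only [hs, scaleArg_smul, h1]
  rw [rBar, rBar, Matrix.smul_apply, Matrix.smul_apply, smul_eq_mul, smul_eq_mul, ← hi, ← hR]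
  exact map_mul (scaleHom K c) _ _

/-- Conjugation of an operator on words by `diag((-q)^{-i})` in all tensor factors. -/
def wordConj (q : K) (T : Matrix (Fin r → Fin n) (Fin r → Fin n) A⟦X⟧) :
    Matrix (Fin r → Fin n) (Fin r → Fin n) A⟦X⟧ :=
  Matrix.of fun I J => ((-q) ^ (∑ p, ((J p : ℤ) - (I p : ℤ))) : K) • T I J

theorem wordConj_mul {q : K} (hq : q ≠ 0)
    (T U : Matrix (Fin r → Fin n) (Fin r → Fin n) A⟦X⟧) :
    wordConj q (T * U) = wordConj q T * wordConj q U := by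
  ext1 I J
  simp only [wordConj, Matrix.of_apply, Matrix.mul_apply, Finset.smul_sum, smul_mul_smul_comm]
  refine Finset.sum_congr rfl fun L _ => ?_
  rw [← zpow_add₀ (neg_ne_zero.mpr hq), ← Finset.sum_add_distrib]
  congr 2
  exact Finset.sum_congr rfl fun p _ => by ring

theorem wordConj_one (q : K) :
    wordConj q (1 : Matrix (Fin r → Fin n) (Fin r → Fin n) A⟦X⟧) = 1 := by
  ext1 I J
  by_cases h : I = J
  · subst h
    simp [wordConj]
  · simp [wordConj, Matrix.one_apply_ne h]

theorem wordConj_onOne (q : K) (k : Fin r) (T : Matrix (Fin n) (Fin n) A⟦X⟧) :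
    wordConj q (onOne k T) =
      onOne k (Matrix.of fun i j => ((-q) ^ ((j : ℤ) - (i : ℤ)) : K) • T i j) := by
  ext1 I J
  simp only [wordConj, onOne, Matrix.of_apply]
  split_ifs with h
  · rw [Finset.sum_eq_single k]
    · intro p _ hp
      rw [h p hp, sub_self]
    · simp
  · rw [smul_zero]

theorem wordConj_onTwo (q : K) {k l : Fin r} (hkl : k ≠ l)
    (T : Matrix (Fin n × Fin n) (Fin n × Fin n) A⟦X⟧) :
    wordConj q (onTwo k l T) = onTwo k l (conjTwo q T) := by
  ext1 I J
  simp only [wordConj, onTwo, conjTwo, Matrix.of_apply]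
  split_ifs with h
  · rw [← Finset.sum_subset (Finset.subset_univ {k, l}), Finset.sum_pair hkl]
    · congr 2
      ring
    · intro p _ hp
      simp only [Finset.mem_insert, Finset.mem_singleton, not_or] at hp
      rw [h p hp.1 hp.2, sub_self]
  · rw [smul_zero]

/-- The homomorphism that scales the argument, conjugates by `diag((-q)^{-i})` in all tensor
factors, and embeds the tensor factors along `e`. -/
def dualHom {q : K} (hq : q ≠ 0) (c : K) (e : Fin r → Fin m) (he : Function.Injective e) :
    Matrix (Fin r → Fin n) (Fin r → Fin n) A⟦X⟧ →*
      Matrix (Fin m → Fin n) (Fin m → Fin n) A⟦X⟧ where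
  toFun T := onLegs e (wordConj q (T.map (scaleArg c)))
  map_one' := by
    have : (1 : Matrix (Fin r → Fin n) (Fin r → Fin n) A⟦X⟧).map (scaleHom A c) = 1 :=
      Matrix.map_one _ (map_zero _) (map_one _)
    exact ((congrArg (fun M => onLegs e (wordConj q M)) this).trans
      (congrArg _ (wordConj_one q))).trans (onLegs_one e)
  map_mul' T U := by
    have : (T * U).map (scaleHom A c) = T.map (scaleHom A c) * U.map (scaleHom A c) :=
      Matrix.map_mul
    exact ((congrArg (fun M => onLegs e (wordConj q M)) this).trans
      (congrArg _ (wordConj_mul hq _ _))).trans (onLegs_mul he _ _)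

theorem dualHom_apply {q : K} (hq : q ≠ 0) (c : K) {e : Fin r → Fin m}
    (he : Function.Injective e) (T : Matrix (Fin r → Fin n) (Fin r → Fin n) A⟦X⟧) :
    dualHom hq c e he T = onLegs e (wordConj q (T.map (scaleArg c))) := rfl

/-- Along reversed legs, `e k + k + 1 = n`, the parameter q^{−2k−2l} u⁻² evaluated at q^{2−n} u is
q^{−2n} times the parameter of the pair `(e k, e l)`. This is precisely the shift required by
crossing symmetry. -/
theorem rBarT_mul_dualHom {q : K} (hq : q ≠ 0) {e : Fin r → Fin m} (he : Function.Injective e)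
    {k l : Fin r} (hkl : k ≠ l) (hk : (e k : ℕ) + k + 1 = n) (hl : (e l : ℕ) + l + 1 = n) :
    rBarT A n q (e k) (e l) * dualHom hq (q ^ (2 - (n : ℤ))) e he (rBarT A n q⁻¹ k l) = 1 := by
  set c := q ^ (2 - (n : ℤ))
  set x : K⟦X⟧ := PowerSeries.C (q ^ (2 * (e k : ℕ) + 2 * (e l : ℕ))) * PowerSeries.X ^ 2 with hx
  set y : K⟦X⟧ := PowerSeries.C (q⁻¹ ^ (2 * (k : ℕ) + 2 * (l : ℕ))) * PowerSeries.X ^ 2 with hy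
  have hxy : scaleArg c y = (q ^ 2)⁻¹ ^ n • x := by
    ext s
    rw [coeff_scaleArg, PowerSeries.coeff_smul, hx, hy, PowerSeries.coeff_C_mul,
      PowerSeries.coeff_C_mul, PowerSeries.coeff_X_pow]
    split_ifs with hs
    · subst hs
      simp only [smul_eq_mul, mul_one, c]
      rw [← zpow_neg, ← zpow_natCast (q ^ _), ← zpow_mul, inv_pow, inv_pow, ← pow_mul,
        ← zpow_natCast q, ← zpow_natCast q, ← zpow_natCast q, ← zpow_neg, ← zpow_neg,
        ← zpow_add₀ hq, ← zpow_add₀ hq]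
      congr 1
      push_cast
      omega
    · simp
  have hy0 : PowerSeries.constantCoeff y = 0 := by simp [hy]
  have hx0 : PowerSeries.constantCoeff x = 0 := by simp [hx]
  have hd : dualHom hq c e he (rBarT A n q⁻¹ k l) =
      onTwo (e k) (e l) ((conjTwo q (transposeFirst (rBar n q⁻¹ ((q ^ 2)⁻¹ ^ n • x)))).map
        (toSeries A)) := by
    rw [dualHom_apply, rBarT_eq, onTwo_map (scaleArg c) (map_zero (scaleHom A c)), wordConj_onTwo q
        hkl,
      onLegs_onTwo he, ← hxy]
    congr 1
    ext1 a b
    simp only [conjTwo, transposeFirst, Matrix.map_apply, Matrix.of_apply, toSeries_smul]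
    rw [← hy, scaleArg_toSeries, scaleArg_rBar_apply _ _ hy0]
  rw [hd, rBarT_eq, ← hx, ← onTwo_mul (he.ne hkl), ← Matrix.map_mul,
    transposeFirst_rBar_mul hq hx0, Matrix.map_one _ (map_zero _) (map_one _), onTwo_one]

theorem xMatrix_apply (q : K) (S : Matrix (Fin n) (Fin n) A⟦X⟧) (hq : q ≠ 0) (i j : Fin n) :
    xMatrix q S i j = ((-q) ^ ((i : ℤ) - (j : ℤ)) : K) •
      Ring.inverse (S.map (scaleArg (q ^ (-(n : ℤ))))) i j := by
  have hinv : (cMatrix n q)⁻¹ = Matrix.diagonal fun i : Fin n => (-q) ^ (i : ℤ) := by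
    refine Matrix.inv_eq_right_inv ?_
    rw [cMatrix, Matrix.diagonal_mul_diagonal, ← Matrix.diagonal_one]
    congr 1
    ext i
    rw [← zpow_add₀ (neg_ne_zero.mpr hq), neg_add_cancel, zpow_zero]
  rw [xMatrix, hinv, cMatrix, Matrix.diagonal_map (map_zero _), Matrix.diagonal_map (map_zero _),
    Matrix.mul_diagonal, Matrix.diagonal_mul]
  change constSeries A ((-q) ^ (i : ℤ)) * _ * constSeries A ((-q) ^ (-(j : ℤ))) = _
  rw [constSeries_mul, sub_eq_add_neg, zpow_add₀ (neg_ne_zero.mpr hq), mul_comm, mul_smul,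
    ← constSeries_mul (A := A) ((-q) ^ (-(j : ℤ))), ← toSeries_C, (toSeries_commute _ _).eq]

/-- The argument matches because q^{2−n} q^{2k} q^{−n} = q^{−2 e(k)}, and the conjugation inside
`dualHom` undoes the conjugation by C in `xMatrix`. -/
theorem sAt_mul_dualHom {q : K} (hq : q ≠ 0) {S : Matrix (Fin n) (Fin n) A⟦X⟧} (hS : IsUnit S)
    {e : Fin r → Fin m} (he : Function.Injective e) {k : Fin r} (hk : (e k : ℕ) + k + 1 = n) :
    sAt q S (e k) * dualHom hq (q ^ (2 - (n : ℤ))) e he (sAt q⁻¹ (xMatrix q S) k) = 1 := by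
  have hu : ∀ c : K, IsUnit (S.map (scaleArg c)) := fun c => hS.map (scaleHom A c).mapMatrix
  have hinv : ∀ c d : K, (Ring.inverse (S.map (scaleArg c))).map (scaleArg d) =
      Ring.inverse (S.map (scaleArg (d * c))) := by
    intro c d
    have h2 : (S.map (scaleArg c)).map (scaleArg d) = S.map (scaleArg (d * c)) := by
      ext1 i j
      exact scaleArg_scaleArg d c _
    have h4 : S.map (scaleArg (d * c)) * (Ring.inverse (S.map (scaleArg c))).map (scaleArg d) =
        1 := by
      rw [← h2]
      have := congrArg (scaleHom A d).mapMatrix (Ring.mul_inverse_cancel _ (hu c))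
      rwa [map_mul, map_one] at this
    calc _ = Ring.inverse (S.map (scaleArg (d * c))) * (S.map (scaleArg (d * c)) *
          (Ring.inverse (S.map (scaleArg c))).map (scaleArg d)) := by
            rw [← mul_assoc, Ring.inverse_mul_cancel _ (hu _), one_mul]
      _ = _ := by rw [h4, mul_one]
  have hd : dualHom hq (q ^ (2 - (n : ℤ))) e he (sAt q⁻¹ (xMatrix q S) k) =
      onOne (e k) (Ring.inverse (S.map (scaleArg (q ^ (-2 * ((e k : ℕ) : ℤ)))))) := by
    rw [dualHom_apply, sAt, onOne_map (scaleArg _) (map_zero (scaleHom A _)), wordConj_onOne,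
      onLegs_onOne he]
    have hc : q ^ (-2 * ((e k : ℕ) : ℤ)) =
        q ^ (2 - (n : ℤ)) * (q⁻¹ ^ (-2 * (k : ℤ)) * q ^ (-(n : ℤ))) := by
      rw [inv_zpow', ← zpow_add₀ hq, ← zpow_add₀ hq]
      congr 1
      omega
    rw [hc, ← hinv, ← hinv]
    congr 1
    ext1 i j
    simp only [Matrix.map_apply, Matrix.of_apply]
    rw [xMatrix_apply q S hq, scaleArg_smul, scaleArg_smul, smul_smul,
      ← zpow_add₀ (neg_ne_zero.mpr hq), sub_add_sub_cancel, sub_self, zpow_zero, one_smul]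
  rw [hd, sAt, ← onOne_mul, Ring.mul_inverse_cancel _ (hu _), onOne_one]

end Dual

/-! ### Ordered products -/

section OrderedProduct

variable {R ι κ : Type*} [Monoid R]

/-- `s k₁ (r k₁ k₂ ⋯ r k₁ kₗ) s k₂ (r k₂ k₃ ⋯ r k₂ kₗ) ⋯ s kₗ`. -/
def orderedProd (s : ι → R) (r : ι → ι → R) : List ι → R
  | [] => 1
  | k :: L => s k * (L.map (r k)).prod * orderedProd s r L

theorem orderedProd_map (s : ι → R) (r : ι → ι → R) (f : κ → ι) (L : List κ) :
    orderedProd s r (L.map f) = orderedProd (fun k => s (f k)) (fun k l => r (f k) (f l)) L := by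
  induction L with
  | nil => rfl
  | cons k L ih =>
    rw [List.map_cons, orderedProd, orderedProd, ih, List.map_map]
    rfl

theorem map_orderedProd {R' : Type*} [Monoid R'] (φ : R →* R') (s : ι → R) (r : ι → ι → R)
    (L : List ι) :
    φ (orderedProd s r L) = orderedProd (fun k => φ (s k)) (fun k l => φ (r k l)) L := by
  induction L with
  | nil => exact map_one φ
  | cons k L ih =>
    rw [orderedProd, orderedProd, map_mul, map_mul, ih, map_list_prod, List.map_map]
    rfl

variable {s : ι → R} {r : ι → ι → R}

theorem commute_orderedProd (hs : ∀ i j k, i ≠ k → j ≠ k → Commute (r i j) (s k))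
    (hr : ∀ i j k l, i ≠ k → i ≠ l → j ≠ k → j ≠ l → Commute (r i j) (r k l)) {i j : ι}
    {L : List ι} (hi : i ∉ L) (hj : j ∉ L) : Commute (r i j) (orderedProd s r L) := by
  induction L with
  | nil => exact Commute.one_right _
  | cons k L ih =>
    simp only [List.mem_cons, not_or] at hi hj
    refine ((hs i j k hi.1 hj.1).mul_right (Commute.list_prod_right _ _ ?_)).mul_right
      (ih hi.2 hj.2)
    simp only [List.mem_map]
    rintro _ ⟨l, hl, rfl⟩
    exact hr i j k l hi.1 (fun h => hi.2 (h ▸ hl)) hj.1 (fun h => hj.2 (h ▸ hl))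

/-- A factor joining `k` to an element of `L'` commutes with all factors having both indices in the
rest of `L`, so the cross factors collect in the middle. -/
theorem orderedProd_append (hs : ∀ i j k, i ≠ k → j ≠ k → Commute (r i j) (s k))
    (hr : ∀ i j k l, i ≠ k → i ≠ l → j ≠ k → j ≠ l → Commute (r i j) (r k l)) {L L' : List ι}
    (h : (L ++ L').Nodup) :
    orderedProd s r (L ++ L') = orderedProd s r L *
      (L.map fun i => (L'.map (r i)).prod).prod * orderedProd s r L' := by
  induction L with
  | nil => simp [orderedProd]
  | cons k L ih =>
    rw [List.cons_append, List.nodup_cons] at h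
    have hc : Commute ((L'.map (r k)).prod) (orderedProd s r L) := by
      refine Commute.list_prod_left _ _ ?_
      simp only [List.mem_map]
      rintro _ ⟨l, hl, rfl⟩
      exact commute_orderedProd hs hr (fun hk => h.1 (List.mem_append_left _ hk))
        (List.disjoint_right.mp (List.disjoint_of_nodup_append h.2) hl)
    rw [List.cons_append, orderedProd, orderedProd, ih h.2, List.map_append, List.prod_append,
      List.map_cons, List.prod_cons]
    simp only [mul_assoc]
    rw [← mul_assoc _ (orderedProd s r L), hc.eq, mul_assoc]

theorem list_prod_reverse_mul {f g : ι → R} (L : List ι)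
    (h : ∀ k ∈ L, f k * g k = 1) :
    (L.reverse.map f).prod * (L.map g).prod = 1 := by
  induction L with
  | nil => simp
  | cons k L ih =>
    rw [List.reverse_cons, List.map_append, List.prod_append, List.map_cons, List.map_cons,
      List.prod_cons, List.map_nil, List.prod_cons, List.prod_nil, mul_one, mul_assoc, ← mul_assoc
          (f k),
      h k List.mem_cons_self, one_mul, ih fun l hl => h l (List.mem_cons_of_mem _ hl)]

/-- The first index `k` of `L` is the last one of the reversed list. There it contributes (∏ r i k)
s k, which meets s' k (∏ r' k l) and cancels; induction does the rest. -/
theorem orderedProd_reverse_mul (hs : ∀ i j k, i ≠ k → j ≠ k → Commute (r i j) (s k))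
    (hr : ∀ i j k l, i ≠ k → i ≠ l → j ≠ k → j ≠ l → Commute (r i j) (r k l)) {s' : ι → R}
    {r' : ι → ι → R} (h1 : ∀ k, s k * s' k = 1) (h2 : ∀ k l, k ≠ l → r l k * r' k l = 1)
    {L : List ι} (h : L.Nodup) : orderedProd s r L.reverse * orderedProd s' r' L = 1 := by
  induction L with
  | nil => simp [orderedProd]
  | cons k L ih =>
    have hL : ∀ l ∈ L, r l k * r' k l = 1 := fun l hl => h2 k l fun e =>
      (List.nodup_cons.mp h).1 (e ▸ hl)
    rw [List.reverse_cons, orderedProd_append hs hr]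
    · have e1 : ∀ i, (List.map (r i) [k]).prod = r i k := fun i => by simp
      have e2 : orderedProd s r [k] = s k := by simp [orderedProd]
      have e3 : orderedProd s' r' (k :: L) = s' k * (L.map (r' k)).prod * orderedProd s' r' L := rfl
      simp only [e1, e2, e3]
      calc _ = orderedProd s r L.reverse * ((L.reverse.map fun i => r i k).prod * (s k * s' k) *
            (L.map (r' k)).prod) * orderedProd s' r' L := by simp only [mul_assoc]
        _ = 1 := by
          rw [h1, mul_one, list_prod_reverse_mul L hL, mul_one, ih (List.nodup_cons.mp h).2]
    · rw [← List.reverse_cons]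
      exact List.nodup_reverse.mpr h

end OrderedProduct

/-! ### The tail of the bracket and its inverse -/

section Tail

variable {K : Type*} [Field K] {A : Type*} [Ring A] [Algebra K A] {d m : ℕ}

/-- In this abstract form splitting and inverting the bracket require only that factors with
disjoint indices commute. -/
theorem bracket_eq_orderedProd (q : K) (S : Matrix (Fin d) (Fin d) A⟦X⟧) (L : List (Fin m)) :
    bracket q S L = orderedProd (sAt q S) (rBarT A d q) L := by
  induction L with
  | nil => rfl
  | cons k L ih =>
    rw [bracket, orderedProd, ih]

theorem bracket_append (q : K) (S : Matrix (Fin d) (Fin d) A⟦X⟧) {L L' : List (Fin m)}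
    (h : (L ++ L').Nodup) :
    bracket q S (L ++ L') = bracket q S L *
      (L.map fun i => (L'.map (rBarT A d q i)).prod).prod * bracket q S L' := by
  simp only [bracket_eq_orderedProd]
  exact orderedProd_append (fun _ _ _ => rBarT_commute_sAt q S)
    (fun _ _ _ _ => rBarT_commute_rBarT q) h

theorem onLegs_bracket_castAdd (q : K) (S : Matrix (Fin d) (Fin d) A⟦X⟧) (n : ℕ)
    (L : List (Fin m)) :
    bracket q S (L.map (Fin.castAdd n)) = onLegs (Fin.castAdd n) (bracket q S L) := by
  have he := Fin.castAdd_injective m n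
  rw [bracket_eq_orderedProd, bracket_eq_orderedProd, orderedProd_map]
  refine Eq.trans ?_ (map_orderedProd (onLegsHom (B := A⟦X⟧) (n := d) (Fin.castAdd n) he)
    (sAt q S) (rBarT A d q) L).symm
  congr 1
  · ext1 k
    exact (onLegs_onOne he k _).symm
  · ext1 k
    ext1 l
    exact (onLegs_onTwo he k l _).symm

/-- The part of the auxiliary minor behind the antisymmetrizer. -/
def auxiliaryBracket (q : K) (S : Matrix (Fin d) (Fin d) A⟦X⟧) (n : ℕ) :
    Matrix (Fin (n + 1) → Fin d) (Fin (n + 1) → Fin d) A⟦X⟧ :=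
  bracket q S ((List.finRange n).map Fin.castSucc) *
    ((List.finRange n).map fun k => rBarT A d q k.castSucc (Fin.last n)).prod

/-- The two brackets cancel first, then the R-matrices at the site `e (Fin.last n)`. Inversion
reverses the product, and the reversed legs restore the order in which the auxiliary minor is
written. -/
theorem tail_mul_dualHom {q : K} (hq : q ≠ 0) {S : Matrix (Fin d) (Fin d) A⟦X⟧} (hS : IsUnit S)
    {n : ℕ} {e : Fin (n + 1) → Fin m} (he : Function.Injective e)
    (hd : ∀ k, (e k : ℕ) + k + 1 = d) :
    ((List.finRange n).reverse.map fun k => rBarT A d q (e (Fin.last n)) (e k.castSucc)).prod *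
        bracket q S ((List.finRange n).reverse.map fun k => e k.castSucc) *
        dualHom hq (q ^ (2 - (d : ℤ))) e he (auxiliaryBracket q⁻¹ (xMatrix q S) n) = 1 := by
  have hinj : Function.Injective fun k : Fin n => e k.castSucc :=
    he.comp (Fin.castSucc_injective n)
  rw [auxiliaryBracket, map_mul, bracket_eq_orderedProd, bracket_eq_orderedProd, orderedProd_map,
    orderedProd_map, map_orderedProd, map_list_prod, List.map_map, mul_assoc,
    ← mul_assoc (orderedProd _ _ _), orderedProd_reverse_mul, one_mul]
  · refine list_prod_reverse_mul _ fun k _ => ?_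
    rw [rBarT_symm]
    exact rBarT_mul_dualHom hq he (Fin.castSucc_lt_last k).ne (hd _) (hd _)
  · exact fun i j k hi hj => rBarT_commute_sAt q S (hinj.ne hi) (hinj.ne hj)
  · exact fun i j k l h1 h2 h3 h4 => rBarT_commute_rBarT q (hinj.ne h1) (hinj.ne h2) (hinj.ne h3)
      (hinj.ne h4)
  · exact fun k => sAt_mul_dualHom hq hS he (hd _)
  · intro k l hkl
    rw [rBarT_symm]
    exact rBarT_mul_dualHom hq he ((Fin.castSucc_injective n).ne hkl) (hd _) (hd _)
  · exact List.nodup_finRange n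

end Tail

/-! ### Counting inversions -/

section Inversions

variable {d m : ℕ}

theorem inversions_eq_sum (I : Fin m → Fin d) :
    inversions I = ∑ i, ∑ j, if i < j ∧ I j < I i then 1 else 0 := by
  rw [inversions, Finset.card_filter, Fintype.sum_prod_type]

theorem inversions_eq_zero {I : Fin m → Fin d} (hI : StrictMono I) : inversions I = 0 := by
  rw [inversions, Finset.card_eq_zero, Finset.filter_eq_empty_iff]
  rintro ⟨i, j⟩ _ ⟨h1, h2⟩
  exact lt_asymm (hI h1) h2

theorem inversions_comp_cast {k : ℕ} (h : k = m) (I : Fin m → Fin d) :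
    inversions (I ∘ Fin.cast h) = inversions I := by
  subst h
  rfl

theorem castAdd_lt_castAdd {k l : ℕ} {i j : Fin k} : Fin.castAdd l i < Fin.castAdd l j ↔ i < j :=
  Iff.rfl

theorem inversions_append {a b : ℕ} (I : Fin a → Fin d) (J : Fin b → Fin d) :
    inversions (Fin.append I J) =
      inversions I + inversions J + ∑ i, ∑ j, if J j < I i then 1 else 0 := by
  have h : ∀ i j, Fin.castAdd b i < Fin.natAdd a j := fun i j => by
    rw [Fin.lt_def, Fin.val_castAdd, Fin.val_natAdd]
    omega
  have h' : ∀ i j, ¬ Fin.natAdd a j < Fin.castAdd b i := fun i j => (h i j).not_gt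
  simp only [inversions_eq_sum, Fin.sum_univ_add, Fin.append_left, Fin.append_right, h, h',
    true_and, false_and, if_false, Finset.sum_const_zero, Finset.sum_add_distrib,
    castAdd_lt_castAdd, Fin.natAdd_lt_natAdd_iff]
  ring

/-- The number of pairs of sites. -/
def pairCount (m : ℕ) : ℕ := ∑ i : Fin m, ∑ j : Fin m, if i < j then 1 else 0

theorem pairCount_succ (m : ℕ) : pairCount (m + 1) = m + pairCount m := by
  simp only [pairCount, Fin.sum_univ_succ, Fin.succ_lt_succ_iff, Fin.succ_pos,
    Fin.not_lt_zero, if_true, if_false, zero_add]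
  simp

/-- Each pair of sites is an inversion of exactly one of the word and its reversal. -/
theorem inversions_comp_rev {I : Fin m → Fin d} (hI : Function.Injective I) :
    inversions (I ∘ Fin.rev) + inversions I = pairCount m := by
  have h : inversions (I ∘ Fin.rev) = ∑ i, ∑ j, if i < j ∧ I i < I j then 1 else 0 := by
    rw [inversions_eq_sum, Finset.sum_comm, ← Equiv.sum_comp Fin.revPerm]
    refine Finset.sum_congr rfl fun i _ => ?_
    rw [← Equiv.sum_comp Fin.revPerm]
    simp
  rw [h, inversions_eq_sum, pairCount, ← Finset.sum_add_distrib]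
  refine Finset.sum_congr rfl fun i _ => ?_
  rw [← Finset.sum_add_distrib]
  refine Finset.sum_congr rfl fun j _ => ?_
  by_cases hij : i < j
  · rcases lt_or_gt_of_ne (hI.ne hij.ne) with h1 | h1 <;> simp [hij, h1, h1.not_gt]
  · simp [hij]

theorem exists_perm_comp {α : Type*} {I J : Fin m → α} (hJ : Function.Injective J)
    (h : ∀ i, J i ∈ Set.range I) : ∃ σ : Equiv.Perm (Fin m), J = I ∘ σ := by
  choose f hf using h
  have hinj : Function.Injective f := fun x y hxy => hJ (by rw [← hf x, ← hf y, hxy])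
  exact ⟨Equiv.ofBijective f (Finite.injective_iff_bijective.mp hinj), funext fun i => (hf i).symm⟩

end Inversions

/-! ### Rows of the antisymmetrizer with some letters fixed -/

section AlternatorRow

variable {K : Type*} [Field K] {A : Type*} [Ring A] [Algebra K A] {d m : ℕ}

theorem alternator_cast_apply {q : K} (hq : q ≠ 0) (h : m = d) {W : Fin m → Fin d}
    (hW : Function.Injective W) :
    alternator A d m q (Fin.cast h) W = constSeries A ((-q) ^ (-(inversions W : ℤ))) := by
  obtain ⟨σ, rfl⟩ := exists_perm_comp (I := Fin.cast h) hW fun i => ⟨Fin.cast h.symm (W i), rfl⟩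
  rw [alternator_apply_comp hq (Fin.cast_injective h),
    inversions_eq_zero (I := Fin.cast h) fun _ _ hij => hij, Nat.cast_zero, zero_sub]

theorem alternator_apply_eq_zero_of_not_injective (q : K) {I : Fin m → Fin d}
    (hI : Function.Injective I) {W : Fin m → Fin d} (hW : ¬ Function.Injective W) :
    alternator A d m q I W = 0 :=
  alternator_apply_eq_zero q fun σ h => hW (h ▸ hI.comp σ.injective)

/-- The word `a, n + 1, …, n + M` in the letters `0, …, n + M`. -/
abbrev consLast (n M : ℕ) (a : Fin (n + 1)) : Fin (M + 1) → Fin (n + 1 + M) :=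
  Fin.cons (α := fun _ => Fin (n + 1 + M)) (Fin.castAdd M a) (Fin.natAdd (n + 1))

theorem castAdd_lt_natAdd {k l : ℕ} (i : Fin k) (j : Fin l) : Fin.castAdd l i < Fin.natAdd k j := by
  rw [Fin.lt_def, Fin.val_castAdd, Fin.val_natAdd]
  omega

theorem strictMono_consLast (n M : ℕ) (a : Fin (n + 1)) : StrictMono (consLast n M a) := by
  intro i j hij
  cases j using Fin.cases with
  | zero => exact absurd hij (Fin.not_lt_zero i)
  | succ j =>
    cases i using Fin.cases with
    | zero => exact castAdd_lt_natAdd a j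
    | succ i => exact (Fin.natAdd_lt_natAdd_iff (n + 1)).mpr (Fin.succ_lt_succ_iff.mp hij)

/-- The word of the letters `0, …, n` without `a`, in decreasing order. -/
def tailWord (n M : ℕ) (a : Fin (n + 1)) : Fin n → Fin (n + 1 + M) :=
  fun k => Fin.castAdd M (a.succAbove k.rev)

theorem tailWord_injective (n M : ℕ) (a : Fin (n + 1)) : Function.Injective (tailWord n M a) :=
  (Fin.castAdd_injective _ _).comp (Fin.succAbove_right_injective.comp Fin.rev_injective)

theorem inversions_tailWord (n M : ℕ) (a : Fin (n + 1)) :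
    inversions (tailWord n M a) = pairCount n := by
  have h := inversions_comp_rev (tailWord_injective n M a)
  rw [inversions_eq_zero, zero_add] at h
  · exact h
  · intro i j hij
    simp only [Function.comp_apply, tailWord, Fin.rev_rev]
    exact Fin.strictMono_succAbove a hij

/-- The letter `a` exceeds `a` of the tail letters, and each of the `M` large letters exceeds all
`n` of them. -/
theorem sum_tailWord_lt (n M : ℕ) (a : Fin (n + 1)) :
    (∑ i, ∑ j, if tailWord n M a j < consLast n M a i then 1 else 0) = (a : ℕ) + M * n := by
  rw [Fin.sum_univ_succ]
  congr 1
  · simp only [Fin.cons_zero, tailWord, castAdd_lt_castAdd]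
    rw [← Equiv.sum_comp Fin.revPerm]
    simp only [Fin.revPerm_apply, Fin.rev_rev]
    have h := Fin.sum_univ_succAbove (fun j : Fin (n + 1) => if j < a then 1 else 0) a
    rw [if_neg (lt_irrefl a), zero_add] at h
    rw [← h, ← Finset.card_filter, Finset.filter_gt_eq_Iio, Fin.card_Iio]
  · simp only [Fin.cons_succ, tailWord, castAdd_lt_natAdd, if_true]
    simp

/-- Only rearrangements of `consLast n M a` complete the tail to a permutation. The inversions
inside the tail and between head and tail do not depend on the arrangement, so just the inversions
of `L` vary. -/
theorem alternator_append_tailWord {q : K} (hq : q ≠ 0) {n M : ℕ} (h : M + 1 + n = n + 1 + M)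
    (a : Fin (n + 1)) (L : Fin (M + 1) → Fin (n + 1 + M)) :
    alternator A (n + 1 + M) (M + 1 + n) q (Fin.cast h) (Fin.append L (tailWord n M a)) =
      (-q) ^ (-((a : ℤ) + M * n + pairCount n)) •
        alternator A (n + 1 + M) (M + 1) q (consLast n M a) L := by
  by_cases hL : Function.Injective (Fin.append L (tailWord n M a))
  · have hne : ∀ i j, L i ≠ tailWord n M a j := by
      intro i j hij
      have := @hL (Fin.castAdd n i) (Fin.natAdd (M + 1) j) (by
        rw [Fin.append_left, Fin.append_right, hij])
      exact (castAdd_lt_natAdd i j).ne this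
    have hLi : Function.Injective L := by
      intro x y hxy
      refine Fin.castAdd_injective _ n (hL ?_)
      rw [Fin.append_left, Fin.append_left, hxy]
    obtain ⟨σ, rfl⟩ := exists_perm_comp (I := consLast n M a) hLi (by
      intro i
      have hne' := hne i
      generalize L i = x at hne'
      induction x using Fin.addCases with
      | left x =>
        refine ⟨0, ?_⟩
        rw [consLast, Fin.cons_zero]
        by_contra hxa
        obtain ⟨k, hk⟩ := Fin.exists_succAbove_eq (x := x) (y := a) (fun e => hxa (by rw [e]))
        exact hne' k.rev (by rw [tailWord, Fin.rev_rev, hk])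
      | right x => exact ⟨x.succ, rfl⟩)
    rw [alternator_cast_apply hq h hL,
      alternator_apply_comp hq (strictMono_consLast n M a).injective,
      inversions_eq_zero (strictMono_consLast n M a), ← constSeries_mul, ← map_mul,
      ← zpow_add₀ (neg_ne_zero.mpr hq), inversions_append, inversions_tailWord]
    have hs : (∑ i, ∑ j, if tailWord n M a j < (consLast n M a ∘ σ) i then 1 else 0) =
        (a : ℕ) + M * n := by
      rw [← sum_tailWord_lt]
      exact Equiv.sum_comp σ fun i => ∑ j, if tailWord n M a j < consLast n M a i then 1 else 0
    rw [hs]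
    congr 2
    push_cast
    ring
  · rw [alternator_apply_eq_zero_of_not_injective q (Fin.cast_injective h) hL,
      alternator_apply_eq_zero, smul_zero]
    rintro σ rfl
    apply hL
    rw [Fin.append_injective_iff]
    refine ⟨(strictMono_consLast n M a).injective.comp σ.injective, tailWord_injective n M a, ?_⟩
    intro i j
    rw [Function.comp_apply]
    generalize σ i = x
    cases x using Fin.cases with
    | zero =>
      intro e
      exact Fin.succAbove_ne a _ (Fin.castAdd_injective _ _ e).symm
    | succ x => exact (castAdd_lt_natAdd _ x).ne'

/-- Reversal replaces the number of inversions of `L` by its complement in `pairCount (n + 1)`. This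
changes the sign of the exponent and is the reason why q⁻¹ enters. -/
theorem alternator_append_rev {q : K} (hq : q ≠ 0) {n M : ℕ} (h : M + 1 + n = n + 1 + M)
    (h' : M + 1 + n = M + (n + 1)) (L : Fin (n + 1) → Fin (n + 1 + M)) :
    alternator A (n + 1 + M) (M + 1 + n) q (Fin.cast h)
        (Fin.append (Fin.natAdd (n + 1)) (L ∘ Fin.rev) ∘ Fin.cast h') =
      (-q) ^ (-((M : ℤ) * (n + 1) + pairCount (n + 1))) •
        alternator A (n + 1 + M) (n + 1) q⁻¹ (Fin.castAdd M) L := by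
  have hmono : StrictMono (Fin.castAdd M : Fin (n + 1) → Fin (n + 1 + M)) := fun _ _ hij => hij
  by_cases hL : Function.Injective (Fin.append (Fin.natAdd (n + 1)) (L ∘ Fin.rev))
  · obtain ⟨-, hLi, hne⟩ := Fin.append_injective_iff.mp hL
    have hLi' : Function.Injective L := by
      have := hLi.comp Fin.rev_injective
      rwa [Function.comp_assoc, Fin.rev_involutive.comp_self] at this
    obtain ⟨σ, rfl⟩ := exists_perm_comp (I := Fin.castAdd M) hLi' (by
      intro i
      have hne' : ∀ j, Fin.natAdd (n + 1) j ≠ L i := fun j => by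
        simpa using hne j i.rev
      generalize L i = x at hne'
      induction x using Fin.addCases with
      | left x => exact ⟨x, rfl⟩
      | right x => exact absurd rfl (hne' x))
    have hs : (∑ i : Fin M, ∑ j, if ((Fin.castAdd M ∘ σ) ∘ Fin.rev) j < Fin.natAdd (n + 1) i
        then 1 else 0) = M * (n + 1) := by
      simp [castAdd_lt_natAdd]
    have hr := inversions_comp_rev hLi'
    rw [alternator_cast_apply hq h (hL.comp (Fin.cast_injective h')),
      alternator_apply_comp (inv_ne_zero hq) hmono.injective, inversions_eq_zero hmono,
      ← constSeries_mul, ← map_mul, inversions_comp_cast, inversions_append, hs,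
      inversions_eq_zero (Fin.strictMono_natAdd (n + 1)), ← inv_neg, inv_zpow',
      ← zpow_add₀ (neg_ne_zero.mpr hq)]
    congr 2
    push_cast
    omega
  · rw [alternator_apply_eq_zero_of_not_injective q (Fin.cast_injective h),
      alternator_apply_eq_zero, smul_zero]
    · rintro σ rfl
      apply hL
      rw [Fin.append_injective_iff]
      refine ⟨Fin.natAdd_injective _ _,
        (hmono.injective.comp σ.injective).comp Fin.rev_injective, ?_⟩
      exact fun i j => (castAdd_lt_natAdd _ i).ne'
    · intro hi
      refine hL ?_
      have := hi.comp (Fin.cast_injective h'.symm)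
      exact this

end AlternatorRow

/-! ### Complementary minors -/

section Complement

variable {K : Type*} [Field K] {A : Type*} [Ring A] [Algebra K A] {d m : ℕ}

theorem sklyaninMinor_eq [CharZero K] (q : K) (S : Matrix (Fin d) (Fin d) A⟦X⟧)
    (I J : Fin m → Fin d) :
    sklyaninMinor q S I J = (alternator A d m q * bracket q S (List.finRange m)) I J := by
  rw [sklyaninMinor, factorial_smul_qAntisymmetrizer]

theorem sklyaninDet_eq (q : K) (S : Matrix (Fin d) (Fin d) A⟦X⟧) (h : m = d) :
    sklyaninDet q S = sklyaninMinor q S (Fin.cast h) (Fin.cast h) := by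
  subst h
  rfl

/-- At full order the injective column words are the permutations of one word. Two skew rows are
therefore proportional, and the diagonal entries give the factor. -/
theorem alternator_mul_bracket_apply [CharZero K] {q : K} (hq : q ≠ 0) (hq2 : q ^ 2 ≠ 1)
    {S : Matrix (Fin d) (Fin d) A⟦X⟧} (hS : SatisfiesReflection q S) (h : m = d)
    (J : Fin m → Fin d) :
    (alternator A d m q * bracket q S (List.finRange m)) (Fin.cast h) J =
      sklyaninDet q S * alternator A d m q (Fin.cast h) J := by
  by_cases hJ : Function.Injective J
  · obtain ⟨σ, rfl⟩ := exists_perm_comp (I := Fin.cast h) hJ fun i => ⟨Fin.cast h.symm (J i), rfl⟩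
    rw [(isSkewRow_minor hq hq2 hS).apply_comp _ (Fin.cast_injective h),
      alternator_apply_comp hq (Fin.cast_injective h), sklyaninDet_eq q S h, sklyaninMinor_eq,
      ← constSeries_mul, ← toSeries_C, (toSeries_commute _ _).eq]
  · rw [(isSkewRow_minor hq hq2 hS).apply_eq_zero _ hJ,
      alternator_apply_eq_zero_of_not_injective q (Fin.cast_injective h) hJ, mul_zero]

/-- On e_i ⊗ e_j with i ≠ j the transposed R-matrix is the scalar x − 1, which the normalisation of
R̄ divides out. -/
theorem mul_rBarT_apply (q : K) {k l : Fin m} (V : Matrix (Fin m → Fin d) (Fin m → Fin d) A⟦X⟧)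
    (I : Fin m → Fin d) {J : Fin m → Fin d} (hJ : J k ≠ J l) :
    (V * rBarT A d q k l) I J = V I J := by
  have hkl : k ≠ l := fun h => hJ (by rw [h])
  set x : K⟦X⟧ := PowerSeries.C (q ^ (2 * (k : ℕ) + 2 * (l : ℕ))) * PowerSeries.X ^ 2 with hx
  have hx0 : PowerSeries.constantCoeff x = 0 := by simp [hx]
  have hT : ∀ a b : Fin d, transposeFirst (rBar d q x) (a, b) (J k, J l) =
      if a = J k ∧ b = J l then 1 else 0 := by
    intro a b
    rw [transposeFirst_rBar, Matrix.smul_apply, transposeFirst_rMatrix_apply, if_neg hJ]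
    by_cases hab : a = b
    · rw [if_pos hab, smul_zero, if_neg]
      rintro ⟨rfl, rfl⟩
      exact hJ hab
    · rw [if_neg hab]
      split_ifs
      · exact PowerSeries.inv_mul_cancel _ (sub_one_ne_zero_of_constantCoeff hx0)
      · rw [smul_zero]
  rw [rBarT_eq, ← hx, mul_onTwo_apply hkl, Finset.sum_eq_single (J k), Finset.sum_eq_single (J l)]
  · rw [Matrix.map_apply, hT, if_pos ⟨rfl, rfl⟩, map_one, mul_one, Function.update_eq_self,
      Function.update_eq_self]
  · intro b _ hb
    rw [Matrix.map_apply, hT, if_neg fun h => hb h.2, map_zero, mul_zero]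
  · simp
  · intro a _ ha
    refine Finset.sum_eq_zero fun b _ => ?_
    rw [Matrix.map_apply, hT, if_neg fun h => ha h.1, map_zero, mul_zero]
  · simp

theorem mul_list_prod_apply {R ι : Type*} [Ring R] [Fintype ι] [DecidableEq ι] {J : ι}
    (L : List (Matrix ι ι R)) (h : ∀ P ∈ L, ∀ (V : Matrix ι ι R) (I : ι), (V * P) I J = V I J)
    (V : Matrix ι ι R) (I : ι) : (V * L.prod) I J = V I J := by
  induction L generalizing V with
  | nil => simp
  | cons P L ih =>
    rw [List.prod_cons, ← Matrix.mul_assoc, ih fun Q hQ => h Q (List.mem_cons_of_mem _ hQ),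
      h P List.mem_cons_self]

theorem finRange_add (k l : ℕ) :
    List.finRange (k + l) =
      (List.finRange k).map (Fin.castAdd l) ++ (List.finRange l).map (Fin.natAdd k) := by
  apply List.ext_getElem
  · simp
  · intro i h1 h2
    rw [List.getElem_append]
    split_ifs with h
    · ext
      simp
    · ext
      simp at h ⊢
      omega

variable {n M : ℕ}

/-- The tensor factors of the tail, in reverse order, as an embedding. -/
def tailLegs (n M : ℕ) (k : Fin (n + 1)) : Fin (M + 1 + n) :=
  ⟨M + n - k, by omega⟩

theorem tailLegs_injective (n M : ℕ) : Function.Injective (tailLegs n M) := by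
  intro k l h
  have := congrArg Fin.val h
  simp only [tailLegs] at this
  omega

theorem tailLegs_last : tailLegs n M (Fin.last n) = Fin.castAdd n (Fin.last M) := by
  ext
  simp [tailLegs]

theorem tailLegs_castSucc (k : Fin n) : tailLegs n M k.castSucc = Fin.natAdd (M + 1) k.rev := by
  ext
  simp only [tailLegs, Fin.val_castSucc, Fin.val_natAdd, Fin.val_rev]
  omega

theorem finRange_map_natAdd (n M : ℕ) :
    (List.finRange n).map (Fin.natAdd (M + 1)) =
      (List.finRange n).reverse.map fun k => tailLegs n M k.castSucc := by
  rw [List.finRange_reverse, List.map_map]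
  refine List.map_congr_left fun k _ => ?_
  rw [Function.comp_apply, tailLegs_castSucc, Fin.rev_rev]

/-- The bracket splits off an operator with an explicit inverse. -/
theorem bracket_finRange_mul_dualHom {q : K} (hq : q ≠ 0)
    {S : Matrix (Fin (n + 1 + M)) (Fin (n + 1 + M)) A⟦X⟧} (hS : IsUnit S) :
    bracket q S (List.finRange (M + 1 + n)) *
        dualHom hq (q ^ (2 - ((n + 1 + M : ℕ) : ℤ))) (tailLegs n M) (tailLegs_injective n M)
          (auxiliaryBracket q⁻¹ (xMatrix q S) n) =
      onLegs (Fin.castAdd n) (bracket q S (List.finRange (M + 1))) *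
        ((List.finRange M).map fun i => ((List.finRange n).map fun l =>
          rBarT A (n + 1 + M) q (Fin.castAdd n i.castSucc) (Fin.natAdd (M + 1) l)).prod).prod := by
  have hnd : ((List.finRange (M + 1)).map (Fin.castAdd n) ++
      (List.finRange n).map (Fin.natAdd (M + 1))).Nodup := by
    rw [← finRange_add]
    exact List.nodup_finRange _
  have h := tail_mul_dualHom hq hS (tailLegs_injective n M) fun k => by
    simp only [tailLegs]
    omega
  rw [tailLegs_last, ← finRange_map_natAdd] at h
  have h' : (List.finRange n).reverse.map (fun k => rBarT A (n + 1 + M) q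
      (Fin.castAdd n (Fin.last M)) (tailLegs n M k.castSucc)) =
      ((List.finRange n).map (Fin.natAdd (M + 1))).map
        (rBarT A (n + 1 + M) q (Fin.castAdd n (Fin.last M))) := by
    rw [finRange_map_natAdd, List.map_map]
    rfl
  rw [h'] at h
  rw [finRange_add, bracket_append q S hnd, onLegs_bracket_castAdd, List.finRange_succ_last,
    List.map_append, List.map_append, List.prod_append, List.map_cons, List.map_cons,
    List.map_nil, List.map_nil, List.prod_cons, List.prod_nil, mul_one]
  simp only [Matrix.mul_assoc] at h ⊢
  -- The factors joining the site M to the tail and the tail bracket cancel against the dual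
  -- operator; the cross factors at the earlier sites remain.
  rw [h, Matrix.mul_one, List.map_map, List.map_map]
  congr 3
  funext i
  simp only [Function.comp_apply, List.map_map]
  rfl

/-- The column that is common to both sides of the complementary minor identity. -/
def columnWord (a b : Fin (n + 1)) : Fin (M + 1 + n) → Fin (n + 1 + M) :=
  Fin.append (Fin.snoc (α := fun _ => Fin (n + 1 + M)) (Fin.natAdd (n + 1)) (Fin.castAdd M b))
    (tailWord n M a)

/-- Read along the reversed legs, the decreasing tail becomes increasing and `b` comes last, as in
the column of the auxiliary minor. -/
theorem columnWord_comp_tailLegs (a b : Fin (n + 1)) :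
    (columnWord a b : Fin (M + 1 + n) → _) ∘ tailLegs n M =
      Fin.snoc (α := fun _ => Fin (n + 1 + M)) (fun k => Fin.castAdd M (a.succAbove k))
        (Fin.castAdd M b) := by
  funext k
  cases k using Fin.lastCases with
  | last => rw [Function.comp_apply, tailLegs_last, columnWord, Fin.append_left, Fin.snoc_last,
      Fin.snoc_last]
  | cast k => rw [Function.comp_apply, tailLegs_castSucc, columnWord, Fin.append_right, tailWord,
      Fin.rev_rev, Fin.snoc_castSucc]

theorem extend_castAdd_columnWord (a b : Fin (n + 1)) (L : Fin (M + 1) → Fin (n + 1 + M)) :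
    Function.extend (Fin.castAdd n) L (columnWord a b) = Fin.append L (tailWord n M a) := by
  funext p
  induction p using Fin.addCases with
  | left p => rw [(Fin.castAdd_injective _ _).extend_apply, Fin.append_left]
  | right p =>
    rw [Function.extend_apply', columnWord, Fin.append_right, Fin.append_right]
    rintro ⟨i, hi⟩
    exact (castAdd_lt_natAdd i p).ne hi

theorem extend_tailLegs_columnWord (h : M + 1 + n = M + (n + 1)) (a b : Fin (n + 1))
    (L : Fin (n + 1) → Fin (n + 1 + M)) :
    Function.extend (tailLegs n M) L (columnWord a b) =
      Fin.append (Fin.natAdd (n + 1)) (L ∘ Fin.rev) ∘ Fin.cast h := by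
  funext p
  by_cases hp : (p : ℕ) < M
  · obtain ⟨i, rfl⟩ : ∃ i : Fin M, Fin.castAdd n i.castSucc = p := ⟨⟨p, hp⟩, rfl⟩
    have e2 : Fin.cast h (Fin.castAdd n i.castSucc) = Fin.castAdd (n + 1) i := rfl
    rw [Function.extend_apply', Function.comp_apply, e2, Fin.append_left, columnWord,
      Fin.append_left, Fin.snoc_castSucc]
    · rintro ⟨k, hk⟩
      have := congrArg Fin.val hk
      simp only [tailLegs] at this
      omega
  · obtain ⟨k, rfl⟩ : ∃ k, tailLegs n M k = p := by
      refine ⟨⟨M + n - p, by omega⟩, Fin.ext ?_⟩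
      simp only [tailLegs]
      omega
    have e2 : Fin.cast h (tailLegs n M k) = Fin.natAdd M k.rev := by
      ext
      simp only [tailLegs, Fin.val_cast, Fin.val_natAdd, Fin.val_rev]
      omega
    rw [(tailLegs_injective n M).extend_apply, Function.comp_apply, e2, Fin.append_right,
      Function.comp_apply, Fin.rev_rev]

/-- Moving `b` from the last place to the first passes `M` larger letters and so removes `M`
inversions. -/
theorem sklyaninMinor_snoc [CharZero K] {q : K} (hq : q ≠ 0) (hq2 : q ^ 2 ≠ 1)
    {S : Matrix (Fin (n + 1 + M)) (Fin (n + 1 + M)) A⟦X⟧} (hS : SatisfiesReflection q S)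
    (I : Fin (M + 1) → Fin (n + 1 + M)) (b : Fin (n + 1)) :
    sklyaninMinor q S I
        (Fin.snoc (α := fun _ => Fin (n + 1 + M)) (Fin.natAdd (n + 1)) (Fin.castAdd M b)) =
      (-q) ^ (-(M : ℤ)) • sklyaninMinor q S I (consLast n M b) := by
  have e : Fin.snoc (α := fun _ => Fin (n + 1 + M)) (Fin.natAdd (n + 1)) (Fin.castAdd M b) =
      consLast n M b ∘ finRotate (M + 1) := Fin.snoc_eq_cons_rotate _ _
  have hinv : inversions (Fin.snoc (α := fun _ => Fin (n + 1 + M)) (Fin.natAdd (n + 1))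
      (Fin.castAdd M b)) = M := by
    rw [← Fin.append_right_eq_snoc (Fin.natAdd (n + 1)) (fun _ : Fin 1 => Fin.castAdd M b),
      inversions_append, inversions_eq_zero (Fin.strictMono_natAdd (n + 1)), inversions_eq_zero]
    · simp [castAdd_lt_natAdd]
    · exact Subsingleton.strictMono _
  rw [sklyaninMinor_eq, sklyaninMinor_eq, e, (isSkewRow_minor hq hq2 hS).apply_comp I
    (strictMono_consLast n M b).injective, ← e, hinv,
    inversions_eq_zero (strictMono_consLast n M b), Nat.cast_zero, zero_sub]

theorem auxiliaryMinor_eq [CharZero K] (q : K) (S : Matrix (Fin d) (Fin d) A⟦X⟧)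
    (I : Fin (n + 1) → Fin d) (J : Fin n → Fin d) (c : Fin d) :
    auxiliaryMinor q S I J c =
      (alternator A d (n + 1) q * auxiliaryBracket q S n) I
        (Fin.snoc (α := fun _ => Fin d) J c) := by
  rw [auxiliaryMinor, factorial_smul_qAntisymmetrizer, auxiliaryBracket, Matrix.mul_assoc]

theorem scaleArg_alternator (q c : K) (I J : Fin m → Fin d) :
    scaleArg c (alternator A d m q I J) = alternator A d m q I J :=
  scaleArg_constSeries c _

theorem alternator_mul_onLegs_apply {q : K} (hq : q ≠ 0) (h : M + 1 + n = n + 1 + M)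
    (a b : Fin (n + 1))
    (T : Matrix (Fin (M + 1) → Fin (n + 1 + M)) (Fin (M + 1) → Fin (n + 1 + M)) A⟦X⟧) :
    (alternator A (n + 1 + M) (M + 1 + n) q * onLegs (Fin.castAdd n) T) (Fin.cast h)
        (columnWord a b) =
      (-q) ^ (-((a : ℤ) + M * n + pairCount n)) •
        (alternator A (n + 1 + M) (M + 1) q * T) (consLast n M a)
          (Fin.snoc (α := fun _ => Fin (n + 1 + M)) (Fin.natAdd (n + 1)) (Fin.castAdd M b)) := by
  have hK : (columnWord a b : Fin (M + 1 + n) → _) ∘ Fin.castAdd n =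
      Fin.snoc (α := fun _ => Fin (n + 1 + M)) (Fin.natAdd (n + 1)) (Fin.castAdd M b) := by
    funext p
    exact Fin.append_left _ _ p
  rw [mul_onLegs_apply (Fin.castAdd_injective _ _), hK, Matrix.mul_apply, Finset.smul_sum]
  refine Finset.sum_congr rfl fun L _ => ?_
  rw [extend_castAdd_columnWord, alternator_append_tailWord hq h, smul_mul_assoc]

theorem alternator_mul_dualHom_apply [CharZero K] {q : K} (hq : q ≠ 0)
    (h : M + 1 + n = n + 1 + M) (c : K) (a b : Fin (n + 1))
    (T : Matrix (Fin (n + 1) → Fin (n + 1 + M)) (Fin (n + 1) → Fin (n + 1 + M)) A⟦X⟧) :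
    (alternator A (n + 1 + M) (M + 1 + n) q *
        dualHom hq c (tailLegs n M) (tailLegs_injective n M) T) (Fin.cast h) (columnWord a b) =
      (-q) ^ (-((M : ℤ) * (n + 1) + pairCount (n + 1)) + ((b : ℤ) - a)) •
        scaleArg c ((alternator A (n + 1 + M) (n + 1) q⁻¹ * T) (Fin.castAdd M)
          (Fin.snoc (α := fun _ => Fin (n + 1 + M)) (fun k => Fin.castAdd M (a.succAbove k))
            (Fin.castAdd M b))) := by
  rw [dualHom_apply, mul_onLegs_apply (tailLegs_injective n M), columnWord_comp_tailLegs,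
    Matrix.mul_apply, ← scaleHom_apply, map_sum, Finset.smul_sum]
  refine Finset.sum_congr rfl fun L _ => ?_
  rw [extend_tailLegs_columnWord (by omega), alternator_append_rev hq h, map_mul, scaleHom_apply,
    scaleHom_apply, scaleArg_alternator]
  by_cases hL : ∃ σ : Equiv.Perm (Fin (n + 1)), L = Fin.castAdd M ∘ σ
  · have hw : ∑ p, (((Fin.snoc (α := fun _ => Fin (n + 1 + M))
        (fun k => Fin.castAdd M (a.succAbove k)) (Fin.castAdd M b) : Fin (n + 1) → _) p : ℤ) -
          (L p : ℤ)) = (b : ℤ) - a := by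
      obtain ⟨σ, rfl⟩ := hL
      have h1 : ∑ p, (((Fin.castAdd M ∘ σ) p : Fin (n + 1 + M)) : ℤ) = ∑ p : Fin (n + 1), (p : ℤ) :=
        Equiv.sum_comp σ fun p : Fin (n + 1) => (p : ℤ)
      rw [Finset.sum_sub_distrib, h1, Fin.sum_univ_castSucc, Fin.sum_univ_succAbove _ a]
      simp only [Fin.snoc_castSucc, Fin.snoc_last, Fin.val_castAdd]
      ring
    rw [wordConj, Matrix.of_apply, hw, Matrix.map_apply, smul_mul_smul_comm,
      ← zpow_add₀ (neg_ne_zero.mpr hq)]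
  · rw [alternator_apply_eq_zero q⁻¹ fun σ e => hL ⟨σ, e⟩, smul_zero, zero_mul, zero_mul, smul_zero]

/-- Sklyanin minors as complementary auxiliary minors of the inverse matrix. -/
theorem sklyaninMinor_complement [CharZero K] {q : K} (hq : q ≠ 0) (hq2 : q ^ 2 ≠ 1)
    {S : Matrix (Fin (n + 1 + M)) (Fin (n + 1 + M)) A⟦X⟧} (hS : IsUnit S)
    (hR : SatisfiesReflection q S) (a b : Fin (n + 1)) :
    sklyaninMinor q S (consLast n M a) (consLast n M b) =
      (-q) ^ ((b : ℤ) - n) • (sklyaninDet q S *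
        scaleArg (q ^ (2 - ((n + 1 + M : ℕ) : ℤ)))
          (auxiliaryMinor q⁻¹ (xMatrix q S) (Fin.castAdd M)
            (fun k => Fin.castAdd M (a.succAbove k)) (Fin.castAdd M b))) := by
  have h : M + 1 + n = n + 1 + M := by omega
  have hq' : -q ≠ 0 := neg_ne_zero.mpr hq
  set c := q ^ (2 - ((n + 1 + M : ℕ) : ℤ)) with hc
  have key := congrArg (fun P => (alternator A (n + 1 + M) (M + 1 + n) q * P) (Fin.cast h)
    (columnWord a b)) (bracket_finRange_mul_dualHom hq hS)
  rw [← Matrix.mul_assoc, ← Matrix.mul_assoc, mul_list_prod_apply, alternator_mul_onLegs_apply hq h,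
    ← sklyaninMinor_eq, sklyaninMinor_snoc hq hq2 hR, Matrix.mul_apply] at key
  -- The Sklyanin determinant is a left factor of every summand and leaves the sum; the rest is an
  -- entry of antisymmetrizer times dual operator.
  · simp only [alternator_mul_bracket_apply hq hq2 hR h, mul_assoc] at key
    rw [← Finset.mul_sum, ← Matrix.mul_apply, ← hc, alternator_mul_dualHom_apply hq h,
      ← auxiliaryMinor_eq, mul_smul_comm, smul_smul, ← zpow_add₀ hq'] at key
    -- This power clears the factor in front of the minor. The exponents then add up to b +
    -- `pairCount n` − `pairCount (n + 1)` = b − n.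
    have := congrArg (fun f => (-q) ^ ((a : ℤ) + M * n + pairCount n + M) • f) key.symm
    simp only [smul_smul, ← zpow_add₀ hq'] at this
    rw [show (a : ℤ) + M * n + pairCount n + M + (-(a + M * n + pairCount n) + -M) = 0 by ring,
      zpow_zero, one_smul] at this
    rw [this, pairCount_succ]
    congr 2
    push_cast
    ring
  -- The leftover cross factors join a site carrying a letter from the last M to a tail site
  -- carrying one of the first n + 1, so the letters differ and each factor acts trivially.
  · simp only [List.mem_map]
    rintro _ ⟨i, -, rfl⟩ V I
    refine mul_list_prod_apply _ ?_ V I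
    simp only [List.mem_map]
    rintro _ ⟨l, -, rfl⟩ V I
    refine mul_rBarT_apply q V I ?_
    rw [columnWord, Fin.append_left, Fin.append_right, Fin.snoc_castSucc]
    exact (castAdd_lt_natAdd _ i).ne'

end Complement

end TwistedQ

end

open TwistedQ in
/-- Here `N = n + 1`, `S(u)` is the generator matrix of size `N + M`, and the indices `a`, `b` are
counted from `0`, so that the exponent `b - N` reads `(b + 1) - N`. -/
theorem mainTheorem9 {K : Type*} [Field K] [CharZero K] (q : K) (hq0 : q ≠ 0)
    (hq : ∀ r : ℕ, 0 < r → q ^ r ≠ 1) (g : SymmetryType) (n M : ℕ)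
    (hg : g = SymmetryType.symplectic → Even (n + 1 + M)) :
    IsUnit (sMatrix K q (n + 1 + M) g) ∧
    ∀ a b : Fin (n + 1),
      sklyaninMinor q (sMatrix K q (n + 1 + M) g)
          (Fin.cons (α := fun _ => Fin (n + 1 + M)) (Fin.castAdd M a) (Fin.natAdd (n + 1)))
          (Fin.cons (α := fun _ => Fin (n + 1 + M)) (Fin.castAdd M b) (Fin.natAdd (n + 1))) =
        (-q) ^ (((b : ℤ) + 1) - ((n + 1 : ℕ) : ℤ)) •
          (sklyaninDet q (sMatrix K q (n + 1 + M) g) *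
            scaleArg (q ^ (2 - ((n + 1 : ℕ) : ℤ) - (M : ℤ)))
              (auxiliaryMinor q⁻¹ (xMatrix q (sMatrix K q (n + 1 + M) g))
                (Fin.castAdd M) (fun k => Fin.castAdd M (a.succAbove k)) (Fin.castAdd M b))) := by
  have hq2 := hq 2 two_pos
  have hu := isUnit_sMatrix (K := K) (g := g) hq0 hg
  refine ⟨hu, fun a b => ?_⟩
  rw [show ((b : ℤ) + 1) - ((n + 1 : ℕ) : ℤ) = (b : ℤ) - n by push_cast; ring,
    show (2 - ((n + 1 : ℕ) : ℤ) - (M : ℤ)) = 2 - ((n + 1 + M : ℕ) : ℤ) by push_cast; ring]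
  exact sklyaninMinor_complement hq0 hq2 hu (satisfiesReflection_sMatrix hq0 hq2 g) a b
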